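/- **Setting.** Let $n,m,d,T\ge 1$. Consider a linear dynamical system with matrices $A\in\mathbb R^{d\times d}$, $B\in\mathbb R^{d\times n}$, $C\in\mathbb R^{m\times d}$, $D\in\mathbb R^{m\times n}$, inputs $x_t\in\mathbb R^n$ and adversarial noise $\eta_t\in\mathbb R^d,\ \xi_t\in\mathbb R^m$: $h_0=0$, $$h_t=Ah_{t-1}+Bx_t+\eta_t,\qquad y_t=Ch_t+Dx_t+\xi_t\qquad(1\le t\le T).$$ (A nonzero initial state is treated as noise in the first step.) Let $R_\Theta,R_x,R_y\ge 1$ and $R_\Psi,R_1,R_\infty$ be reals and $\tau\in\mathbb N$. Assume: 1. $\|x_t\|_2\le R_x$ and $\|y_t\|_2\le R_y$ for $1\le t\le T$; the spectral norms of $B,C,D$ are at most $R_\Theta$; 2. $A=\Psi\Lambda\Psi^{-1}$ with $\Psi$ complex invertible, $\|\Psi\|_F\|\Psi^{-1}\|_F\le R_\Psi$, and $\Lambda=\mathrm{diag}(r_\ell\omega_\ell)_{\ell\le d}$ with $|\omega_\ell|=1$, $0\le r_\ell\le 1$; 3. some monic real polynomial of degree $\tau$ vanishes at all $\omega_\ell$,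 the sum of the absolute values of its coefficients is at most $R_1$, and each coefficient has absolute value at most $R_\infty$; 4. $\sum_{t=1}^T(\|\eta_t\|_2^2+\|\xi_t\|_2^2)\le L$. Let $R$ be such that $R_1^3R_x^2R_\Theta^4R_\Psi^2R_y^2\le R$. **Algorithm.** The parameters are integers $\tau'\ge 3$, $1\le k\le T$, $W\ge 3$ and reals $R_{\hat\Theta},\lambda>0$. Let $(\sigma_h,\phi_h)_{h\le k}$ be the top $k$ orthonormal eigenpairs (eigenvalues in decreasing order) of the $T\times T$ matrix with entries $\frac{2}{(i+j)^3-(i+j)}$, $1\le i,j\le T$. A pseudo-LDS $\hat\Theta=(M,N,\beta,P)$ consists of matrices $M(p,h),N(p,h)\in\mathbb R^{m\times n}$ ($0\le p<W$, $1\le h\le k$), $\beta\in\mathbb R^{\tau'}$ and $P_0,\dots,P_{\tau'-1}\in\mathbb R^{m\times n}$. Its prediction at time $t$ is, with $x_s=0$, $y_s=0$ for $s\le 0$, $$\hat y_t(\hat\Theta)=\sum_{u=1}^{\tau'}\beta_uy_{t-u}+\sum_{j=0}^{\tau'-1}P_jx_{t-j}+\sum_{p=0}^{W-1}\sum_{h=1}^k\sum_{u=1}^T\Big[M(p,h)\cos\tfrac{2\pi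 up}{W}+N(p,h)\sin\tfrac{2\pi up}{W}\Big]\sigma_h^{1/4}\phi_h(u)\,x_{t-\tau'-u+1}.$$ Put $\|M\|_{2,q}=\big(\sum_p(\sum_h\|M(p,h)\|_F^2)^{q/2}\big)^{1/q}$. The decision set $\mathcal K$ consists of the pseudo-LDSs with $\|M\|_{2,1}+\|N\|_{2,1}+\|\beta\|_1+(\sum_j\|P_j\|_F^2)^{1/2}\le R_{\hat\Theta}$, and the regularizer is $$\mathcal R(\hat\Theta)=\|M\|_{2,q}^2+\|N\|_{2,q}^2+\|\beta\|_{q'}^2+\sum_j\|P_j\|_F^2,\qquad q=\tfrac{\ln W}{\ln W-1},\quad q'=\tfrac{\ln\tau'}{\ln\tau'-1}.$$ The algorithm (follow the regularized leader) starts with an arbitrary $\hat\Theta_1\in\mathcal K$. At time $t$ it predicts $\hat y_t=\hat y_t(\hat\Theta_t)$, observes $y_t$, and takes $\hat\Theta_{t+1}$ to be any minimizer over $\hat\Theta\in\mathcal K$ of $\sum_{u=1}^t\|\hat y_u(\hat\Theta)-y_u\|_2^2+\mathcal R(\hat\Theta)/\lambda$. **Theorem.** There are absolute constants $c\in\mathbb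 N$ and $C_2>0$ and, for every $K$, a constant $C_1>0$ depending only on $K$, such that the following holds whenever $\tau\le Kd$. There are parameters $\tau',k,W,R_{\hat\Theta},\lambda$, chosen knowing only $n,m,d,\tau,T,R_\Theta,R_\Psi,R_1,R_\infty,R_x,R_y,R$ (and not the system, the inputs, the noise or $L$), such that for every system, inputs and noise satisfying the assumptions, every run of the algorithm satisfies $$\sum_{t=1}^T\|\hat y_t-y_t\|_2^2\le C_1\big(1+\ln(n\,m\,d\,R_\Theta R_xR_yT)\big)^c\,R\,d^{5/2}\,n\sqrt T+C_2\,R_\infty^2\,\tau^3R_\Theta^2R_\Psi^2\,L.$$ -/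

import Mathlib

noncomputable section

/-- Spectral norm of a real matrix (operator norm between Euclidean spaces). -/
def specNorm {m n : ℕ} (A : Matrix (Fin m) (Fin n) ℝ) : ℝ :=
  ‖A.toEuclideanLin.toContinuousLinearMap‖

/-- Frobenius norm of a real or complex matrix. -/
def frobNorm {𝕜 : Type*} [RCLike 𝕜] {m n : ℕ} (A : Matrix (Fin m) (Fin n) 𝕜) : ℝ :=
  √(∑ i, ∑ j, ‖A i j‖ ^ 2)

/-- Signals are indexed by the times `1, 2, …`; the value `j` steps before time `t`
is zero if it lies before time `1`. -/
def lag {n : ℕ} (x : ℕ → EuclideanSpace ℝ (Fin n)) (t j : ℕ) : EuclideanSpace ℝ (Fin n) :=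
  if j < t then x (t - j) else 0

/-! ### Linear dynamical systems with adversarial noise -/

/-- The matrices of a linear dynamical system with inputs in `ℝⁿ`, outputs in `ℝᵐ` and
hidden states in `ℝᵈ`. -/
structure LDS (n m d : ℕ) where
  A : Matrix (Fin d) (Fin d) ℝ
  B : Matrix (Fin d) (Fin n) ℝ
  C : Matrix (Fin m) (Fin d) ℝ
  D : Matrix (Fin m) (Fin n) ℝ

/-- Hidden states: `h₀ = 0` and `hₜ = A hₜ₋₁ + B xₜ + ηₜ`. -/
def LDS.state {n m d : ℕ} (S : LDS n m d) (x : ℕ → EuclideanSpace ℝ (Fin n))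
    (η : ℕ → EuclideanSpace ℝ (Fin d)) : ℕ → EuclideanSpace ℝ (Fin d)
  | 0 => 0
  | t + 1 => S.A.toEuclideanLin (S.state x η t) + S.B.toEuclideanLin (x (t + 1)) + η (t + 1)

/-- Outputs: `yₜ = C hₜ + D xₜ + ξₜ`. -/
def LDS.output {n m d : ℕ} (S : LDS n m d) (x : ℕ → EuclideanSpace ℝ (Fin n))
    (η : ℕ → EuclideanSpace ℝ (Fin d)) (ξ : ℕ → EuclideanSpace ℝ (Fin m)) (t : ℕ) :
    EuclideanSpace ℝ (Fin m) :=
  S.C.toEuclideanLin (S.state x η t) + S.D.toEuclideanLin (x t) + ξ t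

/-- The assumptions on the system: `B, C, D` have spectral norm at most `RΘ`;
`A = Ψ Λ Ψ⁻¹` with `‖Ψ‖_F ‖Ψ⁻¹‖_F ≤ RΨ` and `Λ` the diagonal matrix of the eigenvalues `r_ℓ ω_ℓ`,
where `|ω_ℓ| = 1` and `0 ≤ r_ℓ ≤ 1` (so the spectral radius is at most one); and some monic real
polynomial of degree `τ` vanishes at all phases `ω_ℓ` and has coefficients of `ℓ¹` norm at most
`R₁` and of `ℓ^∞` norm at most `Rinf`. -/
def LDS.SatisfiesAssumptions {n m d : ℕ} (S : LDS n m d) (τ : ℕ) (RΘ RΨ R₁ Rinf : ℝ) : Prop :=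
  specNorm S.B ≤ RΘ ∧ specNorm S.C ≤ RΘ ∧ specNorm S.D ≤ RΘ ∧
  ∃ (Ψ : Matrix (Fin d) (Fin d) ℂ) (r : Fin d → ℝ) (ω : Fin d → ℂ) (p : Polynomial ℝ),
    IsUnit Ψ.det ∧
    S.A.map Complex.ofReal = Ψ * Matrix.diagonal (fun l => (r l : ℂ) * ω l) * Ψ⁻¹ ∧
    frobNorm Ψ * frobNorm Ψ⁻¹ ≤ RΨ ∧
    (∀ l, 0 ≤ r l ∧ r l ≤ 1 ∧ ‖ω l‖ = 1) ∧
    p.Monic ∧ p.natDegree = τ ∧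
    (∀ l, Polynomial.aeval (ω l) p = 0) ∧
    ∑ j ∈ Finset.range (τ + 1), |p.coeff j| ≤ R₁ ∧
    ∀ j, |p.coeff j| ≤ Rinf

/-! ### Wavefilters -/

/-- The Hankel matrix with entries `2 / ((i + j)³ - (i + j))` for `1 ≤ i, j ≤ T`. -/
def hankel (T : ℕ) : Matrix (Fin T) (Fin T) ℝ := fun i j =>
  2 / ((((i : ℕ) + 1 : ℝ) + ((j : ℕ) + 1 : ℝ)) ^ 3 - (((i : ℕ) + 1 : ℝ) + ((j : ℕ) + 1 : ℝ)))

/-- `(σ_h, φ_h)` are the top `k` eigenpairs of the Hankel matrix, in decreasing order of the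
eigenvalues and with orthonormal eigenvectors (the wavefilters). -/
def IsTopEigenpairs (T k : ℕ) (σ : Fin k → ℝ) (φ : Fin k → EuclideanSpace ℝ (Fin T)) : Prop :=
  Orthonormal ℝ φ ∧ Antitone σ ∧
  (∀ h, (hankel T).toEuclideanLin (φ h) = σ h • φ h) ∧
  ∀ (v : EuclideanSpace ℝ (Fin T)) (μ : ℝ), v ≠ 0 → (hankel T).toEuclideanLin v = μ • v →
    (∀ h, inner ℝ (φ h) v = 0) → ∀ h, μ ≤ σ h

/-! ### Pseudo-LDSs -/

/-- A pseudo-LDS `(M, N, β, P)`, where `P j` stands for `P_j` and `β u` for `β_{u+1}`. -/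
structure PseudoLDS (n m τ k W : ℕ) where
  M : Fin W → Fin k → Matrix (Fin m) (Fin n) ℝ
  N : Fin W → Fin k → Matrix (Fin m) (Fin n) ℝ
  β : Fin τ → ℝ
  P : Fin τ → Matrix (Fin m) (Fin n) ℝ

/-- The wavefiltered input `σ^{1/4} ∑_{u=1}^T φ(u) g(u) x_{t-τ-u+1}`, i.e. `σ^{1/4}` times the
convolution of `(φ(u) g(u))_{1 ≤ u ≤ T}` with the input, evaluated at time `t - τ`. -/
def filtered {n T : ℕ} (τ : ℕ) (σ : ℝ) (φ : EuclideanSpace ℝ (Fin T)) (g : ℕ → ℝ)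
    (x : ℕ → EuclideanSpace ℝ (Fin n)) (t : ℕ) : EuclideanSpace ℝ (Fin n) :=
  σ ^ (1 / 4 : ℝ) • ∑ u : Fin T, (φ u * g ((u : ℕ) + 1)) • lag x t (τ + u)

/-- The prediction of a pseudo-LDS at time `t`, from `x₁, …, xₜ` and `y_{t-τ}, …, y_{t-1}`. -/
def PseudoLDS.predict {n m τ k W T : ℕ} (θ : PseudoLDS n m τ k W) (σ : Fin k → ℝ)
    (φ : Fin k → EuclideanSpace ℝ (Fin T)) (x : ℕ → EuclideanSpace ℝ (Fin n))
    (y : ℕ → EuclideanSpace ℝ (Fin m)) (t : ℕ) : EuclideanSpace ℝ (Fin m) :=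
  ∑ u : Fin τ, θ.β u • lag y t ((u : ℕ) + 1) +
  ∑ j : Fin τ, (θ.P j).toEuclideanLin (lag x t j) +
  ∑ p : Fin W, ∑ h : Fin k,
    ((θ.M p h).toEuclideanLin
        (filtered τ (σ h) (φ h) (fun u => Real.cos (2 * Real.pi * u * (p : ℕ) / W)) x t) +
      (θ.N p h).toEuclideanLin
        (filtered τ (σ h) (φ h) (fun u => Real.sin (2 * Real.pi * u * (p : ℕ) / W)) x t))

/-- `‖M‖_{2,q} = (∑_p ‖M(p,:,:,:)‖_F^q)^{1/q}`. -/
def norm2q {m n k W : ℕ} (q : ℝ) (M : Fin W → Fin k → Matrix (Fin m) (Fin n) ℝ) : ℝ :=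
  (∑ p, √(∑ h, frobNorm (M p h) ^ 2) ^ q) ^ (1 / q)

/-- `‖β‖_q = (∑_u |β_u|^q)^{1/q}`. -/
def normq {τ : ℕ} (q : ℝ) (β : Fin τ → ℝ) : ℝ := (∑ u, |β u| ^ q) ^ (1 / q)

/-- The composite norm `‖M‖_{2,1} + ‖N‖_{2,1} + ‖β‖₁ + (∑_j ‖P_j‖_F²)^{1/2}`. -/
def PseudoLDS.compNorm {n m τ k W : ℕ} (θ : PseudoLDS n m τ k W) : ℝ :=
  norm2q 1 θ.M + norm2q 1 θ.N + normq 1 θ.β + √(∑ j, frobNorm (θ.P j) ^ 2)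

/-- The exponent `ln s / (ln s - 1)`. -/
def regExponent (s : ℕ) : ℝ := Real.log s / (Real.log s - 1)

/-- The regularizer `‖M‖²_{2,q} + ‖N‖²_{2,q} + ‖β‖²_{q'} + ∑_j ‖P_j‖_F²` with
`q = ln W / (ln W - 1)` and `q' = ln τ / (ln τ - 1)`. -/
def PseudoLDS.regularizer {n m τ k W : ℕ} (θ : PseudoLDS n m τ k W) : ℝ :=
  norm2q (regExponent W) θ.M ^ 2 + norm2q (regExponent W) θ.N ^ 2 +
    normq (regExponent τ) θ.β ^ 2 + ∑ j, frobNorm (θ.P j) ^ 2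

/-! ### The algorithm -/

/-- Parameters of the algorithm: autoregression length, number of wavefilters, number of phases,
radius of the decision set, and the learning rate of follow-the-regularized-leader. -/
structure AlgParams where
  τ : ℕ
  k : ℕ
  W : ℕ
  radius : ℝ
  rate : ℝ

/-- Admissible parameters for the horizon `T`. There are only `T` wavefilters; the exponents of the
regularizer exceed one exactly when `W, τ ≥ 3`. -/
def AlgParams.Valid (a : AlgParams) (T : ℕ) : Prop :=
  3 ≤ a.τ ∧ 1 ≤ a.k ∧ a.k ≤ T ∧ 3 ≤ a.W ∧ 0 < a.radius ∧ 0 < a.rate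

/-- The decision set: pseudo-LDSs of composite norm at most the radius. -/
def AlgParams.decisionSet (a : AlgParams) (n m : ℕ) : Set (PseudoLDS n m a.τ a.k a.W) :=
  {θ | θ.compNorm ≤ a.radius}

/-- The objective `∑_{u=1}^t ‖y(θ; x_{1:u}, y_{u-1:u-τ}) - y_u‖² + R(θ) / rate` that is minimized
after round `t`. -/
def AlgParams.objective {n m T : ℕ} (a : AlgParams) (σ : Fin a.k → ℝ)
    (φ : Fin a.k → EuclideanSpace ℝ (Fin T)) (x : ℕ → EuclideanSpace ℝ (Fin n))
    (y : ℕ → EuclideanSpace ℝ (Fin m)) (t : ℕ) (θ : PseudoLDS n m a.τ a.k a.W) : ℝ :=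
  ∑ u ∈ Finset.Icc 1 t, ‖θ.predict σ φ x y u - y u‖ ^ 2 + θ.regularizer / a.rate

/-- `θ₁, …, θ_T` is a run of the algorithm on inputs `x` and observed outputs `y`: `θ₁` is an
arbitrary element of the decision set, and `θ_{t+1}` minimizes the objective of the first `t`
rounds over the decision set. -/
def AlgParams.IsRun {n m T : ℕ} (a : AlgParams) (σ : Fin a.k → ℝ)
    (φ : Fin a.k → EuclideanSpace ℝ (Fin T)) (x : ℕ → EuclideanSpace ℝ (Fin n))
    (y : ℕ → EuclideanSpace ℝ (Fin m)) (θ : ℕ → PseudoLDS n m a.τ a.k a.W) : Prop :=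
  θ 1 ∈ a.decisionSet n m ∧
  ∀ t, 1 ≤ t → t < T →
    θ (t + 1) ∈ a.decisionSet n m ∧
    IsMinOn (a.objective σ φ x y t) (a.decisionSet n m) (θ (t + 1))

end

/-! The competitor is purely autoregressive (`M = N = 0`). If a filter `f` has `f 0 = 1`, then `f *
y = y_t + (past outputs)`. By superposition, `f * y` is also a convolution of the inputs with the
filtered impulse response, plus filtered noise. Moving the past outputs across gives a predictor
whose error is the impulse response beyond lag `N` plus the filtered noise. So `f` needs length
about `d²` up to logarithms, bounded `ℓ²` gain, bounded gain on the noise accumulated in the state,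
and an exponentially small response to every mode `r ω` beyond lag `N`.

Such an `f` is the real part of `annihilator`, a product over the distinct phases `ω` of truncations
of the notch `(1 - ωX) / (1 - ρωX)`. Near `ρ = 1` the notch has gain `2 / (1 + ρ)`, barely above one
(`truncNorm.one_sub_mul_le`), so the whole product has gain at most `e⁴`. Each phase gets one wide
notch and `J` narrow ones. The wide notch tames the noise response with gain `2 #S`, where `#S ≤ τ`
since the phases are roots of the given polynomial (`truncNorm_annihilator_mul_mode_le`). The narrow
ones make late responses of order `2^{-J}`: a mode near the unit circle loses a factor two at each
of them, and any other mode decays by itself (`norm_coeff_annihilator_mul_mode_le`). The result is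
`LDS.SatisfiesAssumptions.exists_competitor`.

The regret bound uses that the regularizer is strongly convex in the composite norm with a
logarithmic modulus (`mixed_norm_sq_midpoint_gap`), and that predictions are Lipschitz in that norm
with a constant `G`, because the scaled wavefilters have logarithmic `ℓ¹` norm
(`hankel_eigenvector_l1_le`). Be-the-leader then bounds the loss by twice that of the competitor
plus a multiple of `G² · radius²`, up to a logarithm (`AlgParams.IsRun.sum_loss_le`). This term is
of order `d⁶`, polynomial in logarithms of `T`.

If `T ≥ d⁷`, then `d⁶ ≤ d^{5/2} √T`. If `T < d⁷`, a tiny decision set bounds the loss by `4 Ry² T ≤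
4 Ry² d^{7/2} √T`, and the extra factor `d` is absorbed in `R` because `d ≤ RΨ²`. -/

/-! ### Strong convexity of squared mixed `(2, q)` norms. -/

section UniformConvexity

/-- Write `y ^ q = y exp((q - 1) log y) ≥ y + (q - 1) y log y`, and bound `y log y ≥ 2y - 2√y`
through `log √y ≥ 1 - 1/√y`. With `s = √y`, the excess of `2y - 2s` over `y - 1` is `(s - 1)² = (y -
1)² / (s + 1)²`, and `(s + 1)² ≤ 6` for `y ≤ 2`. -/
theorem rpow_ge_quadratic {q y : ℝ} (hq : 1 < q) (hy0 : 0 ≤ y) (hy2 : y ≤ 2) :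
    y + (q - 1) * ((y - 1) + (y - 1) ^ 2 / 6) ≤ y ^ q := by
  rcases hy0.eq_or_lt with rfl | hy
  · rw [Real.zero_rpow (by linarith)]; nlinarith
  set s := √y with hs
  have hs0 : 0 < s := Real.sqrt_pos.2 hy
  have hsy : s ^ 2 = y := Real.sq_sqrt hy.le
  have hlog : 2 * (1 - s⁻¹) ≤ Real.log y := by
    rw [← hsy, Real.log_pow]
    have := Real.one_sub_inv_le_log_of_pos hs0
    push_cast; linarith
  have h1 : y ^ q = y * y ^ (q - 1) := by
    rw [← Real.rpow_one_add' hy.le (by linarith)]; congr 1; ring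
  have h2 : 1 + (q - 1) * Real.log y ≤ y ^ (q - 1) := by
    rw [Real.rpow_def_of_pos hy]
    have := Real.add_one_le_exp (Real.log y * (q - 1)); linarith
  have h3 : 2 * y - 2 * s ≤ y * Real.log y := by
    have h := mul_le_mul_of_nonneg_left hlog hy.le
    have : y * (2 * (1 - s⁻¹)) = 2 * y - 2 * s := by
      rw [← hsy]; field_simp
    linarith
  have h4 : (y - 1) + (y - 1) ^ 2 / 6 ≤ 2 * y - 2 * s := by
    have hs2 : s ≤ 3 / 2 := by nlinarith
    have h6 : (s + 1) ^ 2 ≤ 7 := by nlinarith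
    have h5 : (s + 1) ^ 2 ≤ 6 := by
      have : s ≤ 1.4143 := by nlinarith
      nlinarith
    have : (y - 1) ^ 2 = (s - 1) ^ 2 * (s + 1) ^ 2 := by rw [← hsy]; ring
    have h7 : (s - 1) ^ 2 * (s + 1) ^ 2 ≤ (s - 1) ^ 2 * 6 :=
      mul_le_mul_of_nonneg_left h5 (sq_nonneg _)
    nlinarith
  rw [h1]
  have := mul_le_mul_of_nonneg_left h2 hy.le
  have h8 := mul_le_mul_of_nonneg_left (h4.trans h3) (by linarith : 0 ≤ q - 1)
  nlinarith

/-- Uniform convexity of `t ↦ t ^ q` on the nonnegative half-line. -/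
theorem rpow_midpoint_gap {q α β : ℝ} (hq : 1 < q) (hα : 0 ≤ α) (hβ : 0 ≤ β)
    (hs : 0 < (α + β) / 2) :
    ((α + β) / 2) ^ q + (q - 1) / 6 * ((α + β) / 2) ^ (q - 2) * ((α - β) / 2) ^ 2 ≤
      (α ^ q + β ^ q) / 2 := by
  set s := (α + β) / 2 with hsdef
  -- The ratios `α / s` and `β / s` lie in `[0, 2]` and are symmetric about `1`, so the linear terms
  -- cancel on averaging.
  have ha := rpow_ge_quadratic hq (div_nonneg hα hs.le) (by rw [div_le_iff₀ hs]; linarith)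
  have hb := rpow_ge_quadratic hq (div_nonneg hβ hs.le) (by rw [div_le_iff₀ hs]; linarith)
  rw [Real.div_rpow hα hs.le] at ha
  rw [Real.div_rpow hβ hs.le] at hb
  have hsq : 0 < s ^ q := Real.rpow_pos_of_pos hs _
  have h2 : s ^ (q - 2) = s ^ q / s ^ 2 := by
    rw [Real.rpow_sub hs]; norm_num
  rw [le_div_iff₀ hsq] at ha hb
  rw [h2]
  have e1 : β = 2 * s - α := by linarith
  have e2 : s ^ q + (q - 1) / 6 * (s ^ q / s ^ 2) * ((α - β) / 2) ^ 2 =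
      ((α / s + (q - 1) * ((α / s - 1) + (α / s - 1) ^ 2 / 6)) * s ^ q +
      (β / s + (q - 1) * ((β / s - 1) + (β / s - 1) ^ 2 / 6)) * s ^ q) / 2 := by
    rw [e1]; field_simp; ring
  rw [e2]; linarith

variable {E : Type*} [NormedAddCommGroup E] [InnerProductSpace ℝ E]

/-- Uniform convexity of the `q`-th power of a Hilbert space norm. -/
theorem norm_rpow_midpoint_gap {q : ℝ} (hq : 1 < q) (hq2 : q < 2) (a b : E) :
    ‖(1 / 2 : ℝ) • (a + b)‖ ^ q +
      (q - 1) / 24 * ((‖a‖ + ‖b‖) / 2) ^ (q - 2) * ‖a - b‖ ^ 2 ≤ (‖a‖ ^ q + ‖b‖ ^ q) / 2 := by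
  set s := (‖a‖ + ‖b‖) / 2 with hsdef
  have hs0 : 0 ≤ s := by positivity
  rcases hs0.eq_or_lt with h | hs
  · have ha : ‖a‖ = 0 := by linarith [norm_nonneg a, norm_nonneg b]
    have hb : ‖b‖ = 0 := by linarith [norm_nonneg a, norm_nonneg b]
    rw [norm_eq_zero] at ha hb
    subst ha; subst hb
    simp [Real.zero_rpow (by linarith : q ≠ 0)]
  set m := ‖(1 / 2 : ℝ) • (a + b)‖ with hm
  have hm0 : 0 ≤ m := norm_nonneg _
  have hm' : m = ‖a + b‖ / 2 := by
    rw [hm, norm_smul]; norm_num; ring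
  have hms : m ≤ s := by
    rw [hm', hsdef]; linarith [norm_add_le a b]
  have hpar : ‖a + b‖ ^ 2 + ‖a - b‖ ^ 2 = 2 * (‖a‖ ^ 2 + ‖b‖ ^ 2) := by
    have := parallelogram_law_with_norm ℝ a b
    nlinarith
  have hsq : 0 < s ^ q := Real.rpow_pos_of_pos hs _
  have h1 := rpow_midpoint_gap hq (norm_nonneg a) (norm_nonneg b) hs
  rw [← hsdef] at h1
  have h2 : s ^ (q - 2) = s ^ q / s ^ 2 := by
    rw [Real.rpow_sub hs]; norm_num
  have hu0 : 0 ≤ m / s := by positivity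
  have hu1 : m / s ≤ 1 := (div_le_one hs).2 hms
  have h3 : (m / s) ^ q ≤ m / s := by
    conv_rhs => rw [← Real.rpow_one (m / s)]
    exact Real.rpow_le_rpow_of_exponent_ge' hu0 hu1 (by norm_num) hq.le
  -- With `u = m / s ≤ 1`, this is `u ^ q ≤ u ≤ (1 + u²) / 2`.
  have h4 : m ^ q + s ^ (q - 2) * (1 / 2) * (s ^ 2 - m ^ 2) ≤ s ^ q := by
    rw [Real.div_rpow hm0 hs.le] at h3
    have h5 : m ^ q ≤ m / s * s ^ q := by rwa [div_le_iff₀ hsq] at h3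
    have h6 : s ^ (q - 2) * (1 / 2) * (s ^ 2 - m ^ 2) = (1 - (m / s) ^ 2) / 2 * s ^ q := by
      rw [h2]; field_simp
    have h7 : (1 - (m / s) ^ 2) / 2 ≤ 1 - m / s := by nlinarith
    have h8 := mul_le_mul_of_nonneg_right h7 hsq.le
    rw [h6]; linarith
  have hpos : 0 < s ^ (q - 2) := Real.rpow_pos_of_pos hs _
  have h9 : (q - 1) / 6 * s ^ (q - 2) * (s ^ 2 - m ^ 2) ≤
      s ^ (q - 2) * (1 / 2) * (s ^ 2 - m ^ 2) := by
    have : 0 ≤ s ^ 2 - m ^ 2 := by nlinarith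
    have h10 : (q - 1) / 6 * s ^ (q - 2) ≤ s ^ (q - 2) * (1 / 2) := by nlinarith
    exact mul_le_mul_of_nonneg_right h10 this
  -- By the parallelogram law `‖a - b‖² / 4` splits into `s² - m²`, paid for by `h4`, and the radial
  -- part `((‖a‖ - ‖b‖) / 2)²`, paid for by the scalar inequality.
  have h11 : (q - 1) / 24 * s ^ (q - 2) * ‖a - b‖ ^ 2 =
      (q - 1) / 6 * s ^ (q - 2) * (s ^ 2 - m ^ 2) +
      (q - 1) / 6 * s ^ (q - 2) * ((‖a‖ - ‖b‖) / 2) ^ 2 := by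
    rw [hm', hsdef]
    have : ‖a - b‖ ^ 2 = 2 * (‖a‖ ^ 2 + ‖b‖ ^ 2) - ‖a + b‖ ^ 2 := by linarith
    rw [this]; ring
  rw [h11]; linarith

open Finset in
/-- Power mean inequality comparing the exponents `2 - q` and `q`. -/
theorem sum_rpow_two_sub_le {ι : Type*} [Fintype ι] {q : ℝ} (hq : 1 < q) (hq2 : q < 2)
    (s : ι → ℝ) (hs : ∀ p, 0 ≤ s p) :
    ∑ p, s p ^ (2 - q) ≤
      (Fintype.card ι : ℝ) ^ (2 * (q - 1) / q) * (∑ p, s p ^ q) ^ ((2 - q) / q) := by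
  have hq0 : 0 < q := by linarith
  -- Hölder against the constant function `1`; its norm produces the power of the cardinality.
  have hconj : (q / (2 - q)).HolderConjugate (q / (2 * (q - 1))) := by
    rw [Real.holderConjugate_iff]
    constructor
    · rw [lt_div_iff₀ (by linarith)]; linarith
    · rw [inv_div, inv_div]; field_simp; ring
  have := Real.inner_le_Lp_mul_Lq (s := univ) (fun p => s p ^ (2 - q)) (fun _ => (1 : ℝ)) hconj
  simp only [mul_one, abs_one, Real.one_rpow, sum_const, card_univ, nsmul_eq_mul, one_div,
    inv_div] at this
  rw [mul_comm]
  convert this using 4 with p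
  rw [abs_of_nonneg (Real.rpow_nonneg (hs p) _), ← Real.rpow_mul (hs p)]
  congr 1
  have : 2 - q ≠ 0 := by linarith
  field_simp

open Finset in
/-- Midpoint strong convexity of the squared mixed `(2, q)` norm with respect to the mixed
`(2, 1)` norm. -/
theorem mixed_norm_sq_midpoint_gap {ι : Type*} [Fintype ι] {q : ℝ} (hq : 1 < q) (hq2 : q < 2)
    (a b : ι → E) :
    (∑ p, ‖(1 / 2 : ℝ) • (a p + b p)‖ ^ q) ^ (2 / q) +
      (q - 1) / (24 * (Fintype.card ι : ℝ) ^ (2 * (q - 1) / q)) * (∑ p, ‖a p - b p‖) ^ 2 ≤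
      ((∑ p, ‖a p‖ ^ q) ^ (2 / q) + (∑ p, ‖b p‖ ^ q) ^ (2 / q)) / 2 := by
  have hq0 : 0 < q := by linarith
  rcases isEmpty_or_nonempty ι with hι | hι
  · simp [Real.zero_rpow (by positivity : (2 / q : ℝ) ≠ 0)]
  set s : ι → ℝ := fun p => (‖a p‖ + ‖b p‖) / 2 with hs
  have hs0 : ∀ p, 0 ≤ s p := fun p => by positivity
  set D := ∑ p, s p ^ (q - 2) * ‖a p - b p‖ ^ 2 with hD
  have hD0 : 0 ≤ D := sum_nonneg fun p _ => mul_nonneg (Real.rpow_nonneg (hs0 p) _) (sq_nonneg _)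
  set Z := ∑ p, s p ^ q with hZ
  have hZ0 : 0 ≤ Z := sum_nonneg fun p _ => Real.rpow_nonneg (hs0 p) _
  set w := ∑ p, ‖(1 / 2 : ℝ) • (a p + b p)‖ ^ q with hw
  have hw0 : 0 ≤ w := sum_nonneg fun p _ => Real.rpow_nonneg (norm_nonneg _) _
  set z := (∑ p, ‖a p‖ ^ q + ∑ p, ‖b p‖ ^ q) / 2 with hz
  have hA0 : 0 ≤ ∑ p, ‖a p‖ ^ q := sum_nonneg fun p _ => Real.rpow_nonneg (norm_nonneg _) _
  have hB0 : 0 ≤ ∑ p, ‖b p‖ ^ q := sum_nonneg fun p _ => Real.rpow_nonneg (norm_nonneg _) _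
  have hz0 : 0 ≤ z := by positivity
  have hcard : 0 < (Fintype.card ι : ℝ) ^ (2 * (q - 1) / q) :=
    Real.rpow_pos_of_pos (by exact_mod_cast Fintype.card_pos) _
  set κ := (Fintype.card ι : ℝ) ^ (2 * (q - 1) / q) with hκ
  have hgap : w + (q - 1) / 24 * D ≤ z := by
    rw [hw, hD, hz, mul_sum, ← sum_add_distrib, ← sum_add_distrib, sum_div]
    refine sum_le_sum fun p _ => ?_
    have := norm_rpow_midpoint_gap hq hq2 (a p) (b p)
    rw [← mul_assoc]; exact this
  have hZz : Z ≤ z := by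
    rw [hZ, hz, ← sum_add_distrib, sum_div]
    refine sum_le_sum fun p _ => ?_
    rcases (hs0 p).eq_or_lt with h | h
    · rw [← h, Real.zero_rpow hq0.ne']
      have := Real.rpow_nonneg (norm_nonneg (a p)) q
      have := Real.rpow_nonneg (norm_nonneg (b p)) q
      positivity
    · have h1 := rpow_midpoint_gap hq (norm_nonneg (a p)) (norm_nonneg (b p)) h
      have h2 : 0 ≤ (q - 1) / 6 * ((‖a p‖ + ‖b p‖) / 2) ^ (q - 2) * ((‖a p‖ - ‖b p‖) / 2) ^ 2 :=
        mul_nonneg (mul_nonneg (by linarith) (Real.rpow_nonneg h.le _)) (sq_nonneg _)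
      linarith
  have hCS : (∑ p, ‖a p - b p‖) ^ 2 ≤ D * ∑ p, s p ^ (2 - q) := by
    refine sum_sq_le_sum_mul_sum_of_sq_le_mul _
      (fun p _ => mul_nonneg (Real.rpow_nonneg (hs0 p) _) (sq_nonneg _))
      (fun p _ => Real.rpow_nonneg (hs0 p) _) fun p _ => ?_
    rcases (hs0 p).eq_or_lt with h | h
    · have ha : ‖a p‖ = 0 := by
        have : (‖a p‖ + ‖b p‖) / 2 = 0 := h.symm
        linarith [norm_nonneg (a p), norm_nonneg (b p)]
      have hb : ‖b p‖ = 0 := by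
        have : (‖a p‖ + ‖b p‖) / 2 = 0 := h.symm
        linarith [norm_nonneg (a p), norm_nonneg (b p)]
      rw [norm_eq_zero] at ha hb
      simp [ha, hb]
    · have : s p ^ (q - 2) * s p ^ (2 - q) = 1 := by
        rw [← Real.rpow_add h]; simp
      refine le_of_eq ?_
      linear_combination (-‖a p - b p‖ ^ 2) * this
  have hpm := sum_rpow_two_sub_le hq hq2 s hs0
  have hmono : Z ^ ((2 - q) / q) ≤ z ^ ((2 - q) / q) :=
    Real.rpow_le_rpow hZ0 hZz (div_nonneg (by linarith) hq0.le)
  have hexp : 2 / q = 1 + (2 - q) / q := by field_simp; ring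
  have hconv : z ^ (2 / q) ≤
      ((∑ p, ‖a p‖ ^ q) ^ (2 / q) + (∑ p, ‖b p‖ ^ q) ^ (2 / q)) / 2 := by
    have h1 : 1 ≤ 2 / q := by rw [le_div_iff₀ hq0]; linarith
    have := (convexOn_rpow h1).2 (Set.mem_Ici.2 hA0) (Set.mem_Ici.2 hB0)
      (by norm_num : (0 : ℝ) ≤ 1 / 2) (by norm_num : (0 : ℝ) ≤ 1 / 2) (by norm_num)
    simp only [smul_eq_mul] at this
    calc z ^ (2 / q) = (1 / 2 * ∑ p, ‖a p‖ ^ q + 1 / 2 * ∑ p, ‖b p‖ ^ q) ^ (2 / q) := by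
          rw [hz]; congr 1; ring
      _ ≤ _ := this
      _ = _ := by ring
  have hwz : w ≤ z := by nlinarith [mul_nonneg (by linarith : 0 ≤ (q - 1) / 24) hD0]
  -- Since `2 / q = 1 + (2 - q) / q` and `w ≤ z`, a gap `z - w` becomes at least `(z - w) z ^ ((2 -
  -- q) / q)` after raising to the power `2 / q`. This factor cancels the one produced by the power
  -- mean inequality.
  have hdiff : w ^ (2 / q) + (q - 1) / 24 * D * z ^ ((2 - q) / q) ≤ z ^ (2 / q) := by
    rw [hexp, Real.rpow_add' hz0 (by rw [← hexp]; positivity),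
      Real.rpow_add' hw0 (by rw [← hexp]; positivity), Real.rpow_one, Real.rpow_one]
    have h1 : w ^ ((2 - q) / q) ≤ z ^ ((2 - q) / q) :=
      Real.rpow_le_rpow hw0 hwz (div_nonneg (by linarith) hq0.le)
    have h2 := mul_le_mul_of_nonneg_left h1 hw0
    have h3 := mul_le_mul_of_nonneg_right hgap (Real.rpow_nonneg hz0 ((2 - q) / q))
    nlinarith
  have hfin : (q - 1) / (24 * κ) * (∑ p, ‖a p - b p‖) ^ 2 ≤
      (q - 1) / 24 * D * z ^ ((2 - q) / q) := by
    have h1 : (∑ p, ‖a p - b p‖) ^ 2 ≤ D * (κ * z ^ ((2 - q) / q)) :=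
      hCS.trans (mul_le_mul_of_nonneg_left
        (hpm.trans (mul_le_mul_of_nonneg_left hmono hcard.le)) hD0)
    calc _ ≤ (q - 1) / (24 * κ) * (D * (κ * z ^ ((2 - q) / q))) :=
          mul_le_mul_of_nonneg_left h1 (div_nonneg (by linarith) (by positivity))
      _ = _ := by field_simp
  linarith

end UniformConvexity

/-! ### Gain of notch filters on truncated power series. -/

section Filters

open PowerSeries in
/-- The `ℓ²` norm of the first `T` coefficients of a power series. -/
noncomputable def truncNorm (T : ℕ) (u : PowerSeries ℂ) : ℝ :=
  ‖WithLp.toLp 2 (fun t : Fin T => coeff (t : ℕ) u)‖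

namespace truncNorm

open PowerSeries Finset

variable {T : ℕ}

theorem sq_eq (u : PowerSeries ℂ) : truncNorm T u ^ 2 = ∑ t ∈ range T, ‖coeff t u‖ ^ 2 := by
  rw [truncNorm, EuclideanSpace.norm_sq_eq, Finset.sum_range]

theorem nonneg (u : PowerSeries ℂ) : 0 ≤ truncNorm T u := norm_nonneg _

theorem add_le (u v : PowerSeries ℂ) : truncNorm T (u + v) ≤ truncNorm T u + truncNorm T v := by
  refine le_trans (le_of_eq ?_) (norm_add_le _ _)
  rw [truncNorm]; congr 1

theorem C_mul (c : ℂ) (u : PowerSeries ℂ) : truncNorm T (C c * u) = ‖c‖ * truncNorm T u := by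
  rw [truncNorm, truncNorm, ← norm_smul]; congr 1; ext t; simp

theorem sub_le (u v : PowerSeries ℂ) : truncNorm T (u - v) ≤ truncNorm T u + truncNorm T v := by
  refine le_trans (le_of_eq ?_) (norm_sub_le _ _)
  rw [truncNorm]; congr 1

theorem zero : truncNorm T 0 = 0 := by
  have := C_mul (T := T) 0 0
  simpa using this

theorem sum_le {ι : Type*} (s : Finset ι) (u : ι → PowerSeries ℂ) :
    truncNorm T (∑ i ∈ s, u i) ≤ ∑ i ∈ s, truncNorm T (u i) := by
  classical
  induction s using Finset.induction_on with
  | empty => simp [zero]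
  | insert i s hi ih =>
    rw [sum_insert hi, sum_insert hi]
    exact (add_le _ _).trans (by linarith)

theorem X_mul_le (u : PowerSeries ℂ) : truncNorm T (X * u) ≤ truncNorm T u := by
  refine le_of_sq_le_sq ?_ (nonneg _)
  rw [sq_eq, sq_eq]
  cases T with
  | zero => simp
  | succ T =>
    rw [sum_range_succ', sum_range_succ]
    simp only [coeff_succ_X_mul, coeff_zero_X_mul]
    simp

theorem X_pow_mul_le (n : ℕ) (u : PowerSeries ℂ) : truncNorm T (X ^ n * u) ≤ truncNorm T u := by
  induction n with
  | zero => simp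
  | succ n ih =>
    rw [pow_succ', mul_assoc]
    exact (X_mul_le _).trans ih

theorem one_le_one : truncNorm T 1 ≤ 1 := by
  refine le_of_sq_le_sq ?_ zero_le_one
  rw [sq_eq]
  cases T with
  | zero => simp
  | succ T =>
    rw [sum_range_succ']
    simp [coeff_one]

theorem norm_coeff_le {t : ℕ} (ht : t < T) (u : PowerSeries ℂ) : ‖coeff t u‖ ≤ truncNorm T u := by
  refine le_of_sq_le_sq ?_ (nonneg _)
  rw [sq_eq]
  exact single_le_sum (f := fun t => ‖coeff t u‖ ^ 2) (fun _ _ => sq_nonneg _) (mem_range.2 ht)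

/-- The filter `(1 - ωX) / (1 - ρωX)` has gain at most `2 / (1 + ρ)`. -/
theorem one_sub_mul_le {ω : ℂ} (hω : ‖ω‖ = 1) {ρ : ℝ} (h0 : 0 ≤ ρ) (h1 : ρ ≤ 1)
    (w : PowerSeries ℂ) :
    truncNorm T ((1 - C ω * X) * w) ≤ 2 / (1 + ρ) * truncNorm T ((1 - C (ρ * ω) * X) * w) := by
  refine le_of_sq_le_sq ?_ (mul_nonneg (by positivity) (nonneg _))
  rw [mul_pow, div_pow, div_mul_eq_mul_div, le_div_iff₀ (by positivity), sq_eq, sq_eq]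
  cases T with
  | zero => simp
  | succ T =>
    -- A dissipation inequality: the difference of the two sides is `(1 - ρ)² ‖a + ω b‖²`. The last
    -- term telescopes when summed over time with `a`, `b` consecutive coefficients of `w`.
    have key : ∀ a b : ℂ, ‖a - ω * b‖ ^ 2 * (1 + ρ) ^ 2 ≤
        2 ^ 2 * ‖a - ρ * ω * b‖ ^ 2 + 2 * (1 - ρ) * (1 + ρ) * (‖b‖ ^ 2 - ‖a‖ ^ 2) := by
      intro a b
      have hb : ‖ω * b‖ = ‖b‖ := by rw [norm_mul, hω, one_mul]
      rw [← hb, mul_assoc (ρ : ℂ)]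
      generalize ω * b = c
      simp only [← Complex.normSq_eq_norm_sq, Complex.normSq_apply, Complex.sub_re,
        Complex.sub_im, Complex.mul_re, Complex.mul_im, Complex.ofReal_re, Complex.ofReal_im]
      have := mul_nonneg (sq_nonneg (1 - ρ)) (add_nonneg (sq_nonneg (a.re + c.re))
        (sq_nonneg (a.im + c.im)))
      nlinarith
    have hsum : ∀ N : ℕ, (∑ t ∈ range (N + 1), ‖coeff t ((1 - C ω * X) * w)‖ ^ 2) * (1 + ρ) ^ 2 ≤
        2 ^ 2 * (∑ t ∈ range (N + 1), ‖coeff t ((1 - C (ρ * ω) * X) * w)‖ ^ 2) -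
          2 * (1 - ρ) * (1 + ρ) * ‖coeff N w‖ ^ 2 := by
      intro N
      induction N with
      | zero =>
        have := key (coeff 0 w) 0
        simp [sub_mul, mul_assoc] at this ⊢
        linarith
      | succ N ih =>
        rw [sum_range_succ, sum_range_succ _ (N + 1), add_mul, mul_add]
        have := key (coeff (N + 1) w) (coeff N w)
        have e : ∀ c : ℂ, coeff (N + 1) ((1 - C c * X) * w) =
            coeff (N + 1) w - c * coeff N w := by
          intro c
          rw [sub_mul, one_mul, mul_assoc, map_sub, coeff_C_mul, coeff_succ_X_mul]
        rw [e, e]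
        linarith
    have h2 : 0 ≤ 2 * (1 - ρ) * (1 + ρ) * ‖coeff T w‖ ^ 2 := by
      have : 0 ≤ 1 - ρ := by linarith
      positivity
    linarith [hsum T]

end truncNorm

open PowerSeries Finset

/-- The polynomial `(1 - ωX) ∑_{v < V} (ρωX)^v`: a truncation of `(1 - ωX) / (1 - ρωX)`. -/
noncomputable def notch (ω : ℂ) (ρ : ℝ) (V : ℕ) : Polynomial ℂ :=
  (1 - Polynomial.C ω * Polynomial.X) *
    ∑ v ∈ range V, (Polynomial.C (ρ * ω) * Polynomial.X) ^ v

theorem notch_natDegree_le (ω : ℂ) (ρ : ℝ) (V : ℕ) : (notch ω ρ V).natDegree ≤ V := by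
  rcases V.eq_zero_or_pos with rfl | hV
  · simp [notch]
  refine Polynomial.natDegree_mul_le.trans ?_
  have h1 : (1 - Polynomial.C ω * Polynomial.X : Polynomial ℂ).natDegree ≤ 1 := by
    compute_degree
  have h2 : (∑ v ∈ range V, (Polynomial.C (ρ * ω) * Polynomial.X) ^ v :
      Polynomial ℂ).natDegree ≤ V - 1 := by
    refine Polynomial.natDegree_sum_le_of_forall_le _ _ fun v hv => ?_
    have := mem_range.1 hv
    rw [mul_pow, ← Polynomial.C_pow]
    exact (Polynomial.natDegree_C_mul_X_pow_le _ _).trans (by omega)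
  omega

theorem notch_coeff_zero (ω : ℂ) (ρ : ℝ) {V : ℕ} (hV : 0 < V) : (notch ω ρ V).coeff 0 = 1 := by
  rw [Polynomial.coeff_zero_eq_eval_zero, notch]
  obtain ⟨V, rfl⟩ := Nat.exists_eq_succ_of_ne_zero hV.ne'
  simp [Polynomial.eval_finsetSum, sum_range_succ']

theorem coe_notch (ω : ℂ) (ρ : ℝ) (V : ℕ) : (notch ω ρ V : PowerSeries ℂ) =
    (1 - C ω * X) * ∑ v ∈ range V, (C (ρ * ω) * X) ^ v := by
  rw [notch, Polynomial.coe_mul]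
  congr 1
  · simp
  · rw [← Polynomial.coeToPowerSeries.ringHom_apply, map_sum]
    simp

/-- The truncated geometric series is `(1 - z ^ V) / (1 - z)` with `z = ρωX`. Hence truncation
multiplies the gain of the exact notch by at most `1 + ρ ^ V`. -/
theorem truncNorm_notch_mul_le {T : ℕ} {ω : ℂ} (hω : ‖ω‖ = 1) {ρ : ℝ} (h0 : 0 ≤ ρ) (h1 : ρ ≤ 1)
    (V : ℕ) (w : PowerSeries ℂ) :
    truncNorm T ((notch ω ρ V : PowerSeries ℂ) * w) ≤ 2 / (1 + ρ) * (1 + ρ ^ V) * truncNorm T w := by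
  set z : PowerSeries ℂ := C (ρ * ω) * X with hz
  have hinv : (1 - z) * (1 - z)⁻¹ = 1 := PowerSeries.mul_inv_cancel _ (by simp [hz])
  have hgeom : (∑ v ∈ range V, z ^ v) = (1 - z ^ V) * (1 - z)⁻¹ := by
    have := mul_neg_geom_sum z V
    rw [← this]
    linear_combination (-(∑ v ∈ range V, z ^ v)) * hinv
  rw [coe_notch, hgeom, mul_assoc]
  refine (truncNorm.one_sub_mul_le hω h0 h1 _).trans ?_
  rw [mul_assoc (2 / (1 + ρ))]
  refine mul_le_mul_of_nonneg_left ?_ (by positivity)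
  have e : (1 - C (ρ * ω) * X) * ((1 - z ^ V) * (1 - z)⁻¹ * w) = w - C ((ρ * ω) ^ V) * (X ^ V * w) := by
    have h : z ^ V = C ((ρ * ω) ^ V) * X ^ V := by rw [hz, mul_pow, map_pow]
    rw [← hz, ← mul_assoc (C _), ← h]
    linear_combination (1 - z ^ V) * w * hinv
  rw [e]
  refine (truncNorm.sub_le _ _).trans ?_
  rw [truncNorm.C_mul, norm_pow, norm_mul, hω, Complex.norm_of_nonneg h0, mul_one, add_mul, one_mul]
  gcongr
  exact truncNorm.X_pow_mul_le _ _

/-- The notch at `ω` turns the mode `1 / (1 - rωX)` into a filter of bounded gain. -/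
theorem truncNorm_notch_mul_mode_le {T : ℕ} {ω : ℂ} (hω : ‖ω‖ = 1) {ρ r : ℝ} (h0 : 0 ≤ ρ)
    (hr0 : 0 ≤ r) (hr1 : r ≤ 1) (V : ℕ) (g : PowerSeries ℂ) :
    truncNorm T ((notch ω ρ V : PowerSeries ℂ) * g) ≤
      2 * (∑ v ∈ range V, ρ ^ v) * truncNorm T ((1 - C (r * ω) * X) * g) := by
  -- The zero `1 - ωX` is applied to the mode, with gain `2 / (1 + r) ≤ 2` relative to `(1 - rωX)
  -- g`; the geometric series is then bounded term by term.
  rw [coe_notch, mul_right_comm, mul_comm, sum_mul]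
  refine (truncNorm.sum_le _ _).trans ?_
  rw [mul_right_comm, mul_sum]
  refine sum_le_sum fun v _ => ?_
  rw [mul_pow, ← map_pow, mul_assoc, truncNorm.C_mul, norm_pow, norm_mul, hω,
    Complex.norm_of_nonneg h0, mul_one, mul_comm]
  refine mul_le_mul_of_nonneg_right ?_ (by positivity)
  refine (truncNorm.X_pow_mul_le _ _).trans ((truncNorm.one_sub_mul_le hω hr0 hr1 g).trans ?_)
  refine mul_le_mul_of_nonneg_right ?_ (truncNorm.nonneg _)
  rw [div_le_iff₀ (by linarith)]; linarith

end Filters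

/-! ### Products of notches that annihilate all phases with bounded gain. -/

section Annihilators

open PowerSeries Finset

/-- `P` acts on signals of any finite length with `ℓ²` gain at most `γ`. -/
def HasGain (P : Polynomial ℂ) (γ : ℝ) : Prop :=
  ∀ (T : ℕ) (w : PowerSeries ℂ), truncNorm T ((P : PowerSeries ℂ) * w) ≤ γ * truncNorm T w

namespace HasGain

variable {P Q : Polynomial ℂ} {γ δ : ℝ}

theorem one : HasGain 1 1 := fun T w => by simp

theorem mul (hP : HasGain P γ) (hQ : HasGain Q δ) (hγ : 0 ≤ γ) : HasGain (P * Q) (γ * δ) :=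
  fun T w => by
    rw [Polynomial.coe_mul, mul_assoc, mul_assoc]
    exact (hP T _).trans (mul_le_mul_of_nonneg_left (hQ T w) hγ)

theorem mono (hP : HasGain P γ) (h : γ ≤ δ) : HasGain P δ := fun T w =>
  (hP T w).trans (mul_le_mul_of_nonneg_right h (truncNorm.nonneg _))

/-- Gains are kept in exponential form so that products of many notches only require adding
exponents. -/
theorem pow {a : ℝ} (hP : HasGain P (Real.exp a)) (n : ℕ) : HasGain (P ^ n) (Real.exp (n * a)) := by
  induction n with
  | zero => simpa using one
  | succ n ih =>
    rw [pow_succ]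
    convert ih.mul hP (Real.exp_pos _).le using 1
    rw [← Real.exp_add]; push_cast; ring_nf

theorem prod {ι : Type*} {s : Finset ι} {P : ι → Polynomial ℂ} {a : ℝ}
    (h : ∀ i ∈ s, HasGain (P i) (Real.exp a)) :
    HasGain (∏ i ∈ s, P i) (Real.exp (#s * a)) := by
  classical
  induction s using Finset.induction_on with
  | empty => simpa using one
  | insert i s hi ih =>
    rw [prod_insert hi, card_insert_of_notMem hi]
    convert (h i (mem_insert_self _ _)).mul (ih fun j hj => h j (mem_insert_of_mem hj))
      (Real.exp_pos _).le using 1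
    rw [← Real.exp_add]; push_cast; ring_nf

end HasGain

/-- The notch of width `1 / M`, truncated at order `M c`. -/
noncomputable def notchOfWidth (ω : ℂ) (M c : ℕ) : Polynomial ℂ := notch ω (1 - 1 / M) (M * c)

theorem width_bounds {M : ℕ} (hM : 1 ≤ M) : (0 : ℝ) ≤ 1 - 1 / M ∧ (1 : ℝ) - 1 / M ≤ 1 := by
  have h : (1 : ℝ) ≤ M := by exact_mod_cast hM
  have : (1 : ℝ) / M ≤ 1 := by rw [div_le_one (by linarith)]; exact h
  have : (0 : ℝ) ≤ 1 / M := by positivity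
  constructor <;> linarith

/-- With `ρ = 1 - 1/M`, the exact notch and its truncation each cost a factor `1 + 1/M ≤ e^{1/M}`.
The order `M c` is long enough for the latter, as `ρ ^ M ≤ 1/2` gives `ρ ^ (M c) ≤ 2^{-c} ≤ 1/M`. -/
theorem hasGain_notchOfWidth {ω : ℂ} (hω : ‖ω‖ = 1) {M c : ℕ} (hM : 1 ≤ M) (hc : M ≤ 2 ^ c) :
    HasGain (notchOfWidth ω M c) (Real.exp (2 / M)) := by
  intro T w
  obtain ⟨h0, h1⟩ := width_bounds hM
  refine (truncNorm_notch_mul_le hω h0 h1 _ w).trans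
    (mul_le_mul_of_nonneg_right ?_ (truncNorm.nonneg _))
  have hM' : (1 : ℝ) ≤ M := by exact_mod_cast hM
  have hx0 : (0 : ℝ) < 1 / M := by positivity
  have hx1 : (1 : ℝ) / M ≤ 1 := by linarith
  have hpow : ((1 : ℝ) - 1 / M) ^ (M * c) ≤ 1 / M := by
    have hhalf : ((1 : ℝ) - 1 / M) ^ M ≤ 1 / 2 := by
      calc ((1 : ℝ) - 1 / M) ^ M ≤ Real.exp (-(1 / M)) ^ M :=
            pow_le_pow_left₀ h0 (by linarith [Real.add_one_le_exp (-(1 / M : ℝ))]) _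
        _ = Real.exp (-1) := by
            rw [← Real.exp_nat_mul]; congr 1; field_simp
        _ ≤ 1 / 2 := by
            rw [Real.exp_neg, inv_eq_one_div]
            exact one_div_le_one_div_of_le (by norm_num) (by linarith [Real.add_one_le_exp (1 : ℝ)])
    calc ((1 : ℝ) - 1 / M) ^ (M * c) = (((1 : ℝ) - 1 / M) ^ M) ^ c := pow_mul _ _ _
      _ ≤ (1 / 2) ^ c := pow_le_pow_left₀ (pow_nonneg h0 _) hhalf _
      _ = 1 / 2 ^ c := by rw [div_pow, one_pow]
      _ ≤ 1 / M := one_div_le_one_div_of_le (by linarith) (by exact_mod_cast hc)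
  have h2 : 2 / (1 + (1 - 1 / M : ℝ)) ≤ 1 + 1 / M := by
    rw [div_le_iff₀ (by linarith)]; nlinarith
  have h3 : (1 : ℝ) + 1 / M ≤ Real.exp (1 / M) := by linarith [Real.add_one_le_exp (1 / M : ℝ)]
  calc _ ≤ Real.exp (1 / M) * Real.exp (1 / M) := by
        refine mul_le_mul (h2.trans h3) (by linarith) (by positivity) (Real.exp_pos _).le
    _ = _ := by rw [← Real.exp_add]; congr 1; ring

theorem sum_width_pow_le {M : ℕ} (hM : 1 ≤ M) (V : ℕ) :
    ∑ v ∈ range V, ((1 : ℝ) - 1 / M) ^ v ≤ M := by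
  obtain ⟨h0, h1⟩ := width_bounds hM
  have hM' : (1 : ℝ) ≤ M := by exact_mod_cast hM
  have := mul_neg_geom_sum ((1 : ℝ) - 1 / M) V
  have h2 : (1 : ℝ) / M * ∑ v ∈ range V, ((1 : ℝ) - 1 / M) ^ v ≤ 1 := by
    have h3 := pow_nonneg h0 V
    have h4 : (1 : ℝ) - (1 - 1 / M) = 1 / M := by ring
    rw [h4] at this
    linarith
  rw [div_mul_eq_mul_div, one_mul, div_le_one (by linarith)] at h2
  exact h2

/-- The annihilator of the phases in `S`. -/
noncomputable def annihilator (S : Finset ℂ) (M J c : ℕ) : Polynomial ℂ :=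
  ∏ ω ∈ S, (notchOfWidth ω #S c * notchOfWidth ω M c ^ J)

section annihilator

variable {S : Finset ℂ} {M J c : ℕ}

/-- This normalization lets the filtered output contain `y_t` with coefficient one, so that
filtering yields a predictor. -/
theorem annihilator_coeff_zero (hS : 1 ≤ #S) (hM : 1 ≤ M) (hc : 1 ≤ c) :
    (annihilator S M J c).coeff 0 = 1 := by
  rw [annihilator, Polynomial.coeff_zero_prod]
  refine prod_eq_one fun ω _ => ?_
  rw [Polynomial.mul_coeff_zero, Polynomial.coeff_zero_eq_eval_zero (notchOfWidth ω M c ^ J),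
    Polynomial.eval_pow, ← Polynomial.coeff_zero_eq_eval_zero, notchOfWidth, notchOfWidth,
    notch_coeff_zero _ _ (by positivity), notch_coeff_zero _ _ (by positivity)]
  simp

theorem natDegree_annihilator_factor_le (ω : ℂ) (D : ℕ) :
    (notchOfWidth ω D c * notchOfWidth ω M c ^ J).natDegree ≤ D * c + J * (M * c) :=
  Polynomial.natDegree_mul_le.trans (add_le_add (notch_natDegree_le _ _ _)
    (Polynomial.natDegree_pow_le.trans (Nat.mul_le_mul_left _ (notch_natDegree_le _ _ _))))

theorem natDegree_annihilator_le :
    (annihilator S M J c).natDegree ≤ #S * (#S * c + J * (M * c)) := by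
  refine (Polynomial.natDegree_prod_le _ _).trans ?_
  refine (sum_le_card_nsmul _ _ _ fun ω _ => natDegree_annihilator_factor_le ω #S).trans ?_
  rw [smul_eq_mul]

variable (hS1 : ∀ ω ∈ S, ‖ω‖ = 1) (hS : 1 ≤ #S) (hM : #S * J ≤ M) (hM1 : 1 ≤ M)
  (hc : M ≤ 2 ^ c) (hSc : #S ≤ 2 ^ c)

include hS hM1 hc hSc in
theorem hasGain_annihilator_factor {ω : ℂ} (hω : ‖ω‖ = 1) :
    HasGain (notchOfWidth ω #S c * notchOfWidth ω M c ^ J) (Real.exp (2 / #S + J * (2 / M))) := by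
  rw [Real.exp_add]
  exact (hasGain_notchOfWidth hω hS hSc).mul ((hasGain_notchOfWidth hω hM1 hc).pow J)
    (Real.exp_pos _).le

-- The `#S` wide notches contribute `2 / #S` each and the `#S * J` narrow ones `2 / M` each. The
-- condition `#S * J ≤ M` makes the total exponent at most `2 + 2`.
include hS hM hM1 in
theorem card_mul_factor_gain_le : (#S : ℝ) * (2 / #S + J * (2 / M)) ≤ 4 := by
  have h1 : (0 : ℝ) < #S := by exact_mod_cast hS
  have h2 : (0 : ℝ) < M := by exact_mod_cast hM1
  have h3 : (#S : ℝ) * J ≤ M := by exact_mod_cast hM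
  have h4 : (#S : ℝ) * (2 / #S + J * (2 / M)) = 2 + 2 * ((#S * J) / M) := by field_simp
  have h5 : (#S : ℝ) * J / M ≤ 1 := by rw [div_le_one h2]; exact h3
  linarith

include hS1 hS hM hM1 hc hSc in
theorem hasGain_annihilator : HasGain (annihilator S M J c) (Real.exp 4) :=
  (HasGain.prod fun ω hω => hasGain_annihilator_factor hS hM1 hc hSc (hS1 ω hω)).mono
    (Real.exp_le_exp.2 (card_mul_factor_gain_le hS hM hM1))

include hS1 hS hM1 hc hSc in
theorem hasGain_annihilator_erase {ω : ℂ} (hω : ω ∈ S) :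
    HasGain (∏ z ∈ S.erase ω, (notchOfWidth z #S c * notchOfWidth z M c ^ J))
      (Real.exp ((#S - 1) * (2 / #S + J * (2 / M)))) := by
  convert HasGain.prod (s := S.erase ω) fun z hz =>
    hasGain_annihilator_factor (J := J) hS hM1 hc hSc (hS1 z (mem_of_mem_erase hz)) using 3
  rw [card_erase_of_mem hω, Nat.cast_sub hS, Nat.cast_one]

include hS1 hS hM hM1 hc hSc in
/-- The gain of the annihilator on a mode with one of its phases. -/
theorem truncNorm_annihilator_mul_mode_le {ω : ℂ} (hω : ω ∈ S) {r : ℝ} (hr0 : 0 ≤ r) (hr1 : r ≤ 1)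
    (T : ℕ) (g : PowerSeries ℂ) :
    truncNorm T ((annihilator S M J c : PowerSeries ℂ) * g) ≤
      2 * #S * Real.exp 4 * truncNorm T ((1 - C (r * ω) * X) * g) := by
  -- Only the wide notch at `ω` is spent on the mode, which costs `2 #S` instead of the `2 M` of a
  -- narrow notch. All other factors are charged their ordinary gain.
  have hrest := ((hasGain_notchOfWidth (hS1 ω hω) hM1 hc).pow J).mul
    (hasGain_annihilator_erase (J := J) hS1 hS hM1 hc hSc hω) (Real.exp_pos _).le
  rw [← Real.exp_add] at hrest
  have hle : (J : ℝ) * (2 / M) + (#S - 1) * (2 / #S + J * (2 / M)) ≤ 4 := by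
    have := card_mul_factor_gain_le hS hM hM1
    have h2 : (0 : ℝ) ≤ 2 / #S := by positivity
    linarith
  have hrest' := (hrest.mono (Real.exp_le_exp.2 hle)) T ((notchOfWidth ω #S c : PowerSeries ℂ) * g)
  rw [annihilator, ← mul_prod_erase S _ hω]
  have e : ((notchOfWidth ω #S c * notchOfWidth ω M c ^ J *
      ∏ z ∈ S.erase ω, (notchOfWidth z #S c * notchOfWidth z M c ^ J) : Polynomial ℂ) :
      PowerSeries ℂ) * g = ((notchOfWidth ω M c ^ J *
      ∏ z ∈ S.erase ω, (notchOfWidth z #S c * notchOfWidth z M c ^ J) : Polynomial ℂ) :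
      PowerSeries ℂ) * ((notchOfWidth ω #S c : PowerSeries ℂ) * g) := by
    rw [← mul_assoc, ← Polynomial.coe_mul]
    congr 2; ring
  rw [e]
  refine hrest'.trans ?_
  obtain ⟨h0, h1⟩ := width_bounds hS
  have h2 := truncNorm_notch_mul_mode_le (T := T) (hS1 ω hω) h0 hr0 hr1 (#S * c) g
  have h3 := sum_width_pow_le hS (#S * c)
  have h4 : truncNorm T ((notchOfWidth ω #S c : PowerSeries ℂ) * g) ≤
      2 * #S * truncNorm T ((1 - C (r * ω) * X) * g) :=
    h2.trans (mul_le_mul_of_nonneg_right (by linarith) (truncNorm.nonneg _))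
  calc _ ≤ Real.exp 4 * (2 * #S * truncNorm T ((1 - C (r * ω) * X) * g)) :=
        mul_le_mul_of_nonneg_left h4 (Real.exp_pos _).le
    _ = _ := by ring

end annihilator

end Annihilators

/-! ### Exponential decay of annihilated modes at large times. -/

section Tails

open PowerSeries Finset

theorem eval_reflect_eq_sum {R : Type*} [CommSemiring R] {P : Polynomial R} {n : ℕ}
    (h : P.natDegree ≤ n) (l : R) :
    (P.reflect n).eval l = ∑ u ∈ range (n + 1), P.coeff u * l ^ (n - u) := by
  have hd : (P.reflect n).natDegree < n + 1 :=
    Nat.lt_succ_of_le ((Polynomial.natDegree_reflect_le).trans (by simp [h]))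
  rw [Polynomial.eval_eq_sum_range' hd, ← sum_range_reflect]
  refine sum_congr rfl fun u hu => ?_
  have hu' : u ≤ n := Nat.lt_succ_iff.1 (mem_range.1 hu)
  rw [Polynomial.coeff_reflect, Polynomial.revAt_le (by omega)]
  congr 2
  all_goals omega

/-- The response of a filter of degree at most `n` to a geometric signal is geometric after
time `n`. -/
theorem coeff_mul_mk_pow {P : Polynomial ℂ} {n s : ℕ} (h : P.natDegree ≤ n) (hs : n ≤ s) (l : ℂ) :
    coeff s ((P : PowerSeries ℂ) * PowerSeries.mk (fun t => l ^ t)) =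
      l ^ (s - n) * (P.reflect n).eval l := by
  rw [eval_reflect_eq_sum h, coeff_mul, Nat.sum_antidiagonal_eq_sum_range_succ_mk, mul_sum]
  have : range (n + 1) ⊆ range (s + 1) := range_subset_range.2 (by omega)
  rw [← sum_subset this]
  · refine sum_congr rfl fun u hu => ?_
    have hu' : u ≤ n := Nat.lt_succ_iff.1 (mem_range.1 hu)
    simp only [Polynomial.coeff_coe, coeff_mk]
    rw [mul_left_comm, ← pow_add]
    congr 2; omega
  · intro u _ hu
    have : n < u := by simpa using hu
    simp [Polynomial.coeff_eq_zero_of_natDegree_lt (h.trans_lt this)]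

theorem truncNorm_mk_pow_le (T : ℕ) {l : ℂ} (hl : ‖l‖ ≤ 1) :
    truncNorm T (PowerSeries.mk (fun t => l ^ t)) ≤ √T := by
  refine Real.le_sqrt_of_sq_le ?_
  rw [truncNorm.sq_eq]
  calc _ ≤ ∑ t ∈ range T, (1 : ℝ) := by
        refine sum_le_sum fun t _ => ?_
        rw [coeff_mk, norm_pow, ← pow_mul]
        exact pow_le_one₀ (norm_nonneg _) hl
    _ = T := by simp

/-- The reflected value is the coefficient at time `n` of the filtered geometric signal, whose first
`n + 1` terms have `ℓ²` norm at most `√(n + 1)`. -/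
theorem HasGain.norm_eval_reflect_le {P : Polynomial ℂ} {γ : ℝ} (hP : HasGain P γ) (hγ : 0 ≤ γ)
    {n : ℕ} (h : P.natDegree ≤ n) {l : ℂ} (hl : ‖l‖ ≤ 1) :
    ‖(P.reflect n).eval l‖ ≤ γ * √(n + 1) := by
  have h1 := coeff_mul_mk_pow h le_rfl l
  rw [Nat.sub_self, pow_zero, one_mul] at h1
  rw [← h1]
  refine (truncNorm.norm_coeff_le (Nat.lt_succ_self n) _).trans ((hP _ _).trans ?_)
  have := truncNorm_mk_pow_le (n + 1) hl
  push_cast at this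
  exact mul_le_mul_of_nonneg_left this hγ

theorem reflect_pow {R : Type*} [CommSemiring R] {P : Polynomial R} {n : ℕ} (h : P.natDegree ≤ n)
    (J : ℕ) : (P ^ J).reflect (J * n) = P.reflect n ^ J := by
  induction J with
  | zero => simp
  | succ J ih =>
    rw [pow_succ, pow_succ, add_mul, one_mul, Polynomial.reflect_mul _ _ _ h, ih]
    exact Polynomial.natDegree_pow_le.trans (Nat.mul_le_mul_left _ h)

/-- Reflecting `1 - ωX` gives `X - ω`, of modulus `1 - r` at `rω`. The reflected geometric sum is
bounded termwise. -/
theorem norm_eval_reflect_notch_le {ω : ℂ} (hω : ‖ω‖ = 1) {ρ r : ℝ} (h0 : 0 ≤ ρ) (hr0 : 0 ≤ r)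
    (hr1 : r ≤ 1) {V : ℕ} (hV : 1 ≤ V) :
    ‖((notch ω ρ V).reflect V).eval (r * ω)‖ ≤ (1 - r) * ∑ v ∈ range V, ρ ^ v := by
  obtain ⟨V, rfl⟩ := Nat.exists_eq_add_of_le hV
  set Q : Polynomial ℂ := ∑ v ∈ range (1 + V), (Polynomial.C (ρ * ω) * Polynomial.X) ^ v with hQ
  have hcoeff : ∀ u, Q.coeff u = if u < 1 + V then (ρ * ω) ^ u else 0 := by
    intro u
    rw [hQ, Polynomial.finsetSum_coeff]
    simp only [mul_pow, ← Polynomial.C_pow, Polynomial.coeff_C_mul, Polynomial.coeff_X_pow]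
    simp
  have hQd : Q.natDegree ≤ V := by
    rw [Polynomial.natDegree_le_iff_coeff_eq_zero]
    intro u hu
    rw [hcoeff, if_neg (by omega)]
  have hd1 : (1 - Polynomial.C ω * Polynomial.X : Polynomial ℂ).natDegree ≤ 1 := by
    compute_degree
  rw [notch, Polynomial.reflect_mul _ _ hd1 hQd, Polynomial.eval_mul, norm_mul]
  refine mul_le_mul (le_of_eq ?_) ?_ (norm_nonneg _) (by linarith)
  · rw [eval_reflect_eq_sum hd1]
    simp only [sum_range_succ, range_zero, sum_empty]
    simp [Polynomial.coeff_one]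
    have : (r : ℂ) * ω + -ω = ((1 - r : ℝ) : ℂ) * (-ω) := by push_cast; ring
    rw [this, norm_mul, norm_neg, hω, mul_one, Complex.norm_of_nonneg (by linarith)]
  · rw [eval_reflect_eq_sum hQd, add_comm 1 V]
    refine (norm_sum_le _ _).trans (sum_le_sum fun u hu => ?_)
    rw [hcoeff, if_pos (by have := mem_range.1 hu; omega), norm_mul, norm_pow, norm_pow, norm_mul,
      norm_mul, hω, Complex.norm_of_nonneg h0, Complex.norm_of_nonneg hr0, mul_one, mul_one]
    exact mul_le_of_le_one_right (pow_nonneg h0 _) (pow_le_one₀ hr0 hr1)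

/-- After time `N`, the annihilator makes every mode with one of its phases exponentially small. -/
theorem norm_coeff_annihilator_mul_mode_le {S : Finset ℂ} {M J c N s : ℕ}
    (hS1 : ∀ ω ∈ S, ‖ω‖ = 1) (hS : 1 ≤ #S) (hM : #S * J ≤ M) (hM1 : 1 ≤ M)
    (hc : M ≤ 2 ^ c) (hSc : #S ≤ 2 ^ c) (hc1 : 1 ≤ c)
    (hN : #S * (#S * c + J * (M * c)) + 2 * M * J + 1 ≤ N) (hs : N ≤ s)
    {ω : ℂ} (hω : ω ∈ S) {r : ℝ} (hr0 : 0 ≤ r) (hr1 : r ≤ 1) :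
    ‖coeff s ((annihilator S M J c : PowerSeries ℂ) * PowerSeries.mk (fun t => (r * ω) ^ t))‖ ≤
      Real.exp 4 * √N * (1 / 2) ^ J := by
  set n := #S * (#S * c + J * (M * c)) with hn
  have hdeg : (annihilator S M J c).natDegree ≤ n := natDegree_annihilator_le
  have hl : ‖(r * ω : ℂ)‖ = r := by
    rw [norm_mul, hS1 ω hω, Complex.norm_of_nonneg hr0, mul_one]
  rw [coeff_mul_mk_pow hdeg (by omega), norm_mul, norm_pow, hl]
  have hM' : (1 : ℝ) ≤ M := by exact_mod_cast hM1
  have hexp : (0 : ℝ) < Real.exp 4 := Real.exp_pos _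
  -- If `r` is within `1 / (2M)` of one, each of the `J` narrow notches at `ω` contributes a factor
  -- at most `1/2`. Otherwise `r ^ (2M) ≤ 1/2`, and the `2MJ` steps between the degree `n` and time
  -- `N` give `2^{-J}` by decay alone.
  rcases le_total ((1 - r) * M) (1 / 2) with h | h
  · have hrest := (hasGain_notchOfWidth (hS1 ω hω) hS hSc).mul
      (hasGain_annihilator_erase (J := J) hS1 hS hM1 hc hSc hω) (Real.exp_pos _).le
    rw [← Real.exp_add] at hrest
    have hle : (2 : ℝ) / #S + (#S - 1) * (2 / #S + J * (2 / M)) ≤ 4 := by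
      have := card_mul_factor_gain_le hS hM hM1
      have h2 : (0 : ℝ) ≤ J * (2 / M) := by positivity
      linarith
    replace hrest := hrest.mono (Real.exp_le_exp.2 hle)
    set Q := notchOfWidth ω #S c *
      ∏ z ∈ S.erase ω, (notchOfWidth z #S c * notchOfWidth z M c ^ J) with hQ
    set m := #S * c + (#S - 1) * (#S * c + J * (M * c)) with hm
    have hQd : Q.natDegree ≤ m := by
      refine Polynomial.natDegree_mul_le.trans (add_le_add (notch_natDegree_le _ _ _) ?_)
      refine (Polynomial.natDegree_prod_le _ _).trans ?_
      refine (sum_le_card_nsmul _ _ _ fun ω _ => natDegree_annihilator_factor_le ω #S).trans ?_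
      rw [smul_eq_mul, card_erase_of_mem hω]
    have hAd : (notchOfWidth ω M c).natDegree ≤ M * c := notch_natDegree_le _ _ _
    have hfac : annihilator S M J c = notchOfWidth ω M c ^ J * Q := by
      rw [annihilator, ← mul_prod_erase S _ hω, hQ]; ring
    have hnm : n = J * (M * c) + m := by
      obtain ⟨D, hD⟩ := Nat.exists_eq_add_of_le hS
      rw [hn, hm, hD]; simp only [Nat.add_sub_cancel_left]; ring
    have hQe := hrest.norm_eval_reflect_le hexp.le hQd (l := r * ω) (by rw [hl]; exact hr1)
    have hmN : √((m : ℝ) + 1) ≤ √N := Real.sqrt_le_sqrt (by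
      have : m + 1 ≤ N := by omega
      exact_mod_cast this)
    have hA : ‖((notchOfWidth ω M c).reflect (M * c)).eval (r * ω : ℂ)‖ ≤ 1 / 2 := by
      refine (norm_eval_reflect_notch_le (hS1 ω hω) (width_bounds hM1).1 hr0 hr1
        (Nat.mul_pos hM1 hc1)).trans ?_
      exact (mul_le_mul_of_nonneg_left (sum_width_pow_le hM1 _) (by linarith)).trans h
    rw [hfac, hnm, Polynomial.reflect_mul _ _
      (Polynomial.natDegree_pow_le.trans (Nat.mul_le_mul_left _ hAd)) hQd, reflect_pow hAd,
      Polynomial.eval_mul, Polynomial.eval_pow, norm_mul, norm_pow]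
    calc _ ≤ 1 * ((1 / 2) ^ J * (Real.exp 4 * √N)) := by
          refine mul_le_mul (pow_le_one₀ hr0 hr1) ?_ (by positivity) zero_le_one
          refine mul_le_mul (pow_le_pow_left₀ (norm_nonneg _) hA _)
            (hQe.trans (mul_le_mul_of_nonneg_left hmN hexp.le)) (norm_nonneg _) (by positivity)
      _ = _ := by ring
  · have hQe := (hasGain_annihilator hS1 hS hM hM1 hc hSc).norm_eval_reflect_le hexp.le hdeg
      (l := r * ω) (by rw [hl]; exact hr1)
    have hnN : √((n : ℝ) + 1) ≤ √N := Real.sqrt_le_sqrt (by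
      have : n + 1 ≤ N := by omega
      exact_mod_cast this)
    have hr : r ^ (2 * M) ≤ 1 / 2 := by
      calc r ^ (2 * M) ≤ Real.exp (-(1 / (2 * M))) ^ (2 * M) := by
            refine pow_le_pow_left₀ hr0 ?_ _
            have h1 : 1 / (2 * M : ℝ) ≤ 1 - r := by
              rw [div_le_iff₀ (by positivity)]; linarith
            linarith [Real.add_one_le_exp (-(1 / (2 * M) : ℝ))]
        _ = Real.exp (-1) := by
            rw [← Real.exp_nat_mul]; congr 1; push_cast; field_simp
        _ ≤ 1 / 2 := by
            rw [Real.exp_neg, inv_eq_one_div]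
            exact one_div_le_one_div_of_le (by norm_num) (by linarith [Real.add_one_le_exp (1 : ℝ)])
    have hrJ : r ^ (s - n) ≤ (1 / 2) ^ J := by
      calc r ^ (s - n) ≤ r ^ (2 * M * J) := pow_le_pow_of_le_one hr0 hr1 (by omega)
        _ = (r ^ (2 * M)) ^ J := pow_mul _ _ _
        _ ≤ _ := pow_le_pow_left₀ (pow_nonneg hr0 _) hr _
    calc _ ≤ (1 / 2) ^ J * (Real.exp 4 * √N) :=
          mul_le_mul hrJ (hQe.trans (mul_le_mul_of_nonneg_left hnN hexp.le)) (norm_nonneg _)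
            (by positivity)
      _ = _ := by ring

end Tails

/-! ### Logarithmic `ℓ¹` norm of the scaled wavefilters. -/

section Wavefilters

open Finset

/-- This exhibits the matrix as the Gram matrix of the functions `(1 - r) r ^ i` in `L²[0, 1]`,
hence positive semidefinite with nonnegative entries. -/
theorem hankel_eq_integral {T : ℕ} (i j : Fin T) :
    hankel T i j = ∫ r in (0 : ℝ)..1, ((1 - r) * r ^ (i : ℕ)) * ((1 - r) * r ^ (j : ℕ)) := by
  have e : ∀ r : ℝ, ((1 - r) * r ^ (i : ℕ)) * ((1 - r) * r ^ (j : ℕ)) =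
      r ^ ((i : ℕ) + j) - 2 * r ^ ((i : ℕ) + j + 1) + r ^ ((i : ℕ) + j + 2) := fun r => by ring
  simp_rw [e]
  rw [intervalIntegral.integral_add, intervalIntegral.integral_sub,
    intervalIntegral.integral_const_mul, integral_pow, integral_pow, integral_pow, hankel]
  · have hi : (0 : ℝ) ≤ (i : ℕ) := Nat.cast_nonneg _
    have hj : (0 : ℝ) ≤ (j : ℕ) := Nat.cast_nonneg _
    push_cast
    generalize ((i : ℕ) : ℝ) = a at *
    generalize ((j : ℕ) : ℝ) = b at *
    have h1 : a + b + 1 ≠ 0 := by positivity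
    have h2 : a + b + 1 + 1 ≠ 0 := by positivity
    have h3 : a + b + 2 + 1 ≠ 0 := by positivity
    have h4 : (a + 1 + (b + 1)) ^ 3 - (a + 1 + (b + 1)) =
        (a + b + 1) * (a + b + 1 + 1) * (a + b + 2 + 1) := by ring
    rw [h4]
    field_simp
    simp
    ring
  all_goals exact Continuous.intervalIntegrable (by fun_prop) _ _

theorem hankel_comm {T : ℕ} (i j : Fin T) : hankel T i j = hankel T j i := by
  simp only [hankel, add_comm]

theorem hankel_sum_nonneg {T : ℕ} (v : Fin T → ℝ) :
    0 ≤ ∑ i, ∑ j, v i * v j * hankel T i j := by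
  have e : ∑ i, ∑ j, v i * v j * hankel T i j =
      ∫ r in (0 : ℝ)..1, (∑ i, v i * ((1 - r) * r ^ (i : ℕ))) ^ 2 := by
    simp_rw [hankel_eq_integral, ← intervalIntegral.integral_const_mul]
    simp_rw [sq, sum_mul_sum]
    rw [intervalIntegral.integral_finsetSum]
    · refine sum_congr rfl fun i _ => ?_
      rw [intervalIntegral.integral_finsetSum]
      · refine sum_congr rfl fun j _ => ?_
        congr 1; ext r; ring
      · exact fun j _ => Continuous.intervalIntegrable (by fun_prop) _ _
    · exact fun j _ => Continuous.intervalIntegrable (by fun_prop) _ _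
  rw [e]
  exact intervalIntegral.integral_nonneg zero_le_one fun r _ => sq_nonneg _

section Eigenvector

variable {T : ℕ} {σ : ℝ} {φ : EuclideanSpace ℝ (Fin T)}

theorem hankel_eigenvector_apply (h : (hankel T).toEuclideanLin φ = σ • φ) (i : Fin T) :
    ∑ j, hankel T i j * φ j = σ * φ i := by
  have := congrArg (fun v : EuclideanSpace ℝ (Fin T) => v i) h
  simpa [Matrix.toLpLin_apply, Matrix.mulVec, dotProduct] using this

theorem sum_sq_eq_one_of_norm (hφ : ‖φ‖ = 1) : ∑ i, φ i ^ 2 = 1 := by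
  rw [← EuclideanSpace.real_norm_sq_eq, hφ, one_pow]

theorem hankel_eigenvalue_nonneg (h : (hankel T).toEuclideanLin φ = σ • φ) (hφ : ‖φ‖ = 1) :
    0 ≤ σ := by
  have h1 := hankel_sum_nonneg (fun i => φ i)
  have h2 : ∑ i, ∑ j, φ i * φ j * hankel T i j = σ := by
    calc _ = ∑ i, φ i * ∑ j, hankel T i j * φ j := by
          refine sum_congr rfl fun i _ => ?_
          rw [mul_sum]; exact sum_congr rfl fun j _ => by ring
      _ = σ * ∑ i, φ i ^ 2 := by
          simp_rw [hankel_eigenvector_apply h, mul_sum]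
          exact sum_congr rfl fun j _ => by ring
      _ = σ := by rw [sum_sq_eq_one_of_norm hφ, mul_one]
  linarith

/-- Positive semidefiniteness is applied to the component of `s` orthogonal to `φ`: the quadratic
form dominates its rank-one part along `φ`. -/
theorem hankel_eigenvalue_mul_sq_le (h : (hankel T).toEuclideanLin φ = σ • φ) (hφ : ‖φ‖ = 1)
    (s : Fin T → ℝ) :
    σ * (∑ i, s i * φ i) ^ 2 ≤ ∑ i, ∑ j, s i * s j * hankel T i j := by
  set c := ∑ i, s i * φ i with hc
  have h1 := hankel_sum_nonneg (fun i => s i - c * φ i)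
  have e1 : ∑ i, ∑ j, s i * φ j * hankel T i j = σ * c := by
    rw [hc, mul_sum]
    refine sum_congr rfl fun i _ => ?_
    rw [mul_left_comm, ← hankel_eigenvector_apply h, mul_sum]
    exact sum_congr rfl fun j _ => by ring
  have e2 : ∑ i, ∑ j, φ i * s j * hankel T i j = σ * c := by
    rw [← e1, sum_comm]
    refine sum_congr rfl fun i _ => sum_congr rfl fun j _ => ?_
    rw [hankel_comm]; ring
  have e3 : ∑ i, ∑ j, φ i * φ j * hankel T i j = σ := by
    calc _ = σ * ∑ i, φ i ^ 2 := by
          rw [mul_sum]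
          refine sum_congr rfl fun i _ => ?_
          rw [sq, mul_left_comm, ← hankel_eigenvector_apply h, mul_sum]
          exact sum_congr rfl fun j _ => by ring
      _ = σ := by rw [sum_sq_eq_one_of_norm hφ, mul_one]
  have e4 : ∑ i, ∑ j, (s i - c * φ i) * (s j - c * φ j) * hankel T i j =
      ∑ i, ∑ j, s i * s j * hankel T i j - c * (∑ i, ∑ j, s i * φ j * hankel T i j) -
      c * (∑ i, ∑ j, φ i * s j * hankel T i j) + c ^ 2 * ∑ i, ∑ j, φ i * φ j * hankel T i j := by
    simp_rw [mul_sum, ← sum_sub_distrib, ← sum_add_distrib]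
    exact sum_congr rfl fun i _ => sum_congr rfl fun j _ => by ring
  rw [e4, e1, e2, e3] at h1
  nlinarith

theorem hankel_le {i j : Fin T} {n : ℕ} (hn : 1 ≤ n) (hi : n ≤ (i : ℕ) + 1) (hj : n ≤ (j : ℕ) + 1) :
    hankel T i j ≤ 1 / (n : ℝ) ^ 3 := by
  have h1 : (1 : ℝ) ≤ n := by exact_mod_cast hn
  have h2 : (n : ℝ) ≤ (i : ℕ) + 1 := by exact_mod_cast hi
  have h3 : (n : ℝ) ≤ (j : ℕ) + 1 := by exact_mod_cast hj
  rw [hankel]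
  set x := ((i : ℕ) + 1 : ℝ) + ((j : ℕ) + 1 : ℝ) with hx
  have h4 : 2 * (n : ℝ) ≤ x := by linarith
  have h5 : 2 * (n : ℝ) ^ 3 ≤ x ^ 3 - x := by
    have h6 : (2 * (n : ℝ)) ^ 2 - 1 ≤ x ^ 2 - 1 := by nlinarith
    have h7 : 2 * (n : ℝ) * ((2 * (n : ℝ)) ^ 2 - 1) ≤ x * (x ^ 2 - 1) :=
      mul_le_mul h4 h6 (by nlinarith) (by linarith)
    nlinarith [mul_nonneg (sub_nonneg.2 h1) (sq_nonneg (n : ℝ)), mul_nonneg (sub_nonneg.2 h1) (by linarith : (0 : ℝ) ≤ n)]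
  rw [div_le_div_iff₀ (by nlinarith [pow_pos (by linarith : (0 : ℝ) < n) 3]) (by positivity)]
  linarith

/-- Let `z` be the `ℓ¹` norm of `φ` on the block. Testing the quadratic form on the signs of `φ`
gives `σ z² ≤ n² / n³ = 1 / n`, because entries in the block are at most `n^{-3}`. Cauchy–Schwarz
gives `z² ≤ n`. The product `σ z⁴ ≤ 1` explains the exponent `1/4`. -/
theorem hankel_eigenvector_block_le (h : (hankel T).toEuclideanLin φ = σ • φ) (hφ : ‖φ‖ = 1)
    {n : ℕ} (hn : 1 ≤ n) {B : Finset (Fin T)} (hB : #B ≤ n) (hBn : ∀ i ∈ B, n ≤ (i : ℕ) + 1) :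
    σ ^ (1 / 4 : ℝ) * ∑ i ∈ B, |φ i| ≤ 1 := by
  have hσ := hankel_eigenvalue_nonneg h hφ
  have hn' : (0 : ℝ) < n := by exact_mod_cast hn
  have hBr : (#B : ℝ) ≤ n := by exact_mod_cast hB
  set z := ∑ i ∈ B, |φ i| with hz
  have hz0 : 0 ≤ z := sum_nonneg fun _ _ => abs_nonneg _
  have h1 : z ^ 2 ≤ n := by
    have h2 := sum_mul_sq_le_sq_mul_sq B (fun _ => (1 : ℝ)) (fun i => |φ i|)
    simp only [one_mul, one_pow, sum_const, nsmul_eq_mul, mul_one, sq_abs] at h2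
    have h3 : ∑ i ∈ B, φ i ^ 2 ≤ 1 := by
      rw [← sum_sq_eq_one_of_norm hφ]
      exact sum_le_sum_of_subset_of_nonneg (subset_univ _) fun _ _ _ => sq_nonneg _
    nlinarith
  set s : Fin T → ℝ := fun i => if i ∈ B then SignType.sign (φ i) else 0 with hs
  have hsz : ∑ i, s i * φ i = z := by
    rw [hz]
    simp only [hs, ite_mul, zero_mul, sum_ite_mem, univ_inter]
    exact sum_congr rfl fun i _ => by rw [sign_mul_self]
  have h4 := hankel_eigenvalue_mul_sq_le h hφ s
  rw [hsz] at h4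
  have h5 : ∑ i, ∑ j, s i * s j * hankel T i j ≤ 1 / n := by
    have hs1 : ∀ i, |s i| ≤ 1 := by
      intro i
      simp only [hs]
      split_ifs
      · rcases lt_trichotomy (φ i) 0 with h | h | h <;> simp [h]
      · simp
    have hnn : ∀ i j, 0 ≤ hankel T i j := by
      intro i j
      rw [hankel_eq_integral]
      refine intervalIntegral.integral_nonneg zero_le_one fun r hr => ?_
      have := hr.1
      have : 0 ≤ 1 - r := by linarith [hr.2]
      positivity
    calc ∑ i, ∑ j, s i * s j * hankel T i j
        = ∑ i ∈ B, ∑ j ∈ B, s i * s j * hankel T i j := by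
          rw [← sum_subset (subset_univ B)]
          · refine sum_congr rfl fun i _ => ?_
            rw [← sum_subset (subset_univ B)]
            intro j _ hj
            simp [hs, hj]
          · intro i _ hi
            simp [hs, hi]
      _ ≤ ∑ i ∈ B, ∑ j ∈ B, 1 / (n : ℝ) ^ 3 := by
          refine sum_le_sum fun i hi => sum_le_sum fun j hj => ?_
          refine le_trans ?_ (hankel_le hn (hBn i hi) (hBn j hj))
          refine mul_le_of_le_one_left (hnn i j) ?_
          calc s i * s j ≤ |s i * s j| := le_abs_self _
            _ = |s i| * |s j| := abs_mul _ _
            _ ≤ 1 := mul_le_one₀ (hs1 i) (abs_nonneg _) (hs1 j)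
      _ = #B * #B * (1 / (n : ℝ) ^ 3) := by simp [mul_assoc]
      _ ≤ n * n * (1 / (n : ℝ) ^ 3) := by gcongr
      _ = 1 / n := by field_simp
  have h6 : σ * z ^ 4 ≤ 1 := by
    calc σ * z ^ 4 = (σ * z ^ 2) * z ^ 2 := by ring
      _ ≤ 1 / (n : ℝ) * n := mul_le_mul (h4.trans h5) h1 (sq_nonneg _) (by positivity)
      _ = 1 := by field_simp
  have h7 : (σ ^ (1 / 4 : ℝ) * z) ^ 4 ≤ 1 := by
    rw [mul_pow, ← Real.rpow_natCast (σ ^ (1 / 4 : ℝ)), ← Real.rpow_mul hσ]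
    norm_num
    exact h6
  exact (pow_le_one_iff_of_nonneg (mul_nonneg (Real.rpow_nonneg hσ _) hz0) (by norm_num)).1 h7

/-- The wavefilters scaled by `σ^{1/4}` have logarithmic `ℓ¹` norm. -/
theorem hankel_eigenvector_l1_le (h : (hankel T).toEuclideanLin φ = σ • φ) (hφ : ‖φ‖ = 1) :
    σ ^ (1 / 4 : ℝ) * ∑ i, |φ i| ≤ Nat.log 2 T + 1 := by
  have hmaps : ∀ i ∈ (univ : Finset (Fin T)), Nat.log 2 ((i : ℕ) + 1) ∈ range (Nat.log 2 T + 1) :=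
    fun i _ => mem_range.2 (Nat.lt_succ_of_le (Nat.log_mono_right (by omega)))
  -- Split the times into dyadic blocks `[2^a, 2^(a+1))`; each contributes at most one.
  rw [← sum_fiberwise_of_maps_to hmaps, mul_sum]
  calc _ ≤ ∑ a ∈ range (Nat.log 2 T + 1), (1 : ℝ) := by
        refine sum_le_sum fun a _ => ?_
        refine hankel_eigenvector_block_le h hφ (n := 2 ^ a) Nat.one_le_two_pow ?_ ?_
        · have : #({i : Fin T | Nat.log 2 ((i : ℕ) + 1) = a} : Finset (Fin T)) ≤
              #(Ico (2 ^ a) (2 ^ (a + 1))) := by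
            refine card_le_card_of_injOn (fun i => (i : ℕ) + 1) ?_ ?_
            · intro i hi
              have hi' : Nat.log 2 ((i : ℕ) + 1) = a := by simpa using hi
              rw [coe_Ico, Set.mem_Ico, ← hi']
              exact ⟨Nat.pow_log_le_self 2 (by omega), Nat.lt_pow_succ_log_self (by norm_num) _⟩
            · intro i _ j _ hij
              exact Fin.ext (by simpa using hij)
          rw [Nat.card_Ico, pow_succ] at this
          omega
        · intro i hi
          have hi' : Nat.log 2 ((i : ℕ) + 1) = a := by simpa using hi
          rw [← hi']
          exact Nat.pow_log_le_self 2 (by omega)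
    _ = _ := by simp

end Eigenvector

end Wavefilters

/-! ### Follow the regularized leader, and the Lipschitz constant of predictions. -/

section Predictions

open Finset

/-- Follow the regularized leader for the squared loss, when the regularizer is midpoint strongly
convex with respect to a distance for which predictions are Lipschitz: the loss from round `2` on
is at most twice the regularized loss of any competitor. -/
theorem ftrl_sum_le {Θ V : Type*} [NormedAddCommGroup V] [InnerProductSpace ℝ V]
    (K : Set Θ) (pred : ℕ → Θ → V) (y : ℕ → V) (reg : Θ → ℝ) (mid : Θ → Θ → Θ)
    (dist : Θ → Θ → ℝ) {G κ : ℝ} (T : ℕ) (hGκ : G ^ 2 ≤ 2 * κ)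
    (hreg0 : ∀ θ, 0 ≤ reg θ)
    (hmidK : ∀ θ ∈ K, ∀ θ' ∈ K, mid θ θ' ∈ K)
    (hmid : ∀ t θ θ', pred t (mid θ θ') = (1 / 2 : ℝ) • (pred t θ + pred t θ'))
    (hreg : ∀ θ θ', reg (mid θ θ') + κ * dist θ θ' ^ 2 ≤ (reg θ + reg θ') / 2)
    (hlip : ∀ t, t ≤ T → ∀ θ θ', ‖pred t θ - pred t θ'‖ ≤ G * dist θ θ')
    (θ : ℕ → Θ)
    (hrun : ∀ t, 1 ≤ t → t < T → θ (t + 1) ∈ K ∧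
      IsMinOn (fun ϑ => ∑ u ∈ Icc 1 t, ‖pred u ϑ - y u‖ ^ 2 + reg ϑ) K (θ (t + 1)))
    (hT : 1 ≤ T) {ϑ : Θ} (hϑ : ϑ ∈ K) :
    ∑ t ∈ Icc 2 T, ‖pred t (θ t) - y t‖ ^ 2 ≤
      2 * (∑ t ∈ Icc 1 T, ‖pred t ϑ - y t‖ ^ 2 + reg ϑ) := by
  have hconv : ∀ (v a b : V), ‖(1 / 2 : ℝ) • (a + b) - v‖ ^ 2 ≤ (‖a - v‖ ^ 2 + ‖b - v‖ ^ 2) / 2 := by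
    intro v a b
    have e : (1 / 2 : ℝ) • (a + b) - v = (1 / 2 : ℝ) • ((a - v) + (b - v)) := by module
    rw [e, norm_smul, mul_pow]
    have := parallelogram_law_with_norm ℝ (a - v) (b - v)
    norm_num
    nlinarith [norm_nonneg ((a - v) - (b - v))]
  -- Comparing the minimizer with its midpoint to `ϑ` turns midpoint strong convexity into quadratic
  -- growth away from the minimizer.
  have hstep : ∀ t, 1 ≤ t → t < T → ∀ ϑ ∈ K,
      (∑ u ∈ Icc 1 t, ‖pred u (θ (t + 1)) - y u‖ ^ 2 + reg (θ (t + 1))) +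
        2 * κ * dist ϑ (θ (t + 1)) ^ 2 ≤ ∑ u ∈ Icc 1 t, ‖pred u ϑ - y u‖ ^ 2 + reg ϑ := by
    intro t ht1 htT ϑ hϑ
    obtain ⟨hK, hmin⟩ := hrun t ht1 htT
    have h1 := isMinOn_iff.1 hmin _ (hmidK ϑ hϑ _ hK)
    have h2 := hreg ϑ (θ (t + 1))
    have h3 : ∑ u ∈ Icc 1 t, ‖pred u (mid ϑ (θ (t + 1))) - y u‖ ^ 2 ≤
        (∑ u ∈ Icc 1 t, ‖pred u ϑ - y u‖ ^ 2 +
          ∑ u ∈ Icc 1 t, ‖pred u (θ (t + 1)) - y u‖ ^ 2) / 2 := by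
      rw [← sum_add_distrib, sum_div]
      refine sum_le_sum fun u _ => ?_
      rw [hmid]; exact hconv _ _ _
    linarith
  -- Be-the-leader induction: the hypothesis for `t` is used with the leader `θ (t + 1)` as
  -- competitor. The new loss is at most `2b² + 2(Gz)²`, and `2(Gz)² ≤ 4κz²` is exactly twice the
  -- growth gained in `hstep`. The factor two on the competitor thus removes any dependence on the
  -- horizon.
  have hind : ∀ t, 1 ≤ t → t ≤ T → ∀ ϑ ∈ K, ∑ s ∈ Icc 2 t, ‖pred s (θ s) - y s‖ ^ 2 ≤
      2 * (∑ u ∈ Icc 1 t, ‖pred u ϑ - y u‖ ^ 2 + reg ϑ) := by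
    intro t ht
    induction t, ht using Nat.le_induction with
    | base =>
      intro _ ϑ _
      have := hreg0 ϑ
      simp only [Icc_self, sum_singleton]
      rw [Icc_eq_empty (by norm_num), sum_empty]
      positivity
    | succ t ht ih =>
      intro htT ϑ hϑ
      have h1 := hstep t ht (by omega) ϑ hϑ
      have h2 := ih (by omega) _ (hrun t ht (by omega)).1
      rw [sum_Icc_succ_top (by omega), sum_Icc_succ_top (by omega)]
      have h3 := hlip (t + 1) htT ϑ (θ (t + 1))
      set z := dist ϑ (θ (t + 1)) with hz
      have h4 : ‖pred (t + 1) (θ (t + 1)) - y (t + 1)‖ ≤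
          ‖pred (t + 1) ϑ - y (t + 1)‖ + ‖pred (t + 1) ϑ - pred (t + 1) (θ (t + 1))‖ := by
        have e : pred (t + 1) (θ (t + 1)) - y (t + 1) =
          (pred (t + 1) ϑ - y (t + 1)) - (pred (t + 1) ϑ - pred (t + 1) (θ (t + 1))) := by abel
        rw [e]; exact norm_sub_le _ _
      set a := ‖pred (t + 1) (θ (t + 1)) - y (t + 1)‖
      set b := ‖pred (t + 1) ϑ - y (t + 1)‖
      have ha : 0 ≤ a := norm_nonneg _
      have h5 : a ≤ b + G * z := h4.trans (by linarith)
      have h6 : a ^ 2 ≤ 2 * (b ^ 2 + (G * z) ^ 2) := by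
        calc a ^ 2 ≤ (b + G * z) ^ 2 := pow_le_pow_left₀ ha h5 2
          _ ≤ _ := by nlinarith [sq_nonneg (b - G * z)]
      have h7 : (G * z) ^ 2 ≤ 2 * κ * z ^ 2 := by
        rw [mul_pow]; exact mul_le_mul_of_nonneg_right hGκ (sq_nonneg _)
      linarith
  exact hind T hT le_rfl ϑ hϑ

theorem frobNorm_nonneg {𝕜 : Type*} [RCLike 𝕜] {m n : ℕ} (A : Matrix (Fin m) (Fin n) 𝕜) :
    0 ≤ frobNorm A := Real.sqrt_nonneg _

theorem frobNorm_sq {𝕜 : Type*} [RCLike 𝕜] {m n : ℕ} (A : Matrix (Fin m) (Fin n) 𝕜) :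
    frobNorm A ^ 2 = ∑ i, ∑ j, ‖A i j‖ ^ 2 := Real.sq_sqrt (by positivity)

theorem norm_toEuclideanLin_le {m n : ℕ} (A : Matrix (Fin m) (Fin n) ℝ)
    (v : EuclideanSpace ℝ (Fin n)) : ‖A.toEuclideanLin v‖ ≤ frobNorm A * ‖v‖ := by
  refine le_of_sq_le_sq ?_ (mul_nonneg (frobNorm_nonneg _) (norm_nonneg _))
  rw [mul_pow, frobNorm_sq, EuclideanSpace.norm_sq_eq, EuclideanSpace.norm_sq_eq, sum_mul]
  refine sum_le_sum fun i _ => ?_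
  have : (A.toEuclideanLin v) i = ∑ j, A i j * v j := by
    simp [Matrix.toLpLin_apply, Matrix.mulVec, dotProduct]
  rw [this]
  simp only [Real.norm_eq_abs, sq_abs]
  exact sum_mul_sq_le_sq_mul_sq _ _ _

/-- A family of matrices as one Euclidean vector. -/
noncomputable def stack {k m n : ℕ} (M : Fin k → Matrix (Fin m) (Fin n) ℝ) :
    EuclideanSpace ℝ (Fin k × Fin m × Fin n) :=
  WithLp.toLp 2 fun a => M a.1 a.2.1 a.2.2

theorem norm_stack {k m n : ℕ} (M : Fin k → Matrix (Fin m) (Fin n) ℝ) :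
    ‖stack M‖ = √(∑ h, frobNorm (M h) ^ 2) := by
  rw [EuclideanSpace.norm_eq]
  congr 1
  simp_rw [frobNorm_sq]
  rw [Fintype.sum_prod_type]
  refine sum_congr rfl fun h _ => ?_
  rw [Fintype.sum_prod_type]
  rfl

theorem norm2q_one {m n k W : ℕ} (M : Fin W → Fin k → Matrix (Fin m) (Fin n) ℝ) :
    norm2q 1 M = ∑ p, ‖stack (M p)‖ := by
  simp [norm2q, norm_stack]

theorem normq_one {τ : ℕ} (β : Fin τ → ℝ) : normq 1 β = ∑ u, |β u| := by
  simp [normq]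

theorem norm2q_sq {m n k W : ℕ} (q : ℝ) (M : Fin W → Fin k → Matrix (Fin m) (Fin n) ℝ) :
    norm2q q M ^ 2 = (∑ p, ‖stack (M p)‖ ^ q) ^ (2 / q) := by
  simp only [norm2q, norm_stack]
  rw [← Real.rpow_natCast, ← Real.rpow_mul (sum_nonneg fun _ _ => by positivity)]
  congr 1; push_cast; ring

theorem normq_sq {τ : ℕ} (q : ℝ) (β : Fin τ → ℝ) :
    normq q β ^ 2 = (∑ u, ‖β u‖ ^ q) ^ (2 / q) := by
  simp only [normq, Real.norm_eq_abs]
  rw [← Real.rpow_natCast, ← Real.rpow_mul (sum_nonneg fun _ _ => by positivity)]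
  congr 1; push_cast; ring

theorem norm_sum_toEuclideanLin_le {k m n : ℕ} (M : Fin k → Matrix (Fin m) (Fin n) ℝ)
    (v : Fin k → EuclideanSpace ℝ (Fin n)) {r : ℝ} (hr : 0 ≤ r) (hv : ∀ h, ‖v h‖ ≤ r) :
    ‖∑ h, (M h).toEuclideanLin (v h)‖ ≤ ‖stack M‖ * (√k * r) := by
  have h1 : ‖∑ h, (M h).toEuclideanLin (v h)‖ ≤ ∑ h, frobNorm (M h) * r :=
    (norm_sum_le _ _).trans (sum_le_sum fun h _ => (norm_toEuclideanLin_le _ _).trans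
      (mul_le_mul_of_nonneg_left (hv h) (frobNorm_nonneg _)))
  refine h1.trans ?_
  rw [norm_stack, ← sum_mul, ← mul_assoc]
  refine mul_le_mul_of_nonneg_right ?_ hr
  rw [← Real.sqrt_mul (by positivity)]
  refine Real.le_sqrt_of_sq_le ?_
  have := sum_mul_sq_le_sq_mul_sq univ (fun h => frobNorm (M h)) (fun _ => (1 : ℝ))
  simpa using this

namespace PseudoLDS

variable {n m τ k W : ℕ}

/-- The midpoint of two pseudo-LDSs. -/
noncomputable def mid (θ θ' : PseudoLDS n m τ k W) : PseudoLDS n m τ k W where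
  M := fun p h => (1 / 2 : ℝ) • (θ.M p h + θ'.M p h)
  N := fun p h => (1 / 2 : ℝ) • (θ.N p h + θ'.N p h)
  β := fun u => (1 / 2 : ℝ) • (θ.β u + θ'.β u)
  P := fun j => (1 / 2 : ℝ) • (θ.P j + θ'.P j)

/-- The difference of two pseudo-LDSs. -/
noncomputable def sub (θ θ' : PseudoLDS n m τ k W) : PseudoLDS n m τ k W where
  M := fun p h => θ.M p h - θ'.M p h
  N := fun p h => θ.N p h - θ'.N p h
  β := fun u => θ.β u - θ'.β u
  P := fun j => θ.P j - θ'.P j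

theorem compNorm_eq (θ : PseudoLDS n m τ k W) :
    θ.compNorm = ∑ p, ‖stack (θ.M p)‖ + ∑ p, ‖stack (θ.N p)‖ + ∑ u, |θ.β u| + ‖stack θ.P‖ := by
  rw [compNorm, norm2q_one, norm2q_one, normq_one, norm_stack]

theorem regularizer_eq (θ : PseudoLDS n m τ k W) :
    θ.regularizer = (∑ p, ‖stack (θ.M p)‖ ^ regExponent W) ^ (2 / regExponent W) +
      (∑ p, ‖stack (θ.N p)‖ ^ regExponent W) ^ (2 / regExponent W) +
      (∑ u, ‖θ.β u‖ ^ regExponent τ) ^ (2 / regExponent τ) + ‖stack θ.P‖ ^ 2 := by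
  rw [regularizer, norm2q_sq, norm2q_sq, normq_sq, norm_stack, Real.sq_sqrt (by positivity)]

theorem regularizer_nonneg (θ : PseudoLDS n m τ k W) : 0 ≤ θ.regularizer := by
  rw [regularizer]; positivity

theorem stack_mid (A B : Fin k → Matrix (Fin m) (Fin n) ℝ) :
    stack (fun h => (1 / 2 : ℝ) • (A h + B h)) = (1 / 2 : ℝ) • (stack A + stack B) := rfl

theorem stack_sub (A B : Fin k → Matrix (Fin m) (Fin n) ℝ) :
    stack (fun h => A h - B h) = stack A - stack B := rfl

theorem norm_half_smul_add_le {E : Type*} [NormedAddCommGroup E] [NormedSpace ℝ E] (a b : E) :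
    ‖(1 / 2 : ℝ) • (a + b)‖ ≤ (‖a‖ + ‖b‖) / 2 := by
  rw [norm_smul]
  have := norm_add_le a b
  norm_num; linarith

theorem compNorm_mid_le (θ θ' : PseudoLDS n m τ k W) :
    (mid θ θ').compNorm ≤ (θ.compNorm + θ'.compNorm) / 2 := by
  simp only [compNorm_eq, mid, stack_mid]
  have h1 := sum_le_sum fun p (_ : p ∈ univ) => norm_half_smul_add_le (stack (θ.M p)) (stack (θ'.M p))
  have h2 := sum_le_sum fun p (_ : p ∈ univ) => norm_half_smul_add_le (stack (θ.N p)) (stack (θ'.N p))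
  have h3 := sum_le_sum fun p (_ : p ∈ univ) => norm_half_smul_add_le (θ.β p) (θ'.β p)
  have h4 := norm_half_smul_add_le (stack θ.P) (stack θ'.P)
  rw [← sum_div, sum_add_distrib] at h1 h2 h3
  simp only [Real.norm_eq_abs] at h3
  linarith

theorem predict_mid {T : ℕ} (θ θ' : PseudoLDS n m τ k W) (σ : Fin k → ℝ)
    (φ : Fin k → EuclideanSpace ℝ (Fin T)) (x : ℕ → EuclideanSpace ℝ (Fin n))
    (y : ℕ → EuclideanSpace ℝ (Fin m)) (t : ℕ) :
    (mid θ θ').predict σ φ x y t =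
      (1 / 2 : ℝ) • (θ.predict σ φ x y t + θ'.predict σ φ x y t) := by
  simp only [predict, mid, map_smul, map_add, LinearMap.smul_apply, LinearMap.add_apply,
    smul_add, smul_sum, smul_eq_mul, add_smul, mul_smul, sum_add_distrib, mul_add]
  abel

theorem predict_sub {T : ℕ} (θ θ' : PseudoLDS n m τ k W) (σ : Fin k → ℝ)
    (φ : Fin k → EuclideanSpace ℝ (Fin T)) (x : ℕ → EuclideanSpace ℝ (Fin n))
    (y : ℕ → EuclideanSpace ℝ (Fin m)) (t : ℕ) :
    (sub θ θ').predict σ φ x y t = θ.predict σ φ x y t - θ'.predict σ φ x y t := by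
  simp only [predict, sub, map_sub, LinearMap.sub_apply, sub_smul, sum_sub_distrib,
    sum_add_distrib]
  abel

end PseudoLDS

theorem norm_lag_le {n T : ℕ} {x : ℕ → EuclideanSpace ℝ (Fin n)} {Rx : ℝ} (h0 : 0 ≤ Rx)
    (hx : ∀ t ∈ Icc 1 T, ‖x t‖ ≤ Rx) {t : ℕ} (ht : t ≤ T) (j : ℕ) : ‖lag x t j‖ ≤ Rx := by
  rw [lag]
  split_ifs with h
  · exact hx _ (mem_Icc.2 ⟨by omega, by omega⟩)
  · simpa using h0

theorem norm_filtered_le {n T : ℕ} {x : ℕ → EuclideanSpace ℝ (Fin n)} {Rx : ℝ} (h0 : 0 ≤ Rx)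
    (hx : ∀ t ∈ Icc 1 T, ‖x t‖ ≤ Rx) {t : ℕ} (ht : t ≤ T) (τ : ℕ) {σ : ℝ} (hσ : 0 ≤ σ)
    {φ : EuclideanSpace ℝ (Fin T)} {b : ℝ} (hb : σ ^ (1 / 4 : ℝ) * ∑ i, |φ i| ≤ b) {g : ℕ → ℝ}
    (hg : ∀ u, |g u| ≤ 1) : ‖filtered τ σ φ g x t‖ ≤ b * Rx := by
  rw [filtered, norm_smul, Real.norm_of_nonneg (Real.rpow_nonneg hσ _)]
  have h1 : ‖∑ u : Fin T, (φ u * g ((u : ℕ) + 1)) • lag x t (τ + u)‖ ≤ (∑ i, |φ i|) * Rx := by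
    rw [sum_mul]
    refine (norm_sum_le _ _).trans (sum_le_sum fun u _ => ?_)
    rw [norm_smul, norm_mul, Real.norm_eq_abs, Real.norm_eq_abs]
    exact mul_le_mul (mul_le_of_le_one_right (abs_nonneg _) (hg _)) (norm_lag_le h0 hx ht _)
      (norm_nonneg _) (abs_nonneg _)
  calc _ ≤ σ ^ (1 / 4 : ℝ) * ((∑ i, |φ i|) * Rx) :=
        mul_le_mul_of_nonneg_left h1 (Real.rpow_nonneg hσ _)
    _ = (σ ^ (1 / 4 : ℝ) * ∑ i, |φ i|) * Rx := by ring
    _ ≤ _ := mul_le_mul_of_nonneg_right hb h0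

namespace PseudoLDS

/-- Predictions are linear in the pseudo-LDS, so applied to a difference this is the Lipschitz bound
for the regret. The `ℓ¹` bound on the scaled wavefilters makes filtered inputs at most
logarithmically larger than `Rx`; `√k` and `√τ` come from Cauchy–Schwarz over `h` and over the lags
of `P`. -/
theorem norm_predict_le {n m τ k W T : ℕ} (hτ : 1 ≤ τ) (hk : 1 ≤ k)
    (θ : PseudoLDS n m τ k W) {σ : Fin k → ℝ}
    {φ : Fin k → EuclideanSpace ℝ (Fin T)} (hσφ : IsTopEigenpairs T k σ φ)
    {x : ℕ → EuclideanSpace ℝ (Fin n)} {y : ℕ → EuclideanSpace ℝ (Fin m)} {Rx Ry : ℝ}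
    (hRx : 1 ≤ Rx) (hRy : 1 ≤ Ry) (hx : ∀ t ∈ Icc 1 T, ‖x t‖ ≤ Rx)
    (hy : ∀ t ∈ Icc 1 T, ‖y t‖ ≤ Ry) {t : ℕ} (ht : t ≤ T) :
    ‖θ.predict σ φ x y t‖ ≤ (Nat.log 2 T + 1) * √(k * τ) * Rx * Ry * θ.compNorm := by
  obtain ⟨hφ, -, heig, -⟩ := hσφ
  set b : ℝ := Nat.log 2 T + 1 with hb
  have hb1 : 1 ≤ b := by rw [hb]; linarith [(Nat.cast_nonneg (Nat.log 2 T) : (0 : ℝ) ≤ _)]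
  have hk' : 1 ≤ √(k : ℝ) := Real.one_le_sqrt.2 (by exact_mod_cast hk)
  have hτ' : 1 ≤ √(τ : ℝ) := Real.one_le_sqrt.2 (by exact_mod_cast hτ)
  have hsq : √((k : ℝ) * τ) = √k * √τ := Real.sqrt_mul (by positivity) _
  have hX : ∀ (g : ℕ → ℝ), (∀ u, |g u| ≤ 1) → ∀ h, ‖filtered τ (σ h) (φ h) g x t‖ ≤ b * Rx :=
    fun g hg h => norm_filtered_le (by linarith) hx ht τ
      (hankel_eigenvalue_nonneg (heig h) (hφ.1 h)) (hankel_eigenvector_l1_le (heig h) (hφ.1 h)) hg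
  have key : ∀ {z w c : ℝ}, 0 ≤ c → z ≤ c * w → w ≤ b * √(k * τ) * Rx * Ry →
      z ≤ b * √(k * τ) * Rx * Ry * c := fun hc h1 h2 =>
    h1.trans (by rw [mul_comm]; exact mul_le_mul_of_nonneg_right h2 hc)
  have hM : ∀ (M : Fin W → Fin k → Matrix (Fin m) (Fin n) ℝ) (g : Fin W → ℕ → ℝ),
      (∀ p u, |g p u| ≤ 1) →
      ‖∑ p, ∑ h, (M p h).toEuclideanLin (filtered τ (σ h) (φ h) (g p) x t)‖ ≤
        b * √(k * τ) * Rx * Ry * ∑ p, ‖stack (M p)‖ := by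
    intro M g hg
    refine key (w := √k * (b * Rx)) (by positivity) ?_ ?_
    · rw [sum_mul]
      exact (norm_sum_le _ _).trans (sum_le_sum fun p _ =>
        norm_sum_toEuclideanLin_le _ _ (by positivity) (hX _ (hg p)))
    · rw [hsq]
      calc √k * (b * Rx) = b * (√k * 1) * Rx * 1 := by ring
        _ ≤ _ := by gcongr
  have h1 : ‖∑ u : Fin τ, θ.β u • lag y t ((u : ℕ) + 1)‖ ≤
      b * √(k * τ) * Rx * Ry * ∑ u, |θ.β u| := by
    refine key (w := Ry) (by positivity) ?_ ?_
    · rw [sum_mul]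
      refine (norm_sum_le _ _).trans (sum_le_sum fun u _ => ?_)
      rw [norm_smul, Real.norm_eq_abs]
      exact mul_le_mul_of_nonneg_left (norm_lag_le (by linarith) hy ht _) (abs_nonneg _)
    · rw [hsq]
      calc Ry = 1 * (1 * 1) * 1 * Ry := by ring
        _ ≤ _ := by gcongr
  have h2 : ‖∑ j : Fin τ, (θ.P j).toEuclideanLin (lag x t j)‖ ≤
      b * √(k * τ) * Rx * Ry * ‖stack θ.P‖ := by
    refine key (w := √τ * Rx) (by positivity) ?_ ?_
    · exact norm_sum_toEuclideanLin_le _ _ (by linarith) fun j => norm_lag_le (by linarith) hx ht _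
    · rw [hsq]
      calc √τ * Rx = 1 * (1 * √τ) * Rx * 1 := by ring
        _ ≤ _ := by gcongr
  have h3 := hM θ.M (fun p u => Real.cos (2 * Real.pi * u * (p : ℕ) / W))
    fun p u => Real.abs_cos_le_one _
  have h4 := hM θ.N (fun p u => Real.sin (2 * Real.pi * u * (p : ℕ) / W))
    fun p u => Real.abs_sin_le_one _
  rw [predict, compNorm_eq]
  simp only [sum_add_distrib]
  calc _ ≤ _ := norm_add₃_le
    _ ≤ _ := add_le_add (add_le_add h1 h2) ((norm_add_le _ _).trans (add_le_add h3 h4))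
    _ = _ := by ring

end PseudoLDS

end Predictions

/-! ### Regret of the algorithm against a fixed pseudo-LDS. -/

section Regret

open Finset

theorem two_lt_log {s : ℕ} (hs : 8 ≤ s) : 2 < Real.log s := by
  rw [Real.lt_log_iff_exp_lt (by positivity)]
  have h1 : Real.exp 2 = Real.exp 1 ^ 2 := by rw [← Real.exp_nat_mul]; norm_num
  have h2 := Real.exp_one_lt_d9
  have h3 := Real.exp_pos 1
  have h4 : (8 : ℝ) ≤ s := by exact_mod_cast hs
  rw [h1]; nlinarith

/-- The exponent is below two exactly when `log s > 2`, and `8 > e²`; hence the requirement that `W`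
and `τ'` be at least eight. -/
theorem regExponent_bounds {s : ℕ} (hs : 8 ≤ s) : 1 < regExponent s ∧ regExponent s < 2 := by
  have h := two_lt_log hs
  rw [regExponent, lt_div_iff₀ (by linarith), div_lt_iff₀ (by linarith)]
  constructor <;> linarith

/-- The modulus of convexity for the exponent `ln s / (ln s - 1)` in dimension `s`. -/
theorem modulus_regExponent_ge {s : ℕ} (hs : 8 ≤ s) {Λ : ℝ} (hΛ : Real.log s ≤ Λ) :
    1 / (24 * Real.exp 2 * Λ) ≤ (regExponent s - 1) /
      (24 * (s : ℝ) ^ (2 * (regExponent s - 1) / regExponent s)) := by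
  have h := two_lt_log hs
  have hs0 : (0 : ℝ) < s := by positivity
  have h1 : regExponent s - 1 = 1 / (Real.log s - 1) := by
    rw [regExponent]; have : Real.log s - 1 ≠ 0 := by linarith
    field_simp; ring
  -- For this exponent `(q - 1) / q = 1 / log s`, so the dimensional factor is the constant `e²`.
  have h2 : (s : ℝ) ^ (2 * (regExponent s - 1) / regExponent s) = Real.exp 2 := by
    rw [Real.rpow_def_of_pos hs0, h1, regExponent]
    have h3 : Real.log s - 1 ≠ 0 := by linarith
    have h4 : Real.log s ≠ 0 := by linarith
    congr 1; field_simp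
  rw [h2, h1, div_div]
  have := Real.exp_pos 2
  refine one_div_le_one_div_of_le (mul_pos (by linarith) (by positivity)) ?_
  have : (Real.log s - 1) * (24 * Real.exp 2) ≤ Λ * (24 * Real.exp 2) := by gcongr; linarith
  linarith

/-- Each of the four blocks has modulus at least `1 / (24 e² Λ)`, and `(a + b + c + e)² ≤ 4 (a² + b²
+ c² + e²)` turns `24` into `96`. -/
theorem PseudoLDS.regularizer_mid_le {n m τ k W : ℕ} (hW : 8 ≤ W) (hτ : 8 ≤ τ) {Λ : ℝ}
    (hΛW : Real.log W ≤ Λ) (hΛτ : Real.log τ ≤ Λ) (θ θ' : PseudoLDS n m τ k W) :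
    (mid θ θ').regularizer + 1 / (96 * Real.exp 2 * Λ) * (sub θ θ').compNorm ^ 2 ≤
      (θ.regularizer + θ'.regularizer) / 2 := by
  have hΛ2 : 2 < Λ := (two_lt_log hW).trans_le hΛW
  have hκ : 0 < 1 / (24 * Real.exp 2 * Λ) := by have := Real.exp_pos 2; positivity
  have h14 : 1 / (24 * Real.exp 2 * Λ) ≤ 1 / 4 := by
    refine one_div_le_one_div_of_le (by norm_num) ?_
    nlinarith [Real.add_one_le_exp (2 : ℝ)]
  obtain ⟨hq1, hq2⟩ := regExponent_bounds hW
  obtain ⟨hr1, hr2⟩ := regExponent_bounds hτ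
  have h1 := mixed_norm_sq_midpoint_gap hq1 hq2 (fun p => stack (θ.M p)) (fun p => stack (θ'.M p))
  have h2 := mixed_norm_sq_midpoint_gap hq1 hq2 (fun p => stack (θ.N p)) (fun p => stack (θ'.N p))
  have h3 := mixed_norm_sq_midpoint_gap hr1 hr2 θ.β θ'.β
  rw [Fintype.card_fin] at h1 h2 h3
  have mW := modulus_regExponent_ge hW hΛW
  have mτ := modulus_regExponent_ge hτ hΛτ
  have h4 : ‖(1 / 2 : ℝ) • (stack θ.P + stack θ'.P)‖ ^ 2 + 1 / 4 * ‖stack θ.P - stack θ'.P‖ ^ 2 =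
      (‖stack θ.P‖ ^ 2 + ‖stack θ'.P‖ ^ 2) / 2 := by
    have := parallelogram_law_with_norm ℝ (stack θ.P) (stack θ'.P)
    rw [norm_smul]; norm_num
    nlinarith
  simp only [regularizer_eq, compNorm_eq, mid, sub, stack_mid, stack_sub]
  simp only [Real.norm_eq_abs (θ.β _ - θ'.β _)] at h3
  set a := ∑ p, ‖stack (θ.M p) - stack (θ'.M p)‖
  set b := ∑ p, ‖stack (θ.N p) - stack (θ'.N p)‖
  set c := ∑ u, |θ.β u - θ'.β u|
  set e := ‖stack θ.P - stack θ'.P‖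
  have k1 := mul_le_mul_of_nonneg_right mW (sq_nonneg a)
  have k2 := mul_le_mul_of_nonneg_right mW (sq_nonneg b)
  have k3 := mul_le_mul_of_nonneg_right mτ (sq_nonneg c)
  have k4 := mul_le_mul_of_nonneg_right h14 (sq_nonneg e)
  have k5 : 1 / (96 * Real.exp 2 * Λ) * (a + b + c + e) ^ 2 ≤
      1 / (24 * Real.exp 2 * Λ) * (a ^ 2 + b ^ 2 + c ^ 2 + e ^ 2) := by
    have : (a + b + c + e) ^ 2 ≤ 4 * (a ^ 2 + b ^ 2 + c ^ 2 + e ^ 2) := by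
      nlinarith [sq_nonneg (a - b), sq_nonneg (a - c), sq_nonneg (a - e), sq_nonneg (b - c),
        sq_nonneg (b - e), sq_nonneg (c - e)]
    calc _ ≤ 1 / (96 * Real.exp 2 * Λ) * (4 * (a ^ 2 + b ^ 2 + c ^ 2 + e ^ 2)) :=
          mul_le_mul_of_nonneg_left this (by have := Real.exp_pos 2; positivity)
      _ = _ := by field_simp; ring
  linarith

/-- Regret of follow-the-regularized-leader: with a suitable learning rate, the total loss is at
most twice that of any competitor plus a term that does not grow with the horizon. -/
theorem AlgParams.IsRun.sum_loss_le {n m T : ℕ} {a : AlgParams} {σ : Fin a.k → ℝ}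
    {φ : Fin a.k → EuclideanSpace ℝ (Fin T)} {x : ℕ → EuclideanSpace ℝ (Fin n)}
    {y : ℕ → EuclideanSpace ℝ (Fin m)} {θ : ℕ → PseudoLDS n m a.τ a.k a.W}
    (hrun : a.IsRun σ φ x y θ) (hT : 1 ≤ T) (hk : 1 ≤ a.k) (hW : 8 ≤ a.W) (hτ : 8 ≤ a.τ)
    (hσφ : IsTopEigenpairs T a.k σ φ) {Rx Ry Λ G : ℝ} (hRx : 1 ≤ Rx) (hRy : 1 ≤ Ry)
    (hx : ∀ t ∈ Icc 1 T, ‖x t‖ ≤ Rx) (hy : ∀ t ∈ Icc 1 T, ‖y t‖ ≤ Ry)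
    (hΛW : Real.log a.W ≤ Λ) (hΛτ : Real.log a.τ ≤ Λ)
    (hG : (Nat.log 2 T + 1) * √(a.k * a.τ) * Rx * Ry = G)
    (hrate : a.rate = 1 / (48 * Real.exp 2 * Λ * G ^ 2)) (hrad : 1 ≤ a.radius)
    {ϑ : PseudoLDS n m a.τ a.k a.W} (hϑ : ϑ ∈ a.decisionSet n m) :
    ∑ t ∈ Icc 1 T, ‖(θ t).predict σ φ x y t - y t‖ ^ 2 ≤
      2 * ∑ t ∈ Icc 1 T, ‖ϑ.predict σ φ x y t - y t‖ ^ 2 +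
        96 * Real.exp 2 * Λ * G ^ 2 * ϑ.regularizer + 4 * G ^ 2 * a.radius ^ 2 := by
  obtain ⟨hθ1, hmin⟩ := hrun
  have hΛ2 : 2 < Λ := (two_lt_log hW).trans_le hΛW
  have hb1 : (1 : ℝ) ≤ Nat.log 2 T + 1 := by linarith [(Nat.cast_nonneg (Nat.log 2 T) : (0 : ℝ) ≤ _)]
  have hkτ : (1 : ℝ) ≤ √(a.k * a.τ) := by
    rw [Real.one_le_sqrt]
    have : 1 ≤ a.k * a.τ := Nat.mul_pos hk (by omega)
    exact_mod_cast this
  have hRyG : Ry ≤ G := by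
    rw [← hG]
    calc Ry = 1 * 1 * 1 * Ry := by ring
      _ ≤ _ := by gcongr
  have hG1 : 1 ≤ G := hRy.trans hRyG
  have hrate0 : 0 < a.rate := by
    rw [hrate]; have := Real.exp_pos 2; positivity
  have hpred : ∀ t ≤ T, ∀ θ : PseudoLDS n m a.τ a.k a.W,
      ‖θ.predict σ φ x y t‖ ≤ G * θ.compNorm := fun t ht θ => by
    rw [← hG]; exact θ.norm_predict_le (by omega) hk hσφ hRx hRy hx hy ht
  have hftrl := ftrl_sum_le (a.decisionSet n m)
    (fun t (θ : PseudoLDS n m a.τ a.k a.W) => θ.predict σ φ x y t) y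
    (fun θ => θ.regularizer / a.rate) PseudoLDS.mid (fun θ θ' => (PseudoLDS.sub θ θ').compNorm)
    (G := G) (κ := 1 / (96 * Real.exp 2 * Λ) / a.rate) T
    -- The learning rate is chosen so that `κ = G² / 2`, the smallest modulus allowed.
    (le_of_eq (by rw [hrate]; have := Real.exp_pos 2; field_simp; norm_num))
    (fun θ => div_nonneg θ.regularizer_nonneg hrate0.le)
    (fun θ hθ θ' hθ' => (PseudoLDS.compNorm_mid_le θ θ').trans (by
      have h1 : θ.compNorm ≤ a.radius := hθ
      have h2 : θ'.compNorm ≤ a.radius := hθ'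
      linarith))
    (fun t θ θ' => PseudoLDS.predict_mid θ θ' σ φ x y t)
    (fun θ θ' => by
      have := div_le_div_of_nonneg_right (PseudoLDS.regularizer_mid_le hW hτ hΛW hΛτ θ θ') hrate0.le
      calc _ = _ := by rw [div_mul_eq_mul_div, ← add_div]
        _ ≤ _ := this
        _ = _ := by ring)
    (fun t ht θ θ' => by rw [← PseudoLDS.predict_sub]; exact hpred t ht _)
    θ hmin hT hϑ
  -- The starting point is arbitrary, so the first round is bounded by the size of the decision set.
  have h1 : ‖(θ 1).predict σ φ x y 1 - y 1‖ ^ 2 ≤ 4 * G ^ 2 * a.radius ^ 2 := by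
    have h2 : ‖(θ 1).predict σ φ x y 1‖ ≤ G * a.radius :=
      (hpred 1 hT _).trans (mul_le_mul_of_nonneg_left hθ1 (by linarith))
    have h3 : ‖y 1‖ ≤ G * a.radius :=
      (hy 1 (mem_Icc.2 ⟨le_rfl, hT⟩)).trans (hRyG.trans (le_mul_of_one_le_right (by linarith) hrad))
    calc _ ≤ (2 * (G * a.radius)) ^ 2 :=
          pow_le_pow_left₀ (norm_nonneg _) ((norm_sub_le _ _).trans (by linarith)) 2
      _ = _ := by ring
  have hsplit : ∑ t ∈ Icc 1 T, ‖(θ t).predict σ φ x y t - y t‖ ^ 2 =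
      ‖(θ 1).predict σ φ x y 1 - y 1‖ ^ 2 +
      ∑ t ∈ Icc 2 T, ‖(θ t).predict σ φ x y t - y t‖ ^ 2 := by
    rw [← add_sum_Ioc_eq_sum_Icc hT]
    rfl
  have hdiv : ϑ.regularizer / a.rate = 48 * Real.exp 2 * Λ * G ^ 2 * ϑ.regularizer := by
    rw [hrate, div_div_eq_mul_div, div_one, mul_comm]
  rw [hdiv] at hftrl
  rw [hsplit]
  linarith

/-- If the decision set is so small that all predictions are bounded by `Ry`, the loss is trivially
bounded. -/
theorem AlgParams.IsRun.sum_loss_le_of_small {n m T : ℕ} {a : AlgParams} {σ : Fin a.k → ℝ}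
    {φ : Fin a.k → EuclideanSpace ℝ (Fin T)} {x : ℕ → EuclideanSpace ℝ (Fin n)}
    {y : ℕ → EuclideanSpace ℝ (Fin m)} {θ : ℕ → PseudoLDS n m a.τ a.k a.W}
    (hrun : a.IsRun σ φ x y θ) (hk : 1 ≤ a.k) (hτ : 1 ≤ a.τ)
    (hσφ : IsTopEigenpairs T a.k σ φ) {Rx Ry : ℝ} (hRx : 1 ≤ Rx) (hRy : 1 ≤ Ry)
    (hx : ∀ t ∈ Icc 1 T, ‖x t‖ ≤ Rx) (hy : ∀ t ∈ Icc 1 T, ‖y t‖ ≤ Ry)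
    (hrad : (Nat.log 2 T + 1) * √(a.k * a.τ) * Rx * Ry * a.radius ≤ Ry) :
    ∑ t ∈ Icc 1 T, ‖(θ t).predict σ φ x y t - y t‖ ^ 2 ≤ 4 * Ry ^ 2 * T := by
  have hmem : ∀ t ∈ Icc 1 T, θ t ∈ a.decisionSet n m := by
    intro t ht
    obtain ⟨h1, h2⟩ := mem_Icc.1 ht
    rcases h1.eq_or_lt with rfl | h
    · exact hrun.1
    · obtain ⟨s, rfl⟩ := Nat.exists_eq_add_of_lt h
      rw [show 1 + s + 1 = (s + 1) + 1 by ring] at h2 ⊢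
      exact (hrun.2 (s + 1) (by omega) (by omega)).1
  calc _ ≤ ∑ t ∈ Icc 1 T, (2 * Ry) ^ 2 := by
        refine sum_le_sum fun t ht => pow_le_pow_left₀ (norm_nonneg _) ?_ 2
        have h1 := (θ t).norm_predict_le hτ hk hσφ hRx hRy hx hy (mem_Icc.1 ht).2
        have h2 : (θ t).compNorm ≤ a.radius := hmem t ht
        have h3 : (Nat.log 2 T + 1) * √(a.k * a.τ) * Rx * Ry * (θ t).compNorm ≤
            (Nat.log 2 T + 1) * √(a.k * a.τ) * Rx * Ry * a.radius :=
          mul_le_mul_of_nonneg_left h2 (by positivity)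
        linarith [norm_sub_le ((θ t).predict σ φ x y t) (y t), hy t ht]
    _ = _ := by simp; ring

end Regret

/-! ### Matrix norms, real filters, and the modes of a system. -/

section Systems

open Finset

section Frobenius

variable {𝕜 : Type*} [RCLike 𝕜]

theorem sum_norm_sq_mulVec_le {m n : ℕ} (Z : Matrix (Fin m) (Fin n) 𝕜) (v : Fin n → 𝕜) :
    ∑ i, ‖∑ l, Z i l * v l‖ ^ 2 ≤ frobNorm Z ^ 2 * ∑ l, ‖v l‖ ^ 2 := by
  rw [frobNorm_sq, sum_mul]
  refine sum_le_sum fun i _ => ?_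
  calc ‖∑ l, Z i l * v l‖ ^ 2 ≤ (∑ l, ‖Z i l‖ * ‖v l‖) ^ 2 := by
        refine pow_le_pow_left₀ (norm_nonneg _) ((norm_sum_le _ _).trans (le_of_eq ?_)) 2
        simp only [norm_mul]
    _ ≤ _ := sum_mul_sq_le_sq_mul_sq _ _ _

theorem frobNorm_mul_le {l m n : ℕ} (A : Matrix (Fin l) (Fin m) 𝕜) (B : Matrix (Fin m) (Fin n) 𝕜) :
    frobNorm (A * B) ≤ frobNorm A * frobNorm B := by
  refine le_of_sq_le_sq ?_ (mul_nonneg (frobNorm_nonneg _) (frobNorm_nonneg _))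
  rw [mul_pow, frobNorm_sq (A * B), frobNorm_sq B, sum_comm, sum_comm (f := fun i j => ‖B i j‖ ^ 2),
    mul_sum]
  refine sum_le_sum fun j _ => ?_
  simp only [Matrix.mul_apply]
  exact sum_norm_sq_mulVec_le A fun i => B i j

theorem frobNorm_one {n : ℕ} : frobNorm (1 : Matrix (Fin n) (Fin n) 𝕜) = √n := by
  rw [frobNorm]
  congr 1
  have : ∀ i j : Fin n, ‖(1 : Matrix (Fin n) (Fin n) 𝕜) i j‖ ^ 2 = if i = j then 1 else 0 := by
    intro i j
    rw [Matrix.one_apply]; split_ifs <;> simp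
  simp [this]

theorem frobNorm_diagonal_mul_le {d n : ℕ} {μ : Fin d → 𝕜} {ε : ℝ} (hμ : ∀ l, ‖μ l‖ ≤ ε)
    (hε : 0 ≤ ε) (B : Matrix (Fin d) (Fin n) 𝕜) :
    frobNorm (Matrix.diagonal μ * B) ≤ ε * frobNorm B := by
  refine le_of_sq_le_sq ?_ (mul_nonneg hε (frobNorm_nonneg _))
  rw [mul_pow, frobNorm_sq, frobNorm_sq, mul_sum]
  refine sum_le_sum fun i _ => ?_
  rw [mul_sum]
  refine sum_le_sum fun j _ => ?_
  rw [Matrix.diagonal_mul, norm_mul, mul_pow]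
  exact mul_le_mul_of_nonneg_right (pow_le_pow_left₀ (norm_nonneg _) (hμ i) 2) (sq_nonneg _)

theorem norm_toEuclideanLin_le_specNorm {m n : ℕ} (A : Matrix (Fin m) (Fin n) ℝ)
    (v : EuclideanSpace ℝ (Fin n)) : ‖A.toEuclideanLin v‖ ≤ specNorm A * ‖v‖ :=
  A.toEuclideanLin.toContinuousLinearMap.le_opNorm v

theorem specNorm_nonneg {m n : ℕ} (A : Matrix (Fin m) (Fin n) ℝ) : 0 ≤ specNorm A := norm_nonneg _

theorem toEuclideanLin_coord {m n : ℕ} (A : Matrix (Fin m) (Fin n) ℝ)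
    (v : EuclideanSpace ℝ (Fin n)) (i : Fin m) : A.toEuclideanLin v i = ∑ j, A i j * v j := by
  simp [Matrix.toLpLin_apply, Matrix.mulVec, dotProduct]

theorem frobNorm_mul_le_specNorm_mul {l m n : ℕ} (A : Matrix (Fin l) (Fin m) ℝ)
    (B : Matrix (Fin m) (Fin n) ℝ) : frobNorm (A * B) ≤ specNorm A * frobNorm B := by
  refine le_of_sq_le_sq ?_ (mul_nonneg (specNorm_nonneg _) (frobNorm_nonneg _))
  rw [mul_pow, frobNorm_sq (A * B), frobNorm_sq B, sum_comm, sum_comm (f := fun i j => ‖B i j‖ ^ 2),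
    mul_sum]
  refine sum_le_sum fun j _ => ?_
  have h := norm_toEuclideanLin_le_specNorm A (WithLp.toLp 2 fun i => B i j)
  have h2 := pow_le_pow_left₀ (norm_nonneg _) h 2
  rw [mul_pow, EuclideanSpace.norm_sq_eq, EuclideanSpace.norm_sq_eq] at h2
  simpa only [toEuclideanLin_coord, Matrix.mul_apply] using h2

theorem frobNorm_le_sqrt_mul_specNorm {m n : ℕ} (A : Matrix (Fin m) (Fin n) ℝ) :
    frobNorm A ≤ √n * specNorm A := by
  have := frobNorm_mul_le_specNorm_mul A (1 : Matrix (Fin n) (Fin n) ℝ)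
  rwa [Matrix.mul_one, frobNorm_one, mul_comm] at this

theorem frobNorm_eq_norm_stack {m n : ℕ} (A : Matrix (Fin m) (Fin n) ℝ) :
    frobNorm A = ‖stack (fun _ : Fin 1 => A)‖ := by
  rw [norm_stack]; simp [Real.sqrt_sq (frobNorm_nonneg A)]

theorem frobNorm_add_le {m n : ℕ} (A B : Matrix (Fin m) (Fin n) ℝ) :
    frobNorm (A + B) ≤ frobNorm A + frobNorm B := by
  simp only [frobNorm_eq_norm_stack]
  exact norm_add_le (stack fun _ : Fin 1 => A) (stack fun _ : Fin 1 => B)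

theorem frobNorm_smul {m n : ℕ} (c : ℝ) (A : Matrix (Fin m) (Fin n) ℝ) :
    frobNorm (c • A) = |c| * frobNorm A := by
  simp only [frobNorm_eq_norm_stack, ← Real.norm_eq_abs]
  exact norm_smul c (stack fun _ : Fin 1 => A)

theorem frobNorm_le_of_re {m n : ℕ} {A : Matrix (Fin m) (Fin n) ℝ} {Z : Matrix (Fin m) (Fin n) ℂ}
    (h : ∀ i j, A i j = (Z i j).re) : frobNorm A ≤ frobNorm Z := by
  refine Real.sqrt_le_sqrt (sum_le_sum fun i _ => sum_le_sum fun j _ => ?_)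
  rw [h, Real.norm_eq_abs]
  exact pow_le_pow_left₀ (abs_nonneg _) (Complex.abs_re_le_norm _) 2

end Frobenius

/-! ### Real filters and complex power series -/

/-- The output of the filter with coefficients `f` on a signal that starts at time `1`. -/
def filt {E : Type*} [AddCommMonoid E] [Module ℝ E] (f : ℕ → ℝ) (v : ℕ → E) (t : ℕ) : E :=
  ∑ u ∈ range t, f u • v (t - u)

/-- The generating series of a real signal that starts at time `1`. -/
noncomputable def genSeries (a : ℕ → ℝ) : PowerSeries ℂ :=
  PowerSeries.mk fun s => if s = 0 then 0 else (a s : ℂ)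

/-- The annihilator is a complex polynomial. As signals are real, filtering by the real parts of its
coefficients is the real part of filtering by `F`, and all gain bounds carry over. -/
theorem re_coeff_mul_genSeries (F : Polynomial ℂ) (a : ℕ → ℝ) (t : ℕ) :
    (PowerSeries.coeff t ((F : PowerSeries ℂ) * genSeries a)).re =
      filt (fun u => (F.coeff u).re) a t := by
  rw [PowerSeries.coeff_mul, Nat.sum_antidiagonal_eq_sum_range_succ_mk, sum_range_succ, filt]
  simp only [genSeries, Nat.sub_self, PowerSeries.coeff_mk, if_true, mul_zero, add_zero,
    Complex.re_sum, Polynomial.coeff_coe, smul_eq_mul]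
  refine sum_congr rfl fun u hu => ?_
  rw [if_neg (by have := mem_range.1 hu; omega)]
  simp

theorem sum_sq_coeff_genSeries (a : ℕ → ℝ) (T : ℕ) :
    truncNorm (T + 1) (genSeries a) ^ 2 = ∑ t ∈ Icc 1 T, ‖a t‖ ^ 2 := by
  rw [truncNorm.sq_eq, sum_range_succ', range_eq_Ico, sum_Ico_add' (fun t =>
    ‖PowerSeries.coeff t (genSeries a)‖ ^ 2) 0 T 1]
  have : Ico (0 + 1) (T + 1) = Icc 1 T := by ext; simp
  rw [this]
  simp only [genSeries, PowerSeries.coeff_mk, if_true, norm_zero]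
  rw [zero_pow two_ne_zero, add_zero]
  refine sum_congr rfl fun t ht => ?_
  rw [if_neg (by have := (mem_Icc.1 ht).1; omega)]
  simp

theorem sum_Icc_le_sum_range {g : ℕ → ℝ} (hg : ∀ t, 0 ≤ g t) (T : ℕ) :
    ∑ t ∈ Icc 1 T, g t ≤ ∑ t ∈ range (T + 1), g t :=
  sum_le_sum_of_subset_of_nonneg (fun t ht => mem_range.2 (by have := (mem_Icc.1 ht).2; omega))
    fun _ _ _ => hg _

theorem filt_coord {m : ℕ} (f : ℕ → ℝ) (v : ℕ → EuclideanSpace ℝ (Fin m)) (t : ℕ) (i : Fin m) :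
    filt f v t i = filt f (fun s => v s i) t := by
  simp [filt]

theorem norm_sq_filt_le {m : ℕ} (F : Polynomial ℂ) (v : ℕ → EuclideanSpace ℝ (Fin m)) (t : ℕ) :
    ‖filt (fun u => (F.coeff u).re) v t‖ ^ 2 ≤
      ∑ i, ‖PowerSeries.coeff t ((F : PowerSeries ℂ) * genSeries fun s => v s i)‖ ^ 2 := by
  rw [EuclideanSpace.norm_sq_eq]
  refine sum_le_sum fun i _ => ?_
  rw [filt_coord, ← re_coeff_mul_genSeries, Real.norm_eq_abs]
  exact pow_le_pow_left₀ (abs_nonneg _) (Complex.abs_re_le_norm _) 2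

theorem HasGain.sum_norm_sq_filt_le {F : Polynomial ℂ} {γ : ℝ} (hF : HasGain F γ) {m : ℕ}
    (v : ℕ → EuclideanSpace ℝ (Fin m)) (T : ℕ) :
    ∑ t ∈ Icc 1 T, ‖filt (fun u => (F.coeff u).re) v t‖ ^ 2 ≤
      γ ^ 2 * ∑ t ∈ Icc 1 T, ‖v t‖ ^ 2 := by
  calc _ ≤ ∑ t ∈ range (T + 1), ∑ i,
        ‖PowerSeries.coeff t ((F : PowerSeries ℂ) * genSeries fun s => v s i)‖ ^ 2 :=
        (sum_le_sum fun t _ => norm_sq_filt_le F v t).trans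
          (sum_Icc_le_sum_range (fun _ => by positivity) T)
    _ = ∑ i, truncNorm (T + 1) ((F : PowerSeries ℂ) * genSeries fun s => v s i) ^ 2 := by
        rw [sum_comm]; simp only [truncNorm.sq_eq]
    _ ≤ ∑ i, γ ^ 2 * ∑ t ∈ Icc 1 T, ‖v t i‖ ^ 2 := by
        refine sum_le_sum fun i _ => ?_
        rw [← sum_sq_coeff_genSeries, ← mul_pow]
        exact pow_le_pow_left₀ (truncNorm.nonneg _) (hF _ _) 2
    _ = _ := by
        rw [← mul_sum, sum_comm]
        simp only [EuclideanSpace.norm_sq_eq]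

section Modes

variable {n m d : ℕ} {S : LDS n m d} {Ψ : Matrix (Fin d) (Fin d) ℂ} {l : Fin d → ℂ}

theorem inv_mul_eq_diagonal_mul_inv (hΨ : IsUnit Ψ.det)
    (hA : S.A.map Complex.ofReal = Ψ * Matrix.diagonal l * Ψ⁻¹) :
    Ψ⁻¹ * S.A.map Complex.ofReal = Matrix.diagonal l * Ψ⁻¹ := by
  rw [hA, ← mul_assoc, ← mul_assoc, Matrix.nonsing_inv_mul _ hΨ, one_mul]

theorem map_pow_eq (hΨ : IsUnit Ψ.det)
    (hA : S.A.map Complex.ofReal = Ψ * Matrix.diagonal l * Ψ⁻¹) (k : ℕ) :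
    (S.A ^ k).map Complex.ofReal = Ψ * Matrix.diagonal (fun i => l i ^ k) * Ψ⁻¹ := by
  induction k with
  | zero =>
    have : Matrix.diagonal (fun i => l i ^ 0) = (1 : Matrix (Fin d) (Fin d) ℂ) := by simp
    rw [this, mul_one, Matrix.mul_nonsing_inv _ hΨ, pow_zero]
    exact Matrix.map_one _ Complex.ofReal_zero Complex.ofReal_one
  | succ k ih =>
    have h1 : (S.A ^ (k + 1)).map Complex.ofReal =
        (S.A ^ k).map Complex.ofReal * S.A.map Complex.ofReal := by
      rw [pow_succ]
      exact Matrix.map_mul (f := Complex.ofRealHom)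
    rw [h1, ih, mul_assoc, inv_mul_eq_diagonal_mul_inv hΨ hA, mul_assoc,
      ← mul_assoc (Matrix.diagonal _) (Matrix.diagonal _), Matrix.diagonal_mul_diagonal, ← mul_assoc]
    simp only [pow_succ]

/-- The filtered powers of the transition matrix are controlled by the filtered modes. -/
theorem frobNorm_filtered_pow_le (hΨ : IsUnit Ψ.det)
    (hA : S.A.map Complex.ofReal = Ψ * Matrix.diagonal l * Ψ⁻¹) (F : Polynomial ℂ) {s : ℕ} {ε : ℝ}
    (hε : 0 ≤ ε) (h : ∀ i, ‖PowerSeries.coeff s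
      ((F : PowerSeries ℂ) * PowerSeries.mk (fun t => l i ^ t))‖ ≤ ε) :
    frobNorm (∑ u ∈ range (s + 1), (F.coeff u).re • S.A ^ (s - u)) ≤
      ε * (frobNorm Ψ * frobNorm Ψ⁻¹) := by
  set μ : Fin d → ℂ := fun i => ∑ u ∈ range (s + 1), F.coeff u * l i ^ (s - u) with hμ
  have hμ' : ∀ i, ‖μ i‖ ≤ ε := by
    intro i
    have := h i
    rw [PowerSeries.coeff_mul, Nat.sum_antidiagonal_eq_sum_range_succ_mk] at this
    simpa using this
  have hZ : Ψ * (Matrix.diagonal μ * Ψ⁻¹) =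
      ∑ u ∈ range (s + 1), F.coeff u • (S.A ^ (s - u)).map Complex.ofReal := by
    have hd : Matrix.diagonal μ =
        ∑ u ∈ range (s + 1), F.coeff u • Matrix.diagonal (fun i => l i ^ (s - u)) := by
      ext i j
      rw [Matrix.sum_apply]
      by_cases hij : i = j
      · subst hij; simp [hμ]
      · simp [hij]
    rw [hd, sum_mul, mul_sum]
    refine sum_congr rfl fun u _ => ?_
    rw [map_pow_eq hΨ hA, Matrix.smul_mul, Matrix.mul_smul, mul_assoc]
  have hre : frobNorm (∑ u ∈ range (s + 1), (F.coeff u).re • S.A ^ (s - u)) ≤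
      frobNorm (Ψ * (Matrix.diagonal μ * Ψ⁻¹)) := by
    refine frobNorm_le_of_re fun i j => ?_
    rw [hZ, Matrix.sum_apply, Matrix.sum_apply, Complex.re_sum]
    exact sum_congr rfl fun u _ => by simp
  refine hre.trans ((frobNorm_mul_le _ _).trans ?_)
  calc _ ≤ frobNorm Ψ * (ε * frobNorm Ψ⁻¹) :=
        mul_le_mul_of_nonneg_left (frobNorm_diagonal_mul_le hμ' hε _) (frobNorm_nonneg _)
    _ = _ := by ring

/-- Filtering the noise response of the hidden state by an annihilator. -/
theorem sum_norm_sq_filt_state_le (hΨ : IsUnit Ψ.det)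
    (hA : S.A.map Complex.ofReal = Ψ * Matrix.diagonal l * Ψ⁻¹) {F : Polynomial ℂ} {γ : ℝ}
    (hF : ∀ i T g, truncNorm T ((F : PowerSeries ℂ) * g) ≤
      γ * truncNorm T ((1 - PowerSeries.C (l i) * PowerSeries.X) * g))
    (η : ℕ → EuclideanSpace ℝ (Fin d)) (T : ℕ) :
    ∑ t ∈ Icc 1 T, ‖filt (fun u => (F.coeff u).re) (S.state 0 η) t‖ ^ 2 ≤
      (frobNorm Ψ * frobNorm Ψ⁻¹) ^ 2 * γ ^ 2 * ∑ t ∈ Icc 1 T, ‖η t‖ ^ 2 := by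
  set h := S.state 0 η with hh
  set G : Fin d → PowerSeries ℂ := fun k =>
    ∑ i, PowerSeries.C (Ψ⁻¹ k i) * genSeries fun s => h s i with hG
  set U : Fin d → PowerSeries ℂ := fun k =>
    ∑ i, PowerSeries.C (Ψ⁻¹ k i) * genSeries fun s => η s i with hU
  have hh0 : ∀ i, h 0 i = 0 := fun i => by simp [hh, LDS.state]
  have hgen : ∀ i t, PowerSeries.coeff t (genSeries fun s => h s i) = (h t i : ℂ) := by
    intro i t
    simp only [genSeries, PowerSeries.coeff_mk]
    split_ifs with ht
    · rw [ht, hh0, Complex.ofReal_zero]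
    · rfl
  have hinvA : ∀ k j, ∑ i, Ψ⁻¹ k i * (S.A i j : ℂ) = l k * Ψ⁻¹ k j := by
    intro k j
    have := congrFun (congrFun (inv_mul_eq_diagonal_mul_inv hΨ hA) k) j
    rwa [Matrix.diagonal_mul, Matrix.mul_apply] at this
  -- In eigencoordinates the state recursion decouples into one scalar mode per eigenvalue, to which
  -- `hF` applies. Passing to these coordinates and back costs the Frobenius norms of `Ψ⁻¹` and `Ψ`.
  have hmode : ∀ k, (1 - PowerSeries.C (l k) * PowerSeries.X) * G k = U k := by
    intro k
    ext t
    rw [sub_mul, one_mul, mul_assoc, map_sub, PowerSeries.coeff_C_mul]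
    cases t with
    | zero =>
      rw [PowerSeries.coeff_zero_X_mul, mul_zero, sub_zero]
      simp only [hG, hU, map_sum, PowerSeries.coeff_C_mul]
      exact sum_congr rfl fun i _ => by simp [genSeries]
    | succ t =>
      rw [PowerSeries.coeff_succ_X_mul]
      simp only [hG, hU, map_sum, PowerSeries.coeff_C_mul, hgen]
      have hstep : ∀ i, (h (t + 1) i : ℂ) = ∑ j, (S.A i j : ℂ) * h t j + η (t + 1) i := by
        intro i
        rw [hh, LDS.state]
        simp [toEuclideanLin_coord]
      have h1 : ∑ i, Ψ⁻¹ k i * ∑ j, (S.A i j : ℂ) * h t j = l k * ∑ j, Ψ⁻¹ k j * h t j := by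
        simp_rw [mul_sum]
        rw [sum_comm]
        refine sum_congr rfl fun j _ => ?_
        rw [← mul_assoc (l k), ← hinvA, sum_mul]
        exact sum_congr rfl fun i _ => by ring
      simp_rw [hstep, mul_add]
      rw [sum_add_distrib, h1, add_sub_cancel_left]
      exact sum_congr rfl fun i _ => by simp [genSeries]
  have hrec : ∀ i, (genSeries fun s => h s i) = ∑ k, PowerSeries.C (Ψ i k) * G k := by
    intro i
    ext t
    simp only [hG, map_sum, PowerSeries.coeff_C_mul, hgen]
    simp_rw [mul_sum]
    rw [sum_comm]
    have h2 : ∀ j, ∑ k, Ψ i k * (Ψ⁻¹ k j * (h t j : ℂ)) = (1 : Matrix (Fin d) (Fin d) ℂ) i j * h t j := by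
      intro j
      rw [← Matrix.mul_nonsing_inv _ hΨ, Matrix.mul_apply, sum_mul]
      exact sum_congr rfl fun k _ => by ring
    simp_rw [h2]
    simp [Matrix.one_apply]
  calc _ ≤ ∑ t ∈ range (T + 1), ∑ i,
        ‖PowerSeries.coeff t ((F : PowerSeries ℂ) * genSeries fun s => h s i)‖ ^ 2 :=
        (sum_le_sum fun t _ => norm_sq_filt_le F h t).trans
          (sum_Icc_le_sum_range (fun _ => by positivity) T)
    _ ≤ ∑ t ∈ range (T + 1), frobNorm Ψ ^ 2 *
          ∑ k, ‖PowerSeries.coeff t ((F : PowerSeries ℂ) * G k)‖ ^ 2 := by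
        refine sum_le_sum fun t _ => ?_
        refine le_trans (le_of_eq ?_) (sum_norm_sq_mulVec_le Ψ _)
        refine sum_congr rfl fun i _ => ?_
        rw [hrec, mul_sum, map_sum]
        congr 2
        refine sum_congr rfl fun k _ => ?_
        rw [mul_left_comm, PowerSeries.coeff_C_mul]
    _ = frobNorm Ψ ^ 2 * ∑ k, truncNorm (T + 1) ((F : PowerSeries ℂ) * G k) ^ 2 := by
        rw [← mul_sum, sum_comm]; simp only [truncNorm.sq_eq]
    _ ≤ frobNorm Ψ ^ 2 * ∑ k, γ ^ 2 * truncNorm (T + 1) (U k) ^ 2 := by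
        refine mul_le_mul_of_nonneg_left (sum_le_sum fun k _ => ?_) (sq_nonneg _)
        rw [← mul_pow, ← hmode]
        exact pow_le_pow_left₀ (truncNorm.nonneg _) (hF k _ _) 2
    _ = frobNorm Ψ ^ 2 * γ ^ 2 * ∑ t ∈ range (T + 1), ∑ k, ‖PowerSeries.coeff t (U k)‖ ^ 2 := by
        rw [← mul_sum, sum_comm, mul_assoc]; simp only [truncNorm.sq_eq]
    _ ≤ frobNorm Ψ ^ 2 * γ ^ 2 * ∑ t ∈ range (T + 1), frobNorm Ψ⁻¹ ^ 2 *
          ∑ i, ‖PowerSeries.coeff t (genSeries fun s => η s i)‖ ^ 2 := by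
        refine mul_le_mul_of_nonneg_left (sum_le_sum fun t _ => ?_) (by positivity)
        refine le_trans (le_of_eq ?_) (sum_norm_sq_mulVec_le Ψ⁻¹ _)
        simp only [hU, map_sum, PowerSeries.coeff_C_mul]
    _ = (frobNorm Ψ * frobNorm Ψ⁻¹) ^ 2 * γ ^ 2 *
          ∑ i, truncNorm (T + 1) (genSeries fun s => η s i) ^ 2 := by
        rw [← mul_sum, sum_comm]; simp only [truncNorm.sq_eq]; ring
    _ = _ := by
        simp_rw [sum_sq_coeff_genSeries]
        rw [sum_comm]
        simp only [EuclideanSpace.norm_sq_eq]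

end Modes

end Systems

/-! ### The autoregressive predictor of a filter and its residual. -/

section Autoregression

open Finset

section Comparator

variable {n m d : ℕ}

/-- The impulse response of the system filtered by `f`. -/
def LDS.filteredMarkov (S : LDS n m d) (f : ℕ → ℝ) (s : ℕ) : Matrix (Fin m) (Fin n) ℝ :=
  S.C * (∑ u ∈ range (s + 1), f u • S.A ^ (s - u)) * S.B + f s • S.D

theorem toEuclideanLin_mul_apply {l : ℕ} (A : Matrix (Fin l) (Fin m) ℝ)
    (B : Matrix (Fin m) (Fin n) ℝ) (v : EuclideanSpace ℝ (Fin n)) :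
    (A * B).toEuclideanLin v = A.toEuclideanLin (B.toEuclideanLin v) := by
  rw [Matrix.toEuclideanLin, Matrix.toLpLin_mul_same]; rfl

theorem LDS.state_add (S : LDS n m d) (x : ℕ → EuclideanSpace ℝ (Fin n))
    (η : ℕ → EuclideanSpace ℝ (Fin d)) (t : ℕ) :
    S.state x η t = S.state x 0 t + S.state 0 η t := by
  induction t with
  | zero => simp [LDS.state]
  | succ t ih =>
    simp only [LDS.state, ih, map_add, Pi.zero_apply, map_zero, add_zero]
    abel

theorem LDS.state_eq_sum (S : LDS n m d) (x : ℕ → EuclideanSpace ℝ (Fin n)) (t : ℕ) :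
    S.state x 0 t = ∑ i ∈ range t, (S.A ^ i * S.B).toEuclideanLin (x (t - i)) := by
  induction t with
  | zero => simp [LDS.state]
  | succ t ih =>
    rw [LDS.state, ih, sum_range_succ', map_sum]
    simp only [Pi.zero_apply, add_zero, pow_zero, Matrix.one_mul, Nat.sub_zero]
    congr 1
    refine sum_congr rfl fun i _ => ?_
    rw [pow_succ', Matrix.mul_assoc, Nat.add_sub_add_right, ← toEuclideanLin_mul_apply]

theorem filt_add {E : Type*} [AddCommGroup E] [Module ℝ E] (f : ℕ → ℝ) (v w : ℕ → E) (t : ℕ) :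
    filt f (fun s => v s + w s) t = filt f v t + filt f w t := by
  simp [filt, sum_add_distrib]

theorem map_filt {E E' : Type*} [AddCommGroup E] [Module ℝ E] [AddCommGroup E'] [Module ℝ E']
    (L : E →ₗ[ℝ] E') (f : ℕ → ℝ) (v : ℕ → E) (t : ℕ) :
    filt f (fun s => L (v s)) t = L (filt f v t) := by
  simp [filt]

/-- Associativity of convolution: the double sum over filter lag and impulse lag is regrouped by
total lag `s`. -/
theorem LDS.filt_noiseless_output (S : LDS n m d) (x : ℕ → EuclideanSpace ℝ (Fin n)) (f : ℕ → ℝ)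
    (t : ℕ) :
    filt f (fun s => S.C.toEuclideanLin (S.state x 0 s) + S.D.toEuclideanLin (x s)) t =
      ∑ s ∈ range t, (S.filteredMarkov f s).toEuclideanLin (x (t - s)) := by
  have h1 : filt f (S.state x 0) t =
      ∑ s ∈ range t, ((∑ u ∈ range (s + 1), f u • S.A ^ (s - u)) * S.B).toEuclideanLin
        (x (t - s)) := by
    have h2 := sum_range_diag_flip t
      fun u i => f u • (S.A ^ i * S.B).toEuclideanLin (x (t - (u + i)))
    rw [filt]
    refine Eq.trans ?_ (h2.symm.trans ?_)
    · refine sum_congr rfl fun u _ => ?_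
      rw [S.state_eq_sum, smul_sum]
      simp only [Nat.sub_sub]
    · refine sum_congr rfl fun s _ => ?_
      rw [Matrix.sum_mul, map_sum, LinearMap.sum_apply]
      refine sum_congr rfl fun u hu => ?_
      have : u + (s - u) = s := by have := mem_range.1 hu; omega
      rw [this, Matrix.smul_mul, map_smul, LinearMap.smul_apply]
  rw [filt_add, map_filt S.C.toEuclideanLin, h1, map_sum, filt, ← sum_add_distrib]
  refine sum_congr rfl fun s _ => ?_
  rw [filteredMarkov, map_add, LinearMap.add_apply, map_smul, LinearMap.smul_apply,
    Matrix.mul_assoc, toEuclideanLin_mul_apply S.C]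

/-- `C` enters only through its spectral norm; passing to Frobenius norms for `B` and `D` costs the
factor `√n`. -/
theorem LDS.frobNorm_filteredMarkov_le (S : LDS n m d) {RΘ ε δ : ℝ} {f : ℕ → ℝ} {s : ℕ}
    (hB : specNorm S.B ≤ RΘ) (hC : specNorm S.C ≤ RΘ) (hD : specNorm S.D ≤ RΘ)
    (hε : frobNorm (∑ u ∈ range (s + 1), f u • S.A ^ (s - u)) ≤ ε) (hδ : |f s| ≤ δ) :
    frobNorm (S.filteredMarkov f s) ≤ √n * (RΘ ^ 2 * ε + δ * RΘ) := by
  have hR : 0 ≤ RΘ := (specNorm_nonneg _).trans hB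
  have hε0 : 0 ≤ ε := (frobNorm_nonneg _).trans hε
  have hδ0 : 0 ≤ δ := (abs_nonneg _).trans hδ
  have h1 : frobNorm (S.C * (∑ u ∈ range (s + 1), f u • S.A ^ (s - u)) * S.B) ≤
      RΘ * ε * (√n * RΘ) := by
    refine (frobNorm_mul_le _ _).trans (mul_le_mul ((frobNorm_mul_le_specNorm_mul _ _).trans
      (mul_le_mul hC hε (frobNorm_nonneg _) hR)) ((frobNorm_le_sqrt_mul_specNorm _).trans
      (mul_le_mul_of_nonneg_left hB (Real.sqrt_nonneg _))) (frobNorm_nonneg _) (by positivity))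
  have h2 : frobNorm (f s • S.D) ≤ δ * (√n * RΘ) := by
    rw [frobNorm_smul]
    exact mul_le_mul hδ ((frobNorm_le_sqrt_mul_specNorm _).trans
      (mul_le_mul_of_nonneg_left hD (Real.sqrt_nonneg _))) (frobNorm_nonneg _) hδ0
  calc _ ≤ _ := frobNorm_add_le _ _
    _ ≤ RΘ * ε * (√n * RΘ) + δ * (√n * RΘ) := add_le_add h1 h2
    _ = _ := by ring

/-- The autoregressive predictor attached to the filter `f`. -/
def LDS.autoregressive (S : LDS n m d) (f : ℕ → ℝ) (N k W : ℕ) : PseudoLDS n m N k W where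
  M := 0
  N := 0
  -- The sign comes from moving the past outputs of `f * y` to the other side; `β u` acts at lag `u
  -- + 1`.
  β := fun u => -f (u + 1)
  P := fun j => S.filteredMarkov f j

theorem filt_eq_sum_lag (f : ℕ → ℝ) (v : ℕ → EuclideanSpace ℝ (Fin m)) {K : ℕ}
    (hf : ∀ u, K ≤ u → f u = 0) (t : ℕ) :
    filt f v t = ∑ u ∈ range K, f u • lag v t u := by
  have h1 : filt f v t = ∑ u ∈ range t, f u • lag v t u :=
    sum_congr rfl fun u hu => by rw [lag, if_pos (mem_range.1 hu)]
  rw [h1]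
  have h2 : ∑ u ∈ range t, f u • lag v t u = ∑ u ∈ range (max t K), f u • lag v t u :=
    sum_subset (range_subset_range.2 (le_max_left _ _)) fun u _ hu => by
      rw [lag, if_neg (by simpa using hu), smul_zero]
  have h3 : ∑ u ∈ range K, f u • lag v t u = ∑ u ∈ range (max t K), f u • lag v t u :=
    sum_subset (range_subset_range.2 (le_max_right _ _)) fun u _ hu => by
      rw [hf u (by simpa using hu), zero_smul]
  rw [h2, h3]

theorem LDS.sum_filteredMarkov_lag (S : LDS n m d) (f : ℕ → ℝ)
    (x : ℕ → EuclideanSpace ℝ (Fin n)) (N t : ℕ) :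
    ∑ s ∈ range t, (S.filteredMarkov f s).toEuclideanLin (x (t - s)) =
      ∑ j ∈ range N, (S.filteredMarkov f j).toEuclideanLin (lag x t j) +
      ∑ s ∈ range t with N ≤ s, (S.filteredMarkov f s).toEuclideanLin (x (t - s)) := by
  rw [← sum_filter_add_sum_filter_not (range t) (fun s => N ≤ s), add_comm]
  congr 1
  have h1 : ∑ s ∈ range t with ¬ N ≤ s, (S.filteredMarkov f s).toEuclideanLin (x (t - s)) =
      ∑ s ∈ range t with ¬ N ≤ s, (S.filteredMarkov f s).toEuclideanLin (lag x t s) :=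
    sum_congr rfl fun u hu => by
      rw [lag, if_pos (mem_range.1 (mem_filter.1 hu).1)]
  rw [h1]
  refine sum_subset (fun s hs => ?_) fun s hs hs' => ?_
  · have := (mem_filter.1 hs).2
    exact mem_range.2 (by omega)
  · have h2 : ¬ s < t := fun h => hs' (mem_filter.2 ⟨mem_range.2 h, by
      have := mem_range.1 hs; omega⟩)
    rw [lag, if_neg h2, map_zero]

/-- Both sides compute `f * y`. The matrices `P` reproduce the filtered impulse response at lags
below `N` exactly, so what is left is its tail and the filtered noise. -/
theorem LDS.autoregressive_residual (S : LDS n m d) {f : ℕ → ℝ} {N k W T : ℕ} (hf0 : f 0 = 1)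
    (hf : ∀ u, N ≤ u → f u = 0) (σ : Fin k → ℝ) (φ : Fin k → EuclideanSpace ℝ (Fin T))
    (x : ℕ → EuclideanSpace ℝ (Fin n)) (η : ℕ → EuclideanSpace ℝ (Fin d))
    (ξ : ℕ → EuclideanSpace ℝ (Fin m)) {t : ℕ} (ht : 1 ≤ t) :
    S.output x η ξ t - (S.autoregressive f N k W).predict σ φ x (S.output x η ξ) t =
      ∑ s ∈ range t with N ≤ s, (S.filteredMarkov f s).toEuclideanLin (x (t - s)) +
        (S.C.toEuclideanLin (filt f (S.state 0 η) t) + filt f ξ t) := by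
  set y := S.output x η ξ with hy
  have hsplit : filt f y t =
      filt f (fun s => S.C.toEuclideanLin (S.state x 0 s) + S.D.toEuclideanLin (x s)) t +
        (S.C.toEuclideanLin (filt f (S.state 0 η) t) + filt f ξ t) := by
    rw [← map_filt S.C.toEuclideanLin, ← filt_add, ← filt_add]
    congr 1
    ext1 s
    rw [hy, LDS.output, S.state_add, map_add]
    abel
  have hlag : filt f y t = y t + ∑ u : Fin N, f (u + 1) • lag y t ((u : ℕ) + 1) := by
    -- Taking `N + 1` terms, the last of which vanishes, leaves exactly the `N` lags of `β` once `u
    -- = 0` is split off.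
    rw [filt_eq_sum_lag f y (K := N + 1) (fun u hu => hf u (by omega)), sum_range_succ', hf0,
      one_smul, lag, if_pos (by omega), Nat.sub_zero, add_comm, Finset.sum_range]
  have hpred : (S.autoregressive f N k W).predict σ φ x y t =
      -∑ u : Fin N, f (u + 1) • lag y t ((u : ℕ) + 1) +
        ∑ j ∈ range N, (S.filteredMarkov f j).toEuclideanLin (lag x t j) := by
    rw [PseudoLDS.predict, Finset.sum_range]
    simp [autoregressive]
  rw [S.filt_noiseless_output, S.sum_filteredMarkov_lag f x N] at hsplit
  rw [hpred]
  have := hlag.symm.trans hsplit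
  rw [eq_sub_of_add_eq this]
  abel

theorem sum_rpow_rpow_le {τ : ℕ} {q : ℝ} (hq : 1 < q) (b : Fin τ → ℝ) :
    (∑ u, ‖b u‖ ^ q) ^ (2 / q) ≤ (∑ u, |b u|) ^ 2 := by
  set s := ∑ u, |b u| with hs
  have hs0 : 0 ≤ s := sum_nonneg fun _ _ => abs_nonneg _
  have hq0 : 0 < q := by linarith
  have h1 : ∑ u, ‖b u‖ ^ q ≤ s ^ q := by
    have h2 : ∀ z : ℝ, 0 ≤ z → z ^ q = z * z ^ (q - 1) := fun z hz => by
      rw [← Real.rpow_one_add' hz (by linarith)]; congr 1; ring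
    rw [h2 s hs0, hs, sum_mul]
    refine sum_le_sum fun u _ => ?_
    rw [Real.norm_eq_abs, h2 _ (abs_nonneg _)]
    refine mul_le_mul_of_nonneg_left (Real.rpow_le_rpow (abs_nonneg _) ?_ (by linarith))
      (abs_nonneg _)
    exact single_le_sum (f := fun u => |b u|) (fun _ _ => abs_nonneg _) (mem_univ u)
  calc _ ≤ (s ^ q) ^ (2 / q) :=
        Real.rpow_le_rpow (sum_nonneg fun _ _ => by positivity) h1 (by positivity)
    _ = s ^ 2 := by
        rw [← Real.rpow_mul hs0]
        have : q * (2 / q) = (2 : ℕ) := by push_cast; field_simp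
        rw [this, Real.rpow_natCast]

theorem LDS.autoregressive_norms_le (S : LDS n m d) {f : ℕ → ℝ} {N k W : ℕ} {b p : ℝ}
    (hW : 8 ≤ W) (hN : 8 ≤ N) (hb : 0 ≤ b) (hp : 0 ≤ p)
    (hf : ∀ u, |f u| ≤ b) (hP : ∀ s, s < N → frobNorm (S.filteredMarkov f s) ≤ p) :
    (S.autoregressive f N k W).compNorm ≤ N * b + √N * p ∧
      (S.autoregressive f N k W).regularizer ≤ (N * b + √N * p) ^ 2 := by
  have h1 : ∑ u, |(S.autoregressive f N k W).β u| ≤ N * b := by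
    calc _ ≤ ∑ u : Fin N, b := sum_le_sum fun u _ => by
          simp only [autoregressive, abs_neg]; exact hf _
      _ = _ := by simp
  have h2 : ‖stack (S.autoregressive f N k W).P‖ ≤ √N * p := by
    rw [norm_stack]
    refine Real.sqrt_le_iff.2 ⟨by positivity, ?_⟩
    calc _ ≤ ∑ j : Fin N, p ^ 2 := sum_le_sum fun j _ =>
          pow_le_pow_left₀ (frobNorm_nonneg _) (hP j j.2) 2
      _ = _ := by rw [mul_pow, Real.sq_sqrt (by positivity)]; simp
  have h0 : stack (0 : Fin k → Matrix (Fin m) (Fin n) ℝ) = 0 := rfl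
  have hM : ∀ p, stack ((S.autoregressive f N k W).M p) = 0 := fun p => h0
  have hN' : ∀ p, stack ((S.autoregressive f N k W).N p) = 0 := fun p => h0
  have hβ0 : 0 ≤ ∑ u, |(S.autoregressive f N k W).β u| := sum_nonneg fun _ _ => abs_nonneg _
  constructor
  · rw [PseudoLDS.compNorm_eq]
    simp only [hM, hN', norm_zero, sum_const_zero]
    linarith
  · rw [PseudoLDS.regularizer_eq]
    obtain ⟨hq, -⟩ := regExponent_bounds hW
    obtain ⟨hr, -⟩ := regExponent_bounds hN
    have hz : (2 / regExponent W) ≠ 0 := by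
      have : 0 < regExponent W := by linarith
      positivity
    simp only [hM, hN', norm_zero, Real.zero_rpow (by linarith : regExponent W ≠ 0),
      sum_const_zero, Real.zero_rpow hz]
    have h3 := sum_rpow_rpow_le hr (S.autoregressive f N k W).β
    have h4 := pow_le_pow_left₀ hβ0 h1 2
    have h5 := pow_le_pow_left₀ (norm_nonneg _) h2 2
    have h6 : 0 ≤ N * b * (√N * p) := by positivity
    nlinarith

end Comparator

end Autoregression

/-! ### Every admissible system has a good autoregressive competitor. -/

section Competitor

open Finset

/-- The first two bounds come from the leading coefficient `1`, the others from `√d = ‖Ψ Ψ⁻¹‖_F ≤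
RΨ`. The bound `d ≤ RΨ²` provides the spare factor `d` on short horizons. -/
theorem LDS.SatisfiesAssumptions.bounds {n m d τ : ℕ} {S : LDS n m d} {RΘ RΨ R₁ Rinf : ℝ}
    (hS : S.SatisfiesAssumptions τ RΘ RΨ R₁ Rinf) (hd : 1 ≤ d) :
    1 ≤ R₁ ∧ 1 ≤ Rinf ∧ 1 ≤ RΨ ∧ (d : ℝ) ≤ RΨ ^ 2 := by
  obtain ⟨-, -, -, Ψ, r, ω, p, hΨ, -, hΨR, -, hp, hpτ, -, h1, hinf⟩ := hS
  have hlead : |p.coeff τ| = 1 := by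
    rw [← hpτ, Polynomial.coeff_natDegree, hp.leadingCoeff, abs_one]
  have hsd : √(d : ℝ) ≤ RΨ := by
    rw [← frobNorm_one (𝕜 := ℂ), ← Matrix.mul_nonsing_inv Ψ hΨ]
    exact (frobNorm_mul_le _ _).trans hΨR
  have hd' : (1 : ℝ) ≤ d := by exact_mod_cast hd
  refine ⟨?_, ?_, (Real.one_le_sqrt.2 hd').trans hsd, ?_⟩
  · rw [← hlead]
    refine le_trans ?_ h1
    exact single_le_sum (f := fun j => |p.coeff j|) (fun _ _ => abs_nonneg _)
      (mem_range.2 (Nat.lt_succ_self τ))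
  · rw [← hlead]; exact hinf τ
  · calc (d : ℝ) = √d ^ 2 := (Real.sq_sqrt (by positivity)).symm
      _ ≤ RΨ ^ 2 := pow_le_pow_left₀ (Real.sqrt_nonneg _) hsd 2

theorem norm_sq_add_le {E : Type*} [NormedAddCommGroup E] (a b : E) :
    ‖a + b‖ ^ 2 ≤ 2 * ‖a‖ ^ 2 + 2 * ‖b‖ ^ 2 := by
  have := pow_le_pow_left₀ (norm_nonneg _) (norm_add_le a b) 2
  nlinarith [sq_nonneg (‖a‖ - ‖b‖)]

theorem competitor_radius_le {n N : ℕ} {RΘ RΨ : ℝ} (hRΘ : 1 ≤ RΘ) (hRΨ : 1 ≤ RΨ)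
    (hsn : 1 ≤ √(n : ℝ)) (hsN : 1 ≤ √(N : ℝ)) :
    N * Real.exp 4 + √N * (√n * (RΘ ^ 2 * (Real.exp 4 * √N * RΨ) + Real.exp 4 * RΘ)) ≤
      3 * Real.exp 4 * N * √n * RΘ ^ 2 * RΨ := by
  have hexp := Real.exp_pos 4
  have hNN : √(N : ℝ) * √N = N := Real.mul_self_sqrt (Nat.cast_nonneg _)
  have h1 : (N : ℝ) * Real.exp 4 ≤ Real.exp 4 * N * √n * RΘ ^ 2 * RΨ := by
    calc (N : ℝ) * Real.exp 4 = Real.exp 4 * N * 1 * 1 ^ 2 * 1 := by ring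
      _ ≤ _ := by gcongr
  have h2 : √N * √n * Real.exp 4 * RΘ ≤ Real.exp 4 * N * √n * RΘ ^ 2 * RΨ := by
    calc √N * √n * Real.exp 4 * RΘ = Real.exp 4 * (√N * 1) * √n * (RΘ * 1) * 1 := by ring
      _ ≤ Real.exp 4 * (√N * √N) * √n * (RΘ * RΘ) * RΨ := by gcongr
      _ = _ := by rw [hNN]; ring
  have h3 : √N * (√n * (RΘ ^ 2 * (Real.exp 4 * √N * RΨ))) =
      Real.exp 4 * N * √n * RΘ ^ 2 * RΨ := by
    linear_combination Real.exp 4 * √n * RΘ ^ 2 * RΨ * hNN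
  linarith

/-- Summing over lags, squaring and summing over rounds costs `T³`, which `4^{-J} ≤ T^{-4}`
outweighs. -/
theorem tail_energy_le {n N J T : ℕ} (hT : 1 ≤ T) (hTJ : T ^ 2 ≤ 2 ^ J) (RΘ RΨ Rx : ℝ) :
    T * (2 * (T * (√n * (RΘ ^ 2 * (Real.exp 4 * √N * (1 / 2) ^ J * RΨ)) * Rx)) ^ 2) ≤
      2 * Real.exp 8 * n * N * RΘ ^ 4 * RΨ ^ 2 * Rx ^ 2 := by
  have hT' : (1 : ℝ) ≤ T := by exact_mod_cast hT
  have he8 : Real.exp 4 ^ 2 = Real.exp 8 := by rw [← Real.exp_nat_mul]; norm_num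
  have hhalf : (T : ℝ) ^ 4 * ((1 / 2) ^ J) ^ 2 ≤ 1 := by
    have h1 : (T : ℝ) ^ 2 ≤ 2 ^ J := by exact_mod_cast hTJ
    have h2 : (T : ℝ) ^ 2 * (1 / 2) ^ J ≤ 1 := by
      rw [one_div_pow, mul_one_div, div_le_one (by positivity)]; exact h1
    calc (T : ℝ) ^ 4 * ((1 / 2) ^ J) ^ 2 = ((T : ℝ) ^ 2 * (1 / 2) ^ J) ^ 2 := by ring
      _ ≤ 1 := pow_le_one₀ (by positivity) h2
  have h3 : (T : ℝ) ^ 3 * ((1 / 2) ^ J) ^ 2 ≤ 1 := by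
    refine le_trans (mul_le_mul_of_nonneg_right ?_ (by positivity)) hhalf
    exact pow_le_pow_right₀ hT' (by norm_num)
  calc _ = 2 * Real.exp 4 ^ 2 * √n ^ 2 * √N ^ 2 * RΘ ^ 4 * RΨ ^ 2 * Rx ^ 2 *
          ((T : ℝ) ^ 3 * ((1 / 2) ^ J) ^ 2) := by ring
    _ ≤ 2 * Real.exp 4 ^ 2 * √n ^ 2 * √N ^ 2 * RΘ ^ 4 * RΨ ^ 2 * Rx ^ 2 * 1 :=
        mul_le_mul_of_nonneg_left h3 (by positivity)
    _ = _ := by rw [he8, Real.sq_sqrt (Nat.cast_nonneg _), Real.sq_sqrt (Nat.cast_nonneg _)]; ring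

set_option maxHeartbeats 800000 in
/-- A system satisfying the assumptions is approximated by a pseudo-LDS of polynomial norm whose
total loss is bounded by the energy of the noise, up to a small error. -/
theorem LDS.SatisfiesAssumptions.exists_competitor {n m d τ : ℕ} {S : LDS n m d}
    {RΘ RΨ R₁ Rinf : ℝ} (hS : S.SatisfiesAssumptions τ RΘ RΨ R₁ Rinf) (hn : 1 ≤ n) (hd : 1 ≤ d)
    (hRΘ : 1 ≤ RΘ) {J c N T : ℕ} (k : ℕ) {W : ℕ} (hJ : 1 ≤ J) (hc : 1 ≤ c) (hdc : d * J ≤ 2 ^ c)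
    (hN : d * (d * c + J * (d * J * c)) + 2 * (d * J) * J + 1 ≤ N) (hN8 : 8 ≤ N) (hW : 8 ≤ W)
    (hT : 1 ≤ T) (hTJ : T ^ 2 ≤ 2 ^ J) :
    ∃ ϑ : PseudoLDS n m N k W, ϑ.compNorm ≤ 3 * Real.exp 4 * N * √n * RΘ ^ 2 * RΨ ∧
      ϑ.regularizer ≤ (3 * Real.exp 4 * N * √n * RΘ ^ 2 * RΨ) ^ 2 ∧
      ∀ (x : ℕ → EuclideanSpace ℝ (Fin n)) (η : ℕ → EuclideanSpace ℝ (Fin d))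
        (ξ : ℕ → EuclideanSpace ℝ (Fin m)) (L Rx : ℝ), 0 ≤ Rx →
        (∀ t ∈ Icc 1 T, ‖x t‖ ≤ Rx) → ∑ t ∈ Icc 1 T, (‖η t‖ ^ 2 + ‖ξ t‖ ^ 2) ≤ L →
        ∀ (σ : Fin k → ℝ) (φ : Fin k → EuclideanSpace ℝ (Fin T)),
        ∑ t ∈ Icc 1 T, ‖ϑ.predict σ φ x (S.output x η ξ) t - S.output x η ξ t‖ ^ 2 ≤
          2 * Real.exp 8 * n * N * RΘ ^ 4 * RΨ ^ 2 * Rx ^ 2 +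
            16 * Real.exp 8 * (Rinf ^ 2 * τ ^ 3 * RΘ ^ 2 * RΨ ^ 2 * L) := by
  obtain ⟨-, hRinf, hRΨ, -⟩ := hS.bounds hd
  obtain ⟨hB, hC, hD, Ψ, r, ω, p, hΨ, hA, hΨR, hrω, hp, hpτ, hpω, -, -⟩ := hS
  set l : Fin d → ℂ := fun i => (r i : ℂ) * ω i with hl
  set Z : Finset ℂ := univ.image ω with hZ
  have hZmem : ∀ i, ω i ∈ Z := fun i => mem_image_of_mem _ (mem_univ i)
  have hZ1 : ∀ z ∈ Z, ‖z‖ = 1 := by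
    intro z hz
    obtain ⟨i, -, rfl⟩ := mem_image.1 hz
    exact (hrω i).2.2
  have hZcard : 1 ≤ #Z := card_pos.2 ⟨ω ⟨0, hd⟩, hZmem _⟩
  have hZd : #Z ≤ d := card_image_le.trans (by simp)
  -- The distinct phases are roots of a nonzero polynomial of degree `τ`. This bound controls the
  -- noise term, while `#Z ≤ d` controls the length of the filter.
  have hZτ : #Z ≤ τ := by
    have hp0 : p.map (algebraMap ℝ ℂ) ≠ 0 := (hp.map _).ne_zero
    have h1 : #Z ≤ (p.map (algebraMap ℝ ℂ)).natDegree := by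
      refine Polynomial.card_le_degree_of_subset_roots fun z hz => ?_
      obtain ⟨i, -, rfl⟩ := mem_image.1 (show z ∈ Z from hz)
      rw [Polynomial.mem_roots hp0, Polynomial.IsRoot, Polynomial.eval_map_algebraMap]
      exact hpω i
    rwa [Polynomial.natDegree_map, hpτ] at h1
  have hM : #Z * J ≤ d * J := Nat.mul_le_mul_right _ hZd
  have hM1 : 1 ≤ d * J := Nat.mul_pos hd hJ
  have hZc : #Z ≤ 2 ^ c := hZd.trans ((Nat.le_mul_of_pos_right d hJ).trans hdc)
  have hN' : #Z * (#Z * c + J * (d * J * c)) + 2 * (d * J) * J + 1 ≤ N := by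
    refine le_trans ?_ hN
    gcongr
  set F := annihilator Z (d * J) J c with hF
  have hgain : HasGain F (Real.exp 4) := hasGain_annihilator hZ1 hZcard hM hM1 hdc hZc
  have hdeg : F.natDegree < N := by
    have : F.natDegree ≤ _ := natDegree_annihilator_le
    omega
  set f : ℕ → ℝ := fun u => (F.coeff u).re with hf
  have hf0 : f 0 = 1 := by
    rw [hf]; simp only [hF]; rw [annihilator_coeff_zero hZcard hM1 hc, Complex.one_re]
  have hfN : ∀ u, N ≤ u → f u = 0 := fun u hu => by
    simp only [hf, Polynomial.coeff_eq_zero_of_natDegree_lt (hdeg.trans_le hu), Complex.zero_re]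
  have hexp : 0 < Real.exp 4 := Real.exp_pos 4
  -- The coefficients are the response to a unit impulse, so the gain bounds them.
  have hfle : ∀ u, |f u| ≤ Real.exp 4 := by
    intro u
    have h1 := hgain (u + 1) 1
    have h2 := truncNorm.norm_coeff_le (Nat.lt_succ_self u) ((F : PowerSeries ℂ) * 1)
    rw [mul_one] at h1 h2
    have h3 := truncNorm.one_le_one (T := u + 1)
    rw [Polynomial.coeff_coe] at h2
    exact (Complex.abs_re_le_norm _).trans (h2.trans (h1.trans (mul_le_of_le_one_right hexp.le h3)))
  have hnormΨ : 0 ≤ frobNorm Ψ * frobNorm Ψ⁻¹ := mul_nonneg (frobNorm_nonneg _) (frobNorm_nonneg _)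
  have hln : ∀ i, ‖l i‖ ≤ 1 := by
    intro i
    obtain ⟨h0, h1, h2⟩ := hrω i
    rw [hl]; simp only [norm_mul, h2, Complex.norm_of_nonneg h0, mul_one]; exact h1
  have hmode : ∀ s, s < N → ∀ i, ‖PowerSeries.coeff s
      ((F : PowerSeries ℂ) * PowerSeries.mk (fun t => l i ^ t))‖ ≤ Real.exp 4 * √N := by
    intro s hs i
    refine (truncNorm.norm_coeff_le hs _).trans ((hgain N _).trans ?_)
    exact mul_le_mul_of_nonneg_left (truncNorm_mk_pow_le N (hln i)) hexp.le
  have htail : ∀ s, N ≤ s → ∀ i, ‖PowerSeries.coeff s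
      ((F : PowerSeries ℂ) * PowerSeries.mk (fun t => l i ^ t))‖ ≤
        Real.exp 4 * √N * (1 / 2) ^ J := fun s hs i =>
    norm_coeff_annihilator_mul_mode_le hZ1 hZcard hM hM1 hdc hZc hc hN' hs (hZmem i) (hrω i).1
      (hrω i).2.1
  have hP : ∀ s, s < N → frobNorm (S.filteredMarkov f s) ≤
      √n * (RΘ ^ 2 * (Real.exp 4 * √N * RΨ) + Real.exp 4 * RΘ) := fun s hs =>
    S.frobNorm_filteredMarkov_le hB hC hD ((frobNorm_filtered_pow_le hΨ hA F (by positivity)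
      (hmode s hs)).trans (mul_le_mul_of_nonneg_left hΨR (by positivity))) (hfle s)
  have hPtail : ∀ s, N ≤ s → frobNorm (S.filteredMarkov f s) ≤
      √n * (RΘ ^ 2 * (Real.exp 4 * √N * (1 / 2) ^ J * RΨ)) := fun s hs => by
    -- From lag `N` on the filter vanishes, so the feedthrough `D` no longer contributes.
    have := S.frobNorm_filteredMarkov_le (f := f) (s := s) (δ := 0) hB hC hD
      ((frobNorm_filtered_pow_le hΨ hA F (by positivity)
      (htail s hs)).trans (mul_le_mul_of_nonneg_left hΨR (by positivity))) (by simp [hfN s hs])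
    simpa using this
  have hsn : 1 ≤ √(n : ℝ) := Real.one_le_sqrt.2 (by exact_mod_cast hn)
  have hsN : 1 ≤ √(N : ℝ) := Real.one_le_sqrt.2 (by exact_mod_cast (by omega : 1 ≤ N))
  have hN0 : (0 : ℝ) ≤ N := Nat.cast_nonneg _
  have hrad := competitor_radius_le hRΘ hRΨ hsn hsN
  obtain ⟨hcomp, hreg⟩ := S.autoregressive_norms_le (k := k) (W := W) hW hN8 hexp.le
    (by positivity) hfle hP
  refine ⟨S.autoregressive f N k W, hcomp.trans hrad,
    hreg.trans (pow_le_pow_left₀ (by positivity) hrad 2), ?_⟩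
  intro x η ξ L Rx hRx hx hL σ φ
  have hL1 : ∑ t ∈ Icc 1 T, ‖η t‖ ^ 2 + ∑ t ∈ Icc 1 T, ‖ξ t‖ ^ 2 ≤ L := by
    rwa [← sum_add_distrib]
  have hη0 : 0 ≤ ∑ t ∈ Icc 1 T, ‖η t‖ ^ 2 := by positivity
  have hξ0 : 0 ≤ ∑ t ∈ Icc 1 T, ‖ξ t‖ ^ 2 := by positivity
  set B := √n * (RΘ ^ 2 * (Real.exp 4 * √N * (1 / 2) ^ J * RΨ)) with hBdef
  have hB0 : 0 ≤ B := by positivity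
  have hT' : (1 : ℝ) ≤ T := by exact_mod_cast hT
  have htailsum : ∀ t ∈ Icc 1 T, ‖∑ s ∈ range t with N ≤ s,
      (S.filteredMarkov f s).toEuclideanLin (x (t - s))‖ ≤ T * (B * Rx) := by
    intro t ht
    obtain ⟨ht1, htT⟩ := mem_Icc.1 ht
    have h1 : ∀ s ∈ (range t).filter (N ≤ ·),
        ‖(S.filteredMarkov f s).toEuclideanLin (x (t - s))‖ ≤ B * Rx := by
      intro s hs
      obtain ⟨hs1, hs2⟩ := mem_filter.1 hs
      have := mem_range.1 hs1
      exact (norm_toEuclideanLin_le _ _).trans (mul_le_mul (hPtail s hs2)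
        (hx _ (mem_Icc.2 ⟨by omega, by omega⟩)) (norm_nonneg _) hB0)
    refine (norm_sum_le_of_le _ h1).trans ?_
    rw [sum_const, nsmul_eq_mul]
    refine mul_le_mul_of_nonneg_right ?_ (by positivity)
    have : #((range t).filter (N ≤ ·)) ≤ T := (card_filter_le _ _).trans (by simpa using htT)
    exact_mod_cast this
  have hres : ∀ t ∈ Icc 1 T,
      ‖(S.autoregressive f N k W).predict σ φ x (S.output x η ξ) t - S.output x η ξ t‖ ^ 2 ≤
      2 * (T * (B * Rx)) ^ 2 + (4 * RΘ ^ 2 * ‖filt f (S.state 0 η) t‖ ^ 2 + 4 * ‖filt f ξ t‖ ^ 2) := by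
    intro t ht
    rw [norm_sub_rev, S.autoregressive_residual hf0 hfN σ φ x η ξ (mem_Icc.1 ht).1]
    have h1 := pow_le_pow_left₀ (norm_nonneg _) (htailsum t ht) 2
    have h2 := pow_le_pow_left₀ (norm_nonneg _) ((norm_toEuclideanLin_le_specNorm S.C
      (filt f (S.state 0 η) t)).trans (mul_le_mul_of_nonneg_right hC (norm_nonneg _))) 2
    rw [mul_pow] at h2
    refine (norm_sq_add_le _ _).trans ?_
    have h3 := norm_sq_add_le (S.C.toEuclideanLin (filt f (S.state 0 η) t)) (filt f ξ t)
    linarith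
  have hstate := sum_norm_sq_filt_state_le hΨ hA (F := F) (γ := 2 * #Z * Real.exp 4)
    (fun i T g => truncNorm_annihilator_mul_mode_le hZ1 hZcard hM hM1 hdc hZc (hZmem i) (hrω i).1
      (hrω i).2.1 T g) η T
  have hobs := hgain.sum_norm_sq_filt_le ξ T
  have he8 : Real.exp 4 ^ 2 = Real.exp 8 := by rw [← Real.exp_nat_mul]; norm_num
  have he8' : 0 < Real.exp 8 := Real.exp_pos 8
  have hZτ' : (#Z : ℝ) ≤ τ := by exact_mod_cast hZτ
  have hZ1' : (1 : ℝ) ≤ #Z := by exact_mod_cast hZcard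
  have hτ1 : (1 : ℝ) ≤ τ := hZ1'.trans hZτ'
  have hstate' : ∑ t ∈ Icc 1 T, ‖filt f (S.state 0 η) t‖ ^ 2 ≤
      4 * Real.exp 8 * (Rinf ^ 2 * τ ^ 3 * RΨ ^ 2) * ∑ t ∈ Icc 1 T, ‖η t‖ ^ 2 := by
    refine hstate.trans (mul_le_mul_of_nonneg_right ?_ hη0)
    -- The gain gives `τ²`; it is relaxed to `Rinf² τ³` using `1 ≤ Rinf` and `1 ≤ τ`.
    calc (frobNorm Ψ * frobNorm Ψ⁻¹) ^ 2 * (2 * #Z * Real.exp 4) ^ 2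
        ≤ RΨ ^ 2 * (2 * τ * Real.exp 4) ^ 2 := by gcongr
      _ = 4 * Real.exp 8 * (1 ^ 2 * (τ ^ 2 * 1) * RΨ ^ 2) := by rw [← he8]; ring
      _ ≤ 4 * Real.exp 8 * (Rinf ^ 2 * (τ ^ 2 * τ) * RΨ ^ 2) := by gcongr
      _ = _ := by ring
  have hobs' : ∑ t ∈ Icc 1 T, ‖filt f ξ t‖ ^ 2 ≤
      Real.exp 8 * (Rinf ^ 2 * τ ^ 3 * RΘ ^ 2 * RΨ ^ 2) * ∑ t ∈ Icc 1 T, ‖ξ t‖ ^ 2 := by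
    refine hobs.trans (mul_le_mul_of_nonneg_right ?_ hξ0)
    rw [he8]
    calc Real.exp 8 = Real.exp 8 * (1 ^ 2 * 1 ^ 3 * 1 ^ 2 * 1 ^ 2) := by ring
      _ ≤ _ := by gcongr
  have hdet : T * (2 * (T * (B * Rx)) ^ 2) ≤
      2 * Real.exp 8 * n * N * RΘ ^ 4 * RΨ ^ 2 * Rx ^ 2 := tail_energy_le hT hTJ RΘ RΨ Rx
  calc _ ≤ _ := sum_le_sum hres
    _ = T * (2 * (T * (B * Rx)) ^ 2) + (4 * RΘ ^ 2 * ∑ t ∈ Icc 1 T, ‖filt f (S.state 0 η) t‖ ^ 2 +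
          4 * ∑ t ∈ Icc 1 T, ‖filt f ξ t‖ ^ 2) := by
        simp only [sum_add_distrib, sum_const, Nat.card_Icc, Nat.add_sub_cancel, nsmul_eq_mul, mul_sum]
    _ ≤ 2 * Real.exp 8 * n * N * RΘ ^ 4 * RΨ ^ 2 * Rx ^ 2 +
          (4 * RΘ ^ 2 * (4 * Real.exp 8 * (Rinf ^ 2 * τ ^ 3 * RΨ ^ 2) * ∑ t ∈ Icc 1 T, ‖η t‖ ^ 2) +
          4 * (Real.exp 8 * (Rinf ^ 2 * τ ^ 3 * RΘ ^ 2 * RΨ ^ 2) * ∑ t ∈ Icc 1 T, ‖ξ t‖ ^ 2)) := by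
        gcongr
    _ ≤ _ := by
        have hc0 : 0 ≤ Real.exp 8 * (Rinf ^ 2 * τ ^ 3 * RΘ ^ 2 * RΨ ^ 2) := by positivity
        have h1 := mul_le_mul_of_nonneg_left hL1 hc0
        have h2 := mul_nonneg hc0 hξ0
        nlinarith

end Competitor

/-! ### Choice of the parameters. -/

section Parameters

open Finset

theorem natLog_two_add_one_le {T : ℕ} (hT : 1 ≤ T) {l : ℝ} (hl : 1 + Real.log T ≤ l) :
    ((Nat.log 2 T + 1 : ℕ) : ℝ) ≤ 2 * l := by
  have h1 : ((2 : ℝ) ^ Nat.log 2 T) ≤ T := by exact_mod_cast Nat.pow_log_le_self 2 (by omega)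
  have h2 := Real.log_le_log (by positivity) h1
  rw [Real.log_pow] at h2
  have h3 := Real.log_two_gt_d9
  have h4 : (0 : ℝ) ≤ Nat.log 2 T := Nat.cast_nonneg _
  push_cast
  nlinarith

/-- The autoregression length used for hidden dimension `d` and horizon `T`. -/
def regressionLength (d T : ℕ) : ℕ :=
  16 * d ^ 2 * (Nat.log 2 T + 1) ^ 2 * (Nat.log 2 d + 1 + (Nat.log 2 T + 1))

section regressionLength

variable {d T : ℕ}

theorem eight_le_regressionLength (hd : 1 ≤ d) : 8 ≤ regressionLength d T := by
  have : 1 ≤ d ^ 2 * (Nat.log 2 T + 1) ^ 2 * (Nat.log 2 d + 1 + (Nat.log 2 T + 1)) :=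
    Nat.mul_pos (by positivity) (by omega)
  calc 8 ≤ 16 * (d ^ 2 * (Nat.log 2 T + 1) ^ 2 * (Nat.log 2 d + 1 + (Nat.log 2 T + 1))) := by omega
    _ = _ := by rw [regressionLength]; ring

/-- With `J = 2b` and `M = dJ`, the left side is the degree of the annihilator plus the waiting time
`2MJ` plus one. Its terms add up to at most `(1 + 4 + 8 + 1) d² b² c`, below the chosen `16 d² b²
c`. -/
theorem le_regressionLength (hd : 1 ≤ d) {b c : ℕ} (hb : b = Nat.log 2 T + 1)
    (hc : c = Nat.log 2 d + 1 + b) :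
    d * (d * c + 2 * b * (d * (2 * b) * c)) + 2 * (d * (2 * b)) * (2 * b) + 1 ≤
      regressionLength d T := by
  have h : regressionLength d T = 16 * (d ^ 2 * b ^ 2 * c) := by
    rw [regressionLength, hc, hb]; ring
  have hb1 : 1 ≤ b ^ 2 := Nat.one_le_pow _ _ (by omega)
  have hc1 : 1 ≤ c := by omega
  have hd1 : d ≤ d ^ 2 := Nat.le_self_pow two_ne_zero d
  have h1 : d ^ 2 * 1 * c ≤ d ^ 2 * b ^ 2 * c := by gcongr
  have h2 : d * b ^ 2 * 1 ≤ d ^ 2 * b ^ 2 * c := by gcongr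
  have h3 : 1 ≤ d ^ 2 * b ^ 2 * c := Nat.mul_pos (Nat.mul_pos (Nat.pow_pos hd) hb1) hc1
  rw [h]
  nlinarith

theorem mul_le_two_pow {b c : ℕ} (hb1 : 1 ≤ b) (hc : c = Nat.log 2 d + 1 + b) :
    d * (2 * b) ≤ 2 ^ c := by
  have h1 : d ≤ 2 ^ (Nat.log 2 d + 1) := (Nat.lt_pow_succ_log_self (by norm_num) d).le
  have h2 : 2 * b ≤ 2 ^ b := by
    induction b, hb1 using Nat.le_induction generalizing c with
    | base => norm_num
    | succ b hb ih =>
      have := ih rfl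
      have : 2 ≤ 2 ^ b := (Nat.pow_le_pow_right (by norm_num) hb : 2 ^ 1 ≤ 2 ^ b)
      rw [pow_succ]; omega
  rw [hc, pow_add]
  exact Nat.mul_le_mul h1 h2

theorem sq_le_two_pow_log : T ^ 2 ≤ 2 ^ (2 * (Nat.log 2 T + 1)) := by
  rw [mul_comm, pow_mul]
  exact Nat.pow_le_pow_left (Nat.lt_pow_succ_log_self (by norm_num) T).le 2

theorem regressionLength_le (hd : 1 ≤ d) (hT : 1 ≤ T) {l : ℝ} (hdl : 1 + Real.log d ≤ l)
    (hTl : 1 + Real.log T ≤ l) : (regressionLength d T : ℝ) ≤ 256 * d ^ 2 * l ^ 3 := by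
  have h1 := natLog_two_add_one_le hd hdl
  have h2 := natLog_two_add_one_le hT hTl
  have hl : 0 ≤ l := by nlinarith [Real.log_natCast_nonneg T]
  calc (regressionLength d T : ℝ) = 16 * d ^ 2 * ((Nat.log 2 T + 1 : ℕ) : ℝ) ^ 2 *
        (((Nat.log 2 d + 1 : ℕ) : ℝ) + ((Nat.log 2 T + 1 : ℕ) : ℝ)) := by
        rw [regressionLength]; push_cast; ring
    _ ≤ 16 * d ^ 2 * (2 * l) ^ 2 * (2 * l + 2 * l) := by gcongr
    _ = _ := by ring

theorem log_regressionLength_le (hd : 1 ≤ d) (hT : 1 ≤ T) {l : ℝ} (hdl : 1 + Real.log d ≤ l)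
    (hTl : 1 + Real.log T ≤ l) : Real.log (regressionLength d T) ≤ 260 * l := by
  have hl : 1 ≤ l := by linarith [Real.log_natCast_nonneg T]
  have hd' : (1 : ℝ) ≤ d := by exact_mod_cast hd
  have hN : (0 : ℝ) < regressionLength d T := by
    exact_mod_cast (by norm_num : 0 < 8).trans_le (eight_le_regressionLength hd)
  have h1 := Real.log_le_log hN (regressionLength_le hd hT hdl hTl)
  rw [Real.log_mul (by positivity) (by positivity), Real.log_mul (by norm_num) (by positivity),
    Real.log_pow, Real.log_pow] at h1
  have h2 := Real.log_le_sub_one_of_pos (by norm_num : (0 : ℝ) < 256)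
  have h3 := Real.log_le_sub_one_of_pos (by linarith : 0 < l)
  push_cast at h1
  linarith

end regressionLength

theorem log_add_eight_le {T : ℕ} (hT : 1 ≤ T) {l : ℝ} (hTl : 1 + Real.log T ≤ l) :
    Real.log ((T + 8 : ℕ) : ℝ) ≤ 9 * l := by
  have hT' : (1 : ℝ) ≤ T := by exact_mod_cast hT
  have h0 := Real.log_natCast_nonneg T
  have h1 : Real.log ((T + 8 : ℕ) : ℝ) ≤ Real.log (9 * T) :=
    Real.log_le_log (by positivity) (by push_cast; linarith)
  rw [Real.log_mul (by norm_num) (by positivity)] at h1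
  have h2 := Real.log_le_sub_one_of_pos (by norm_num : (0 : ℝ) < 9)
  linarith

/-- The parameters of the algorithm. For short horizons the decision set is so small that the
predictions are bounded by `Ry`. -/
noncomputable def algParams (n d T : ℕ) (RΘ RΨ Rx Ry : ℝ) : AlgParams :=
  { τ := regressionLength d T
    k := Nat.log 2 T + 1
    W := T + 8
    -- The threshold `d⁷` is where `d⁶`, the order of the regret term, equals `d^{5/2} √T`.
    radius := if T < d ^ 7 then
        1 / ((Nat.log 2 T + 1) * √((Nat.log 2 T + 1 : ℕ) * (regressionLength d T)) * Rx)
      -- The maximum keeps the radius positive even when no system meets the assumptions; otherwise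
      -- `1 ≤ RΨ`.
      else 3 * Real.exp 4 * regressionLength d T * √n * RΘ ^ 2 * max 1 RΨ
    rate := 1 / (48 * Real.exp 2 * (Real.log ((T + 8 : ℕ) : ℝ) + Real.log (regressionLength d T)) *
      ((Nat.log 2 T + 1) * √((Nat.log 2 T + 1 : ℕ) * (regressionLength d T)) * Rx * Ry) ^ 2) }

theorem algParams_valid {n d T : ℕ} {RΘ RΨ Rx Ry : ℝ} (hn : 1 ≤ n) (hd : 1 ≤ d) (hT : 1 ≤ T)
    (hRΘ : 1 ≤ RΘ) (hRx : 1 ≤ Rx) (hRy : 1 ≤ Ry) :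
    (algParams n d T RΘ RΨ Rx Ry).Valid T := by
  have hN := eight_le_regressionLength (T := T) hd
  have hN0 : (0 : ℝ) < regressionLength d T := by exact_mod_cast (by omega)
  have hlog1 := two_lt_log hN
  have hlog2 := two_lt_log (by omega : 8 ≤ T + 8)
  have he2 := Real.exp_pos 2
  have he4 := Real.exp_pos 4
  have hn' : (0 : ℝ) < n := by exact_mod_cast hn
  refine ⟨by simp only [algParams]; omega, by simp [algParams], ?_, by simp only [algParams]; omega,
    ?_, ?_⟩
  · exact Nat.log_lt_self 2 (by omega)
  · simp only [algParams]
    have : 0 < max 1 RΨ := lt_max_of_lt_left one_pos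
    split_ifs <;> positivity
  · simp only [algParams]
    have : 0 < Real.log ((T + 8 : ℕ) : ℝ) + Real.log (regressionLength d T) := by linarith
    positivity

end Parameters

/-! ### Final numerical bounds for short and long horizons. -/

section Horizons

open Finset

theorem rpow_five_halves (d : ℕ) : (d : ℝ) ^ (5 / 2 : ℝ) = √d ^ 5 := by
  rw [Real.sqrt_eq_rpow, ← Real.rpow_natCast, ← Real.rpow_mul (Nat.cast_nonneg d)]
  norm_num

theorem sqrt_pow_seven (d : ℕ) : √((d : ℝ) ^ 7) = √d ^ 7 := by
  rw [Real.sqrt_eq_iff_mul_self_eq (by positivity) (by positivity)]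
  calc (d : ℝ) ^ 7 = (√d ^ 2) ^ 7 := by rw [Real.sq_sqrt (Nat.cast_nonneg d)]
    _ = _ := by ring

/-- Write `T = √T √T` with one factor at most `d^{7/2} = d · d^{5/2}`; the extra `d` is absorbed in
`R`. -/
theorem short_horizon_le {d n T : ℕ} {l Ry R C : ℝ} (hn : 1 ≤ n) (hl : 1 ≤ l) (hC : 4 ≤ C)
    (hR : Ry ^ 2 * d ≤ R) (hT : T < d ^ 7) :
    4 * Ry ^ 2 * T ≤ C * l ^ 13 * (R * (d : ℝ) ^ (5 / 2 : ℝ) * n * √T) := by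
  have hsT : √(T : ℝ) ≤ √d ^ 7 := by
    rw [← sqrt_pow_seven]
    exact Real.sqrt_le_sqrt (by exact_mod_cast hT.le)
  have hTT : (T : ℝ) = √T * √T := (Real.mul_self_sqrt (Nat.cast_nonneg T)).symm
  have hdd : (d : ℝ) = √d ^ 2 := (Real.sq_sqrt (Nat.cast_nonneg d)).symm
  have hn' : (1 : ℝ) ≤ n := by exact_mod_cast hn
  have hR0 : 0 ≤ Ry ^ 2 * d := by positivity
  rw [rpow_five_halves]
  calc 4 * Ry ^ 2 * T = 4 * Ry ^ 2 * (√T * √T) := by rw [← hTT]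
    _ ≤ 4 * Ry ^ 2 * (√d ^ 7 * √T) := by gcongr
    _ = 4 * 1 * ((Ry ^ 2 * √d ^ 2) * √d ^ 5 * 1 * √T) := by ring
    _ = 4 * 1 * ((Ry ^ 2 * d) * √d ^ 5 * 1 * √T) := by rw [← hdd]
    _ ≤ C * l ^ 13 * (R * √d ^ 5 * n * √T) := by
        have hR' : 0 ≤ R := hR0.trans hR
        have := one_le_pow₀ (n := 13) hl
        gcongr

/-- Everything is a multiple of `A`, the product of the squared Lipschitz constant and squared
radius, which is of order `b³ N³ n Q`. As `N` is at most of order `d² l³`, this is `d⁶ l¹²`, and `Λ`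
adds one more logarithm. Finally `d⁶ ≤ d^{5/2} √T`. -/
theorem long_horizon_le {d n T : ℕ} {b N l Λ RΘ RΨ Rx Ry R : ℝ} (hb1 : 1 ≤ b) (hN1 : 1 ≤ N)
    (hb : b ≤ 2 * l) (hN : N ≤ 256 * d ^ 2 * l ^ 3) (hΛ : Λ ≤ 300 * l)
    (hRy : 1 ≤ Ry) (hR : Rx ^ 2 * RΘ ^ 4 * RΨ ^ 2 * Ry ^ 2 ≤ R) (hT : d ^ 7 ≤ T) :
    4 * Real.exp 8 * n * N * RΘ ^ 4 * RΨ ^ 2 * Rx ^ 2 +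
        96 * Real.exp 2 * Λ * (b * √(b * N) * Rx * Ry) ^ 2 *
          (3 * Real.exp 4 * N * √n * RΘ ^ 2 * RΨ) ^ 2 +
        4 * (b * √(b * N) * Rx * Ry) ^ 2 * (3 * Real.exp 4 * N * √n * RΘ ^ 2 * RΨ) ^ 2 ≤
      (30000 * Real.exp 2 * (9 * Real.exp 8 * (8 * 256 ^ 3))) * l ^ 13 *
        (R * (d : ℝ) ^ (5 / 2 : ℝ) * n * √T) := by
  have he8 : Real.exp 4 ^ 2 = Real.exp 8 := by rw [← Real.exp_nat_mul]; norm_num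
  have h8 := Real.exp_pos 8
  have h2 : 1 ≤ Real.exp 2 := by linarith [Real.add_one_le_exp (2 : ℝ)]
  have hl0 : 0 ≤ l := by linarith
  set Q := Rx ^ 2 * RΘ ^ 4 * RΨ ^ 2 * Ry ^ 2 with hQ
  have hQ0 : 0 ≤ Q := by positivity
  set A := (b * √(b * N) * Rx * Ry) ^ 2 * (3 * Real.exp 4 * N * √n * RΘ ^ 2 * RΨ) ^ 2 with hA
  have hAeq : A = 9 * Real.exp 8 * (b ^ 3 * N ^ 3) * n * Q := by
    have e1 : √(b * N) ^ 2 = b * N := Real.sq_sqrt (by positivity)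
    have e2 : √(n : ℝ) ^ 2 = n := Real.sq_sqrt (Nat.cast_nonneg n)
    calc A = 9 * Real.exp 4 ^ 2 * (b ^ 2 * √(b * N) ^ 2 * N ^ 2) * √n ^ 2 * Q := by
          rw [hA, hQ]; ring
      _ = _ := by rw [he8, e1, e2]; ring
  have hA0 : 0 ≤ A := by positivity
  have hfirst : 4 * Real.exp 8 * n * N * RΘ ^ 4 * RΨ ^ 2 * Rx ^ 2 ≤ A := by
    rw [hAeq, hQ]
    have hb3 : 1 ≤ b ^ 3 := one_le_pow₀ hb1
    have hN2 : 1 ≤ N ^ 2 := one_le_pow₀ hN1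
    have hRy2 : 1 ≤ Ry ^ 2 := one_le_pow₀ hRy
    calc 4 * Real.exp 8 * n * N * RΘ ^ 4 * RΨ ^ 2 * Rx ^ 2 =
          4 * Real.exp 8 * (1 * (1 * N)) * n * (Rx ^ 2 * RΘ ^ 4 * RΨ ^ 2 * 1) := by ring
      _ ≤ 9 * Real.exp 8 * (b ^ 3 * (N ^ 2 * N)) * n * (Rx ^ 2 * RΘ ^ 4 * RΨ ^ 2 * Ry ^ 2) := by
          gcongr; norm_num
      _ = _ := by ring
  have hd6 : (d : ℝ) ^ 6 ≤ (d : ℝ) ^ (5 / 2 : ℝ) * √T := by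
    have hsT : √(d : ℝ) ^ 7 ≤ √T := by
      rw [← sqrt_pow_seven]
      exact Real.sqrt_le_sqrt (by exact_mod_cast hT)
    rw [rpow_five_halves]
    calc (d : ℝ) ^ 6 = (√d ^ 2) ^ 6 := by rw [Real.sq_sqrt (Nat.cast_nonneg d)]
      _ = √d ^ 5 * √d ^ 7 := by ring
      _ ≤ _ := by gcongr
  have hAle : A ≤ 9 * Real.exp 8 * (8 * 256 ^ 3) * l ^ 12 *
      (R * (d : ℝ) ^ (5 / 2 : ℝ) * n * √T) := by
    calc A ≤ 9 * Real.exp 8 * ((2 * l) ^ 3 * (256 * d ^ 2 * l ^ 3) ^ 3) * n * R := by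
          rw [hAeq]; gcongr
      _ = 9 * Real.exp 8 * (8 * 256 ^ 3) * l ^ 12 * (R * d ^ 6 * n) := by ring
      _ ≤ 9 * Real.exp 8 * (8 * 256 ^ 3) * l ^ 12 *
          (R * ((d : ℝ) ^ (5 / 2 : ℝ) * √T) * n) := by
          have : 0 ≤ R := hQ0.trans hR
          gcongr
      _ = _ := by ring
  have hcoef : 5 + 96 * Real.exp 2 * Λ ≤ 30000 * Real.exp 2 * l := by
    have : Real.exp 2 * Λ ≤ Real.exp 2 * (300 * l) := by gcongr
    nlinarith
  calc _ = 4 * Real.exp 8 * n * N * RΘ ^ 4 * RΨ ^ 2 * Rx ^ 2 +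
        96 * Real.exp 2 * Λ * A + 4 * A := by rw [hA]; ring
    _ ≤ A + 96 * Real.exp 2 * Λ * A + 4 * A := by gcongr
    _ = (5 + 96 * Real.exp 2 * Λ) * A := by ring
    _ ≤ (30000 * Real.exp 2 * l) * (9 * Real.exp 8 * (8 * 256 ^ 3) * l ^ 12 *
          (R * (d : ℝ) ^ (5 / 2 : ℝ) * n * √T)) := by gcongr
    _ = _ := by ring

theorem one_add_log_le {n m d T : ℕ} {RΘ Rx Ry : ℝ} (hn : 1 ≤ n) (hm : 1 ≤ m) (hd : 1 ≤ d)
    (hT : 1 ≤ T) (hRΘ : 1 ≤ RΘ) (hRx : 1 ≤ Rx) (hRy : 1 ≤ Ry) :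
    1 + Real.log d ≤ 1 + Real.log (n * m * d * RΘ * Rx * Ry * T) ∧
      1 + Real.log T ≤ 1 + Real.log (n * m * d * RΘ * Rx * Ry * T) := by
  have hn' : (1 : ℝ) ≤ n := by exact_mod_cast hn
  have hm' : (1 : ℝ) ≤ m := by exact_mod_cast hm
  have hd' : (1 : ℝ) ≤ d := by exact_mod_cast hd
  have hT' : (1 : ℝ) ≤ T := by exact_mod_cast hT
  constructor
  · refine add_le_add_right (Real.log_le_log (by linarith) ?_) _
    calc (d : ℝ) = 1 * 1 * d * 1 * 1 * 1 * 1 := by ring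
      _ ≤ _ := by gcongr
  · refine add_le_add_right (Real.log_le_log (by linarith) ?_) _
    calc (T : ℝ) = 1 * 1 * 1 * 1 * 1 * 1 * T := by ring
      _ ≤ _ := by gcongr

end Horizons

/-! ### Assembly of the two horizon regimes. -/

theorem mainTheorem1 :
    ∃ (c : ℕ) (C₂ : ℝ), 0 < C₂ ∧ ∀ K : ℝ, ∃ C₁ : ℝ, 0 < C₁ ∧
      ∀ (n m d τ T : ℕ) (RΘ RΨ R₁ Rinf Rx Ry R : ℝ),
        1 ≤ n → 1 ≤ m → 1 ≤ d → 1 ≤ T → (τ : ℝ) ≤ K * d →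
        1 ≤ RΘ → 1 ≤ Rx → 1 ≤ Ry →
        R₁ ^ 3 * Rx ^ 2 * RΘ ^ 4 * RΨ ^ 2 * Ry ^ 2 ≤ R →
        ∃ a : AlgParams, a.Valid T ∧
          ∀ (S : LDS n m d), S.SatisfiesAssumptions τ RΘ RΨ R₁ Rinf →
          ∀ (x : ℕ → EuclideanSpace ℝ (Fin n)) (η : ℕ → EuclideanSpace ℝ (Fin d))
            (ξ : ℕ → EuclideanSpace ℝ (Fin m)) (L : ℝ),
            (∀ t ∈ Finset.Icc 1 T, ‖x t‖ ≤ Rx) →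
            (∀ t ∈ Finset.Icc 1 T, ‖S.output x η ξ t‖ ≤ Ry) →
            ∑ t ∈ Finset.Icc 1 T, (‖η t‖ ^ 2 + ‖ξ t‖ ^ 2) ≤ L →
          ∀ (σ : Fin a.k → ℝ) (φ : Fin a.k → EuclideanSpace ℝ (Fin T)),
            IsTopEigenpairs T a.k σ φ →
          ∀ θ : ℕ → PseudoLDS n m a.τ a.k a.W,
            a.IsRun σ φ x (S.output x η ξ) θ →
            ∑ t ∈ Finset.Icc 1 T,
                ‖(θ t).predict σ φ x (S.output x η ξ) t - S.output x η ξ t‖ ^ 2 ≤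
              C₁ * (1 + Real.log (n * m * d * RΘ * Rx * Ry * T)) ^ c *
                  (R * (d : ℝ) ^ (5 / 2 : ℝ) * n * √T) +
                C₂ * (Rinf ^ 2 * (τ : ℝ) ^ 3 * RΘ ^ 2 * RΨ ^ 2 * L) := by
  have h2 : 1 ≤ Real.exp 2 := by linarith [Real.add_one_le_exp (2 : ℝ)]
  have h8 : 1 ≤ Real.exp 8 := by linarith [Real.add_one_le_exp (8 : ℝ)]
  -- The exponent is twelve logarithms from `(bN)³` and one from the learning rate. The noise
  -- constant is twice the competitor's `16 e⁸`.
  refine ⟨13, 32 * Real.exp 8, by positivity, fun K =>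
    ⟨30000 * Real.exp 2 * (9 * Real.exp 8 * (8 * 256 ^ 3)), by positivity, ?_⟩⟩
  intro n m d τ T RΘ RΨ R₁ Rinf Rx Ry R hn hm hd hT _ hRΘ hRx hRy hR
  refine ⟨algParams n d T RΘ RΨ Rx Ry, algParams_valid hn hd hT hRΘ hRx hRy, ?_⟩
  intro S hS x η ξ L hx hy hL σ φ hσφ θ hrun
  obtain ⟨hR₁, hRinf, hRΨ, hdΨ⟩ := hS.bounds hd
  obtain ⟨hdl, hTl⟩ := one_add_log_le hn hm hd hT hRΘ hRx hRy
  set l := 1 + Real.log (n * m * d * RΘ * Rx * Ry * T) with hl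
  have hl1 : 1 ≤ l := by linarith [Real.log_natCast_nonneg T]
  have hQR : Rx ^ 2 * RΘ ^ 4 * RΨ ^ 2 * Ry ^ 2 ≤ R := by
    refine le_trans ?_ hR
    have h1 : 1 ≤ R₁ ^ 3 := one_le_pow₀ hR₁
    calc _ = 1 * Rx ^ 2 * RΘ ^ 4 * RΨ ^ 2 * Ry ^ 2 := by ring
      _ ≤ _ := by gcongr
  have hL0 : 0 ≤ L := le_trans (by positivity) hL
  have hN8 := eight_le_regressionLength (T := T) hd
  have hN1 : (1 : ℝ) ≤ regressionLength d T := by exact_mod_cast (by omega)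
  have hb1 : (1 : ℝ) ≤ ((Nat.log 2 T + 1 : ℕ) : ℝ) := by exact_mod_cast Nat.le_add_left 1 _
  have hcast : ((Nat.log 2 T + 1 : ℕ) : ℝ) = (Nat.log 2 T : ℝ) + 1 := by push_cast; ring
  rcases lt_or_ge T (d ^ 7) with hTd | hTd
  · have hrad : (Nat.log 2 T + 1) * √((algParams n d T RΘ RΨ Rx Ry).k *
        (algParams n d T RΘ RΨ Rx Ry).τ) * Rx * Ry * (algParams n d T RΘ RΨ Rx Ry).radius ≤ Ry := by
      simp only [algParams, if_pos hTd]
      have h3 : 0 < √(((Nat.log 2 T + 1 : ℕ) : ℝ) * (regressionLength d T)) :=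
        Real.sqrt_pos.2 (by positivity)
      refine le_of_eq ?_
      field_simp
    have h1 := hrun.sum_loss_le_of_small (by simp [algParams])
      (by simp only [algParams]; omega) hσφ hRx hRy hx hy hrad
    have hRd : Ry ^ 2 * d ≤ R := by
      refine le_trans ?_ hQR
      have hx2 : 1 ≤ Rx ^ 2 := one_le_pow₀ hRx
      have hθ4 : 1 ≤ RΘ ^ 4 := one_le_pow₀ hRΘ
      calc Ry ^ 2 * d = 1 * 1 * d * Ry ^ 2 := by ring
        _ ≤ _ := by gcongr
    have h3 := short_horizon_le (C := 30000 * Real.exp 2 * (9 * Real.exp 8 * (8 * 256 ^ 3)))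
      hn hl1 (by nlinarith) hRd hTd
    have h4 : 0 ≤ 32 * Real.exp 8 * (Rinf ^ 2 * (τ : ℝ) ^ 3 * RΘ ^ 2 * RΨ ^ 2 * L) := by positivity
    linarith
  · have hradius : (algParams n d T RΘ RΨ Rx Ry).radius =
        3 * Real.exp 4 * regressionLength d T * √n * RΘ ^ 2 * RΨ := by
      simp only [algParams, if_neg (not_lt.2 hTd), max_eq_right hRΨ]
    -- The choice of `J` gives `2^J ≥ T²`, and that of `c` gives `2^c ≥ dJ`, the width parameter of
    -- the narrow notches.
    obtain ⟨ϑ, hϑ, hϑreg, hϑloss⟩ := hS.exists_competitor (T := T) (N := regressionLength d T)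
      (J := 2 * (Nat.log 2 T + 1)) (c := Nat.log 2 d + 1 + (Nat.log 2 T + 1))
      (W := T + 8) hn hd hRΘ (Nat.log 2 T + 1) (by omega) (by omega)
      (mul_le_two_pow (by omega) rfl) (le_regressionLength hd rfl rfl) hN8 (by omega) hT
      sq_le_two_pow_log
    set Λ := Real.log ((T + 8 : ℕ) : ℝ) + Real.log (regressionLength d T) with hΛ
    have hlogW := two_lt_log (by omega : 8 ≤ T + 8)
    have hlogN := two_lt_log hN8
    have hΛle : Λ ≤ 300 * l := by
      linarith [log_add_eight_le hT hTl, log_regressionLength_le hd hT hdl hTl]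
    set G := ((Nat.log 2 T : ℝ) + 1) *
      √((Nat.log 2 T + 1 : ℕ) * (regressionLength d T)) * Rx * Ry with hG
    have hsn : 1 ≤ √(n : ℝ) := Real.one_le_sqrt.2 (by exact_mod_cast hn)
    have hrad1 : 1 ≤ (algParams n d T RΘ RΨ Rx Ry).radius := by
      rw [hradius]
      have h4 : 1 ≤ Real.exp 4 := by linarith [Real.add_one_le_exp (4 : ℝ)]
      have hθ2 : 1 ≤ RΘ ^ 2 := one_le_pow₀ hRΘ
      calc (1 : ℝ) = 1 * 1 * 1 * 1 * 1 * 1 := by norm_num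
        _ ≤ _ := by gcongr; norm_num
    have hmain := hrun.sum_loss_le (Λ := Λ) (G := G) hT (by simp [algParams])
      (by simp only [algParams]; omega) hN8 hσφ hRx hRy hx hy
      (by simp only [algParams]; linarith) (by simp only [algParams]; linarith) rfl rfl hrad1
      (ϑ := ϑ) (hϑ.trans hradius.ge)
    have hcomp := hϑloss x η ξ L Rx (by linarith) hx hL σ φ
    have hnum := long_horizon_le (n := n) hb1 hN1 (natLog_two_add_one_le hT hTl)
      (regressionLength_le hd hT hdl hTl) hΛle hRy hQR hTd
    rw [hcast] at hnum
    rw [hradius] at hmain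
    have hGeq : G = ((Nat.log 2 T : ℝ) + 1) * √(((Nat.log 2 T : ℝ) + 1) * regressionLength d T) *
        Rx * Ry := by rw [hG, hcast]
    rw [← hGeq] at hnum
    have hregle : 96 * Real.exp 2 * Λ * G ^ 2 * ϑ.regularizer ≤ 96 * Real.exp 2 * Λ * G ^ 2 *
        (3 * Real.exp 4 * regressionLength d T * √n * RΘ ^ 2 * RΨ) ^ 2 :=
      mul_le_mul_of_nonneg_left hϑreg (by
        have : 0 < Λ := by linarith
        positivity)
    refine hmain.trans ?_
    have hcomp2 := mul_le_mul_of_nonneg_left hcomp (by norm_num : (0 : ℝ) ≤ 2)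
    refine (add_le_add (add_le_add hcomp2 hregle) le_rfl).trans ?_
    linarith
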